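/- Notation. Write $x=(x_h,x_3)\in\mathbb R^2\times\mathbb R$, and let $\varphi\in C_c^\infty((\tfrac34,\tfrac83))$ be real valued with $\sum_{j\in\mathbb Z}\varphi(2^{-j}\tau)=1$ for all $\tau>0$. For $k,l\in\mathbb Z$ put $$\Delta^h_k a=\mathcal F^{-1}(\varphi(2^{-k}|\xi_h|)\hat a),\quad \Delta^v_l a=\mathcal F^{-1}(\varphi(2^{-l}|\xi_3|)\hat a),\quad S^h_k a=\sum_{k'\le k-1}\Delta^h_{k'}a .$$ For $p\in[2,\infty)$ let $B_p=B^{-1+\frac2p,\frac12}_p$ be the space of (vector-valued) distributions on $\mathbb R^3$ that is the completion of the Schwartz class $\mathcal S(\mathbb R^3)$ for the norm $$\|a\|_{B_p}=\sum_{l\in\mathbb Z}2^{\frac l2}\Big(\sum_{k\ge l-1}2^{(-2+\frac4p)k}\|\Delta^h_k\Delta^v_l a\|_{L^p_h(L^2_v)}^2\Big)^{\frac12}+\sum_{j\in\mathbb Z}2^{\frac j2}\|S^h_{j-1}\Delta^v_j a\|_{L^2(\mathbb R^3)} .$$ For $\nu_h>0$, $\nu_3\ge0$ and $a\in B_p$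 let $$a_{hh}=\sum_{k\ge l-1}\Delta^h_k\Delta^v_l a,\qquad a_F(t)=e^{\nu_h t\Delta_h+\nu_3 t\partial_3^2}a_{hh},\qquad \Delta_h=\partial_1^2+\partial_2^2,$$ $$[a]_{E^p_T}=\|a\|_{B_p}+\int_0^T\sum_{j\in\mathbb Z}2^{\frac j2}\|\Delta^v_j(a_F\cdot\nabla a_F)\|_{L^2(\mathbb R^3)}\,dt,\qquad T\in(0,\infty].$$ Proposition. There is a constant $C>0$, depending only on $\varphi$, such that for all $p\in[2,4]$, $\nu_h>0$, $\nu_3\ge0$ and every vector field $a\in B_p$ the series defining $a_{hh}$ converges in $\mathcal S'(\mathbb R^3)$, $$\sum_{j\in\mathbb Z}2^{\frac j2}\int_0^\infty\|\Delta^v_j(a_F\cdot\nabla a_F)\|_{L^2(\mathbb R^3)}\,dt\le C\nu_h^{-1}\|a\|_{B_p}^2,$$ and $$[a]_{E^p_\infty}\le C\big(\|a\|_{B_p}+\nu_h^{-1}\|a\|_{B_p}^2\big).$$ Consequently, for every $c>0$ there is $c'>0$, depending only on $c$ and $\varphi$, such that for all such $p,\nu_h,\nu_3$ and $a$, $\|a\|_{B_p}\le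 c'\nu_h$ implies $[a]_{E^p_\infty}\le c\,\nu_h$. -/

import Mathlib

open MeasureTheory Filter
open scoped SchwartzMap LineDeriv ENNReal ContDiff Topology

noncomputable section

namespace ANS

/-- Physical space `ℝ³`; a point is `x = (x_h, x_3)` with `x_h = (x 0, x 1)` and `x_3 = x 2`. -/
abbrev Space := EuclideanSpace ℝ (Fin 3)

/-- Values of a vector field. Complex values are allowed, so that real fields are included. -/
abbrev Vec := EuclideanSpace ℂ (Fin 3)

/-- The profile of the dyadic decomposition: `φ ∈ 𝓓((3/4, 8/3))` and `∑_j φ(2^{-j} τ) = 1`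
for every `τ > 0`. -/
structure IsDyadicProfile (φ : ℝ → ℝ) : Prop where
  contDiff : ContDiff ℝ ∞ φ
  hasCompactSupport : HasCompactSupport φ
  tsupport_subset : tsupport φ ⊆ Set.Ioo (3 / 4) (8 / 3)
  partition : ∀ τ : ℝ, 0 < τ → HasSum (fun j : ℤ ↦ φ ((2 : ℝ) ^ (-j) * τ)) 1

/-- The length `|ξ_h|` of the horizontal part of a frequency. -/
def horNorm (ξ : Space) : ℝ := √(ξ 0 ^ 2 + ξ 1 ^ 2)

/-- The Fourier multiplier `𝓕⁻¹ (m(ξ) 𝓕 a)` for the Fourier transform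
`𝓕 a (ξ) = ∫ e^{-i x·ξ} a(x) dx`. Mathlib's transform is `∫ e^{-2πi x·η} a(x) dx`, so that
`ξ = 2π η`. -/
def multiplier (m : Space → ℝ) : 𝓢'(Space, Vec) →L[ℂ] 𝓢'(Space, Vec) :=
  TemperedDistribution.fourierMultiplierCLM Vec
    (fun η : Space ↦ ((m ((2 * Real.pi) • η) : ℝ) : ℂ))

/-- The symbol `φ(2^{-k} |ξ_h|)`. -/
def horSymbol (φ : ℝ → ℝ) (k : ℤ) (ξ : Space) : ℝ := φ ((2 : ℝ) ^ (-k) * horNorm ξ)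

/-- The symbol `φ(2^{-l} |ξ_3|)`. -/
def verSymbol (φ : ℝ → ℝ) (l : ℤ) (ξ : Space) : ℝ := φ ((2 : ℝ) ^ (-l) * |ξ 2|)

open Classical in
/-- The symbol `∑_{k' ≤ k - 1} φ(2^{-k'} |ξ_h|)`. For small `|ξ_h| ≠ 0` the sum equals `1`, and
on the null set `ξ_h = 0` the symbol takes this value too, which makes it smooth. -/
def horLowSymbol (φ : ℝ → ℝ) (k : ℤ) (ξ : Space) : ℝ :=
  if horNorm ξ = 0 then 1 else ∑' k' : Set.Iic (k - 1), horSymbol φ k' ξ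

/-- The horizontal block `Δ^h_k`. -/
def deltaH (φ : ℝ → ℝ) (k : ℤ) : 𝓢'(Space, Vec) →L[ℂ] 𝓢'(Space, Vec) :=
  multiplier (horSymbol φ k)

/-- The vertical block `Δ^v_l`. -/
def deltaV (φ : ℝ → ℝ) (l : ℤ) : 𝓢'(Space, Vec) →L[ℂ] 𝓢'(Space, Vec) :=
  multiplier (verSymbol φ l)

/-- The horizontal low frequency cut-off `S^h_k`. -/
def lowH (φ : ℝ → ℝ) (k : ℤ) : 𝓢'(Space, Vec) →L[ℂ] 𝓢'(Space, Vec) :=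
  multiplier (horLowSymbol φ k)

/-- The tempered distribution `T` is the locally integrable function `f`. -/
def Represents (T : 𝓢'(Space, Vec)) (f : Space → Vec) : Prop :=
  LocallyIntegrable f volume ∧
    ∀ ψ : 𝓢(Space, ℂ), Integrable (fun x ↦ ψ x • f x) volume ∧ T ψ = ∫ x, ψ x • f x

/-- The `L²(ℝ³)` norm of a tempered distribution; it is `∞` if the distribution is not a
function. -/
def normL2 (T : 𝓢'(Space, Vec)) : ℝ≥0∞ :=
  ⨅ (f : Space → Vec) (_ : Represents T f), eLpNorm f 2 volume

/-- The `L^p_h(L²_v)` norm of a function, that is the `L^p(ℝ²)` norm of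
`x_h ↦ ‖f(x_h, ·)‖_{L²(ℝ)}`. -/
def mixedNormFun (p : ℝ) (f : Space → Vec) : ℝ≥0∞ :=
  (∫⁻ y : EuclideanSpace ℝ (Fin 2),
    (∫⁻ z : ℝ, ‖f (!₂[y 0, y 1, z] : Space)‖ₑ ^ (2 : ℝ)) ^ (p / 2)) ^ (1 / p)

/-- The `L^p_h(L²_v)` norm of a tempered distribution; it is `∞` if the distribution is not a
function. -/
def mixedNorm (p : ℝ) (T : 𝓢'(Space, Vec)) : ℝ≥0∞ :=
  ⨅ (f : Space → Vec) (_ : Represents T f), mixedNormFun p f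

/-- The norm of `B^{-1+2/p, 1/2}_p`. -/
def besovNorm (φ : ℝ → ℝ) (p : ℝ) (a : 𝓢'(Space, Vec)) : ℝ≥0∞ :=
  (∑' l : ℤ, (2 : ℝ≥0∞) ^ ((l : ℝ) / 2) *
    (∑' k : Set.Ici (l - 1), (2 : ℝ≥0∞) ^ ((-2 + 4 / p) * ((k : ℤ) : ℝ)) *
      mixedNorm p (deltaH φ k (deltaV φ l a)) ^ (2 : ℝ)) ^ (1 / 2 : ℝ)) +
  ∑' j : ℤ, (2 : ℝ≥0∞) ^ ((j : ℝ) / 2) * normL2 (lowH φ (j - 1) (deltaV φ j a))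

/-- The space `B^{-1+2/p, 1/2}_p`, the completion of `𝓢(ℝ³)` for the norm `besovNorm φ p`, realized
in the tempered distributions: its elements are the distributions of finite norm that are limits of
Schwartz fields both in the sense of distributions and in this norm. -/
def MemBesov (φ : ℝ → ℝ) (p : ℝ) (a : 𝓢'(Space, Vec)) : Prop :=
  besovNorm φ p a < ⊤ ∧
    ∃ u : ℕ → 𝓢(Space, Vec),
      Tendsto (fun n ↦ (u n : 𝓢'(Space, Vec))) atTop (𝓝 a) ∧
      Tendsto (fun n ↦ besovNorm φ p (a - (u n : 𝓢'(Space, Vec)))) atTop (𝓝 0)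

/-- The terms `Δ^h_k Δ^v_l a`, `k ≥ l - 1`, of the series that defines `a_hh`. -/
def highBlock (φ : ℝ → ℝ) (a : 𝓢'(Space, Vec)) (q : {q : ℤ × ℤ // q.2 - 1 ≤ q.1}) :
    𝓢'(Space, Vec) :=
  deltaH φ q.1.1 (deltaV φ q.1.2 a)

/-- `a_hh = ∑_{k ≥ l - 1} Δ^h_k Δ^v_l a`, a series in the tempered distributions. -/
def highPart (φ : ℝ → ℝ) (a : 𝓢'(Space, Vec)) : 𝓢'(Space, Vec) := ∑' q, highBlock φ a q

/-- The semigroup `e^{ν_h t Δ_h + ν_3 t ∂_3²}`, `t ≥ 0`. -/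
def heat (νh ν3 t : ℝ) : 𝓢'(Space, Vec) →L[ℂ] 𝓢'(Space, Vec) :=
  multiplier (fun ξ ↦ Real.exp (-(νh * t * horNorm ξ ^ 2 + ν3 * t * ξ 2 ^ 2)))

/-- `a_F(t) = e^{ν_h t Δ_h + ν_3 t ∂_3²} a_hh`. -/
def heatFlow (φ : ℝ → ℝ) (νh ν3 : ℝ) (a : 𝓢'(Space, Vec)) (t : ℝ) : 𝓢'(Space, Vec) :=
  heat νh ν3 t (highPart φ a)

/-- `N = u · ∇u = ∑_m u^m ∂_m u`, where `u` and its partial derivatives (in the sense of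
distributions) are functions and `N` is the distribution given by the pointwise product. Such an
`N` is unique. -/
def IsAdvection (u N : 𝓢'(Space, Vec)) : Prop :=
  ∃ (f : Space → Vec) (g : Fin 3 → Space → Vec),
    Represents u f ∧
    (∀ m, Represents (∂_{EuclideanSpace.single m (1 : ℝ)} u) (g m)) ∧
    Represents N (fun x ↦ ∑ m, f x m • g m x)

/-- `‖Δ^v_j (u · ∇u)‖_{L²(ℝ³)}`; it is `∞` if the product `u · ∇u` is not defined. -/
def advectionNorm (φ : ℝ → ℝ) (j : ℤ) (u : 𝓢'(Space, Vec)) : ℝ≥0∞ :=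
  ⨅ (N : 𝓢'(Space, Vec)) (_ : IsAdvection u N), normL2 (deltaV φ j N)

/-- `[a]_{E^p_T}`, `T ∈ (0, ∞]`: the Besov norm of `a` plus
`∫_0^T ∑_j 2^{j/2} ‖Δ^v_j (a_F · ∇a_F)‖_{L²} dt`. -/
def bracketE (φ : ℝ → ℝ) (p νh ν3 : ℝ) (T : ℝ≥0∞) (a : 𝓢'(Space, Vec)) : ℝ≥0∞ :=
  besovNorm φ p a +
    ∫⁻ t in {t : ℝ | 0 < t ∧ ENNReal.ofReal t < T},
      ∑' j : ℤ, (2 : ℝ≥0∞) ^ ((j : ℝ) / 2) * advectionNorm φ j (heatFlow φ νh ν3 a t)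

end ANS

end

/-!
The estimate is a paraproduct-free bilinear estimate on frequency blocks, driven by the smoothing
of the heat semigroup in the horizontal variables only; this is why `ν3 = 0` is allowed.

Let `q = (k, l)` with `k ≥ l - 1`, let `T_q = Δ^h_k Δ^v_l a`, and let
`β k l = 2^{l/2} 2^{(-1 + 2/p) k} ‖T_q‖_{L^p_h(L²_v)}`, so that `∑_l (∑_k β(k, l)²)^{1/2} ≤ ‖a‖`.

* The heat semigroup acts on `T_q` by convolution with an anisotropically dilated Schwartz kernel,
  bounded by `e^{-ν_h t 4^k / 8}` times a product of integrable weights, uniformly in `ν_3`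
  (`IsCutoff.exists_kernel_le`, `IsDyadicProfile.heat_block`). A derivative `∂_m` costs at most
  `2 · 2^k`, because `l ≤ k + 1` (`IsDyadicProfile.lineDeriv_heat_block`, `derivScale_le`).
* For `2 ≤ p ≤ 4`, Bernstein's inequality in the horizontal variables bounds the `L^4_h(L²_v)` norm
  of a block by `2^{(k - l)/2} β` (`lintegral_horConv_freq_sq_le`). Estimating the block of smaller
  vertical frequency in `L^4_h(L^∞_v)` and the other one in `L^4_h(L²_v)`, the product of the heated
  blocks `q` and `∇ q'` is at most
  `e^{-ν_h t (4^k + 4^{k'}) / 8} 2^{k'} 2^{(k + k' - max(l, l')) / 2} β β'` in `L²`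
  (`exists_eLpNorm_blocks_le`).
* The Fourier support of this product is contained in `|ξ_3| ≤ 6 · 2^{max(l, l')}`, so that `Δ^v_j`
  sees it only for `j < max(l, l') + 3` (`fourierMultiplier_mul_kconv_eq_zero`,
  `IsDyadicProfile.exists_advectionNorm_le`). The sum of `2^{j/2}` over these `j` absorbs the
  factor `2^{-max(l, l')/2}`.
* The time integral yields `ν_h⁻¹ 4^{-max(k, k')}`, and what remains is the kernel `2^{-|k - k'|/2}`
  in the horizontal frequencies, bounded on `ℓ²` by Schur's test
  (`tsum_lintegral_pairBound_le`).

Only the part `k ≥ l - 1` of the Besov norm is used. That the products and series make sense is part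
of the claim: for `t > 0` the heated blocks and their derivatives are summable in the sup norm, so
`a_F · ∇a_F` is the absolutely convergent series of the products
(`exists_isAdvection_hasSum`), and at `t = 0` the blocks with `k ≥ 0` are horizontal Laplacians of a
family summable in the sup norm (`IsDyadicProfile.summable_highBlock`).
-/

noncomputable section

namespace ANS

open FourierTransform

/-! ### Anisotropic dilations and cutoffs -/

/-- The anisotropic dilation `(x_h, x_3) ↦ (a x_h, b x_3)`. -/
def dil (a b : ℝ) : Space →L[ℝ] Space :=
  LinearMap.toContinuousLinearMap
    { toFun := fun x ↦ !₂[a * x 0, a * x 1, b * x 2]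
      map_add' := fun x y ↦ by ext i; fin_cases i <;> simp <;> ring
      map_smul' := fun c x ↦ by ext i; fin_cases i <;> simp <;> ring }

@[simp] theorem dil_zero_apply (a b : ℝ) (x : Space) : dil a b x 0 = a * x 0 := rfl
@[simp] theorem dil_one_apply (a b : ℝ) (x : Space) : dil a b x 1 = a * x 1 := rfl
@[simp] theorem dil_two_apply (a b : ℝ) (x : Space) : dil a b x 2 = b * x 2 := rfl

theorem dil_inv_dil {a b : ℝ} (ha : 0 < a) (hb : 0 < b) (x : Space) :
    dil a⁻¹ b⁻¹ (dil a b x) = x := by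
  ext i; fin_cases i <;> simp <;> field_simp

theorem dil_dil_inv {a b : ℝ} (ha : 0 < a) (hb : 0 < b) (x : Space) :
    dil a b (dil a⁻¹ b⁻¹ x) = x := by
  ext i; fin_cases i <;> simp <;> field_simp

theorem norm_sq_eq (x : Space) : ‖x‖ ^ 2 = x 0 ^ 2 + x 1 ^ 2 + x 2 ^ 2 := by
  rw [EuclideanSpace.norm_sq_eq, Fin.sum_univ_three]; simp

theorem inner_eq (x y : Space) : inner ℝ x y = x 0 * y 0 + x 1 * y 1 + x 2 * y 2 := by
  rw [PiLp.inner_apply, Fin.sum_univ_three]; simp; ring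

/-- The dilation `dil a b` divides Lebesgue measure by `a² b`. -/
theorem map_dil_volume {a b : ℝ} (ha : 0 < a) (hb : 0 < b) :
    ENNReal.ofReal (a ^ 2 * b) • Measure.map (dil a b) volume = (volume : Measure Space) := by
  set D : Fin 3 → ℝ := ![a, a, b]
  have hdet : (Matrix.diagonal D).det = a ^ 2 * b := by
    simp [D, Matrix.det_diagonal, Fin.prod_univ_three, pow_two]
  have h := Real.smul_map_diagonal_volume_pi (D := D) (by rw [hdet]; positivity)
  rw [hdet, abs_of_pos (by positivity)] at h
  have e : (dil a b : Space → Space) =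
      (WithLp.toLp 2) ∘ (Matrix.toLin' (Matrix.diagonal D)) ∘ (WithLp.ofLp) := by
    ext x i
    fin_cases i <;> simp [D, Matrix.mulVec_diagonal]
  have m1 := PiLp.volume_preserving_ofLp (Fin 3)
  have m2 := PiLp.volume_preserving_toLp (Fin 3)
  have hm : Measurable (Matrix.toLin' (Matrix.diagonal D)) :=
    (LinearMap.continuous_on_pi _).measurable
  rw [e, ← Measure.map_map m2.measurable (hm.comp m1.measurable),
    ← Measure.map_map hm m1.measurable, m1.map_eq, ← Measure.map_smul, h, m2.map_eq]

theorem integral_comp_dil {E : Type*} [NormedAddCommGroup E] [NormedSpace ℝ E] {a b : ℝ}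
    (ha : 0 < a) (hb : 0 < b) (g : Space → E) :
    ∫ x, g x = (a ^ 2 * b) • ∫ x, g (dil a b x) := by
  let e : Space ≃ₜ Space :=
    { toFun := dil a b, invFun := dil a⁻¹ b⁻¹
      left_inv := dil_inv_dil ha hb, right_inv := dil_dil_inv ha hb
      continuous_toFun := (dil a b).continuous
      continuous_invFun := (dil a⁻¹ b⁻¹).continuous }
  conv_lhs => rw [← map_dil_volume ha hb]
  rw [integral_smul_measure, ENNReal.toReal_ofReal (by positivity)]
  congr 1
  exact e.isClosedEmbedding.measurableEmbedding.integral_map g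

/-- Smooth symbols supported where both `|ζ_h|` and `|ζ_3|` lie in `[1/2, 3]`. -/
structure IsCutoff (χ : Space → ℂ) : Prop where
  contDiff : ContDiff ℝ ∞ χ
  bounds : ∀ ζ, χ ζ ≠ 0 → 1 / 4 ≤ ζ 0 ^ 2 + ζ 1 ^ 2 ∧ ζ 0 ^ 2 + ζ 1 ^ 2 ≤ 9 ∧
    1 / 4 ≤ ζ 2 ^ 2 ∧ ζ 2 ^ 2 ≤ 9

/-- The exponent `τ |ζ_h|² + σ ζ_3²` of the heat symbol. -/
def quad (τ σ : ℝ) (ζ : Space) : ℝ := τ * (ζ 0 ^ 2 + ζ 1 ^ 2) + σ * ζ 2 ^ 2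

/-- The symbol `e^{-(τ |ζ_h|² + σ ζ_3²)} χ(ζ)`. -/
def damp (χ : Space → ℂ) (τ σ : ℝ) (ζ : Space) : ℂ := Real.exp (-quad τ σ ζ) • χ ζ

theorem contDiff_quad (τ σ : ℝ) : ContDiff ℝ ∞ (quad τ σ) := by
  unfold quad; fun_prop

theorem IsCutoff.tsupport_bounds {χ : Space → ℂ} (h : IsCutoff χ) {ζ : Space}
    (hζ : ζ ∈ tsupport χ) : 1 / 4 ≤ ζ 0 ^ 2 + ζ 1 ^ 2 ∧ ζ 0 ^ 2 + ζ 1 ^ 2 ≤ 9 ∧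
    1 / 4 ≤ ζ 2 ^ 2 ∧ ζ 2 ^ 2 ≤ 9 := by
  have hc : IsClosed {ζ : Space | 1 / 4 ≤ ζ 0 ^ 2 + ζ 1 ^ 2 ∧ ζ 0 ^ 2 + ζ 1 ^ 2 ≤ 9 ∧
      1 / 4 ≤ ζ 2 ^ 2 ∧ ζ 2 ^ 2 ≤ 9} := by
    simp only [Set.ofPred_and]
    refine IsClosed.inter (isClosed_le ?_ ?_) (IsClosed.inter (isClosed_le ?_ ?_)
      (IsClosed.inter (isClosed_le ?_ ?_) (isClosed_le ?_ ?_))) <;> fun_prop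
  exact closure_minimal (fun x hx ↦ h.bounds x hx) hc hζ

theorem IsCutoff.damp {χ : Space → ℂ} (h : IsCutoff χ) (τ σ : ℝ) : IsCutoff (damp χ τ σ) where
  contDiff := by
    have := h.contDiff
    have h2 := contDiff_quad τ σ
    unfold ANS.damp
    exact (Real.contDiff_exp.comp h2.neg).smul this
  bounds ζ hζ := h.bounds ζ fun h0 ↦ hζ (by simp [ANS.damp, h0])

theorem IsCutoff.hasCompactSupport {χ : Space → ℂ} (h : IsCutoff χ) : HasCompactSupport χ := by
  refine HasCompactSupport.intro (isCompact_closedBall (0 : Space) 5) fun ζ hζ ↦ ?_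
  by_contra h0
  apply hζ
  have := h.bounds ζ h0
  have h2 := norm_sq_eq ζ
  rw [mem_closedBall_zero_iff]
  nlinarith [norm_nonneg ζ]

theorem IsCutoff.comp_dil {χ : Space → ℂ} (h : IsCutoff χ) {a b : ℝ} (ha : 0 < a) (hb : 0 < b) :
    HasCompactSupport (fun η ↦ χ (dil a⁻¹ b⁻¹ η)) ∧ ContDiff ℝ ∞ (fun η ↦ χ (dil a⁻¹ b⁻¹ η)) := by
  let e : Space ≃ₜ Space :=
    { toFun := dil a⁻¹ b⁻¹, invFun := dil a b
      left_inv := dil_dil_inv ha hb, right_inv := dil_inv_dil ha hb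
      continuous_toFun := (dil a⁻¹ b⁻¹).continuous
      continuous_invFun := (dil a b).continuous }
  exact ⟨h.hasCompactSupport.comp_homeomorph e, h.contDiff.comp (dil a⁻¹ b⁻¹).contDiff⟩

/-- The symbol `χ` as a Schwartz function. -/
def IsCutoff.schwartz {χ : Space → ℂ} (h : IsCutoff χ) : 𝓢(Space, ℂ) :=
  h.hasCompactSupport.toSchwartzMap h.contDiff

/-- The symbol `η ↦ χ(η_h / a, η_3 / b)` as a Schwartz function. -/
def IsCutoff.dilSchwartz {χ : Space → ℂ} (h : IsCutoff χ) {a b : ℝ} (ha : 0 < a) (hb : 0 < b) :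
    𝓢(Space, ℂ) :=
  (h.comp_dil ha hb).1.toSchwartzMap (h.comp_dil ha hb).2

theorem fourierInv_dilSchwartz {χ : Space → ℂ} (h : IsCutoff χ) {a b : ℝ} (ha : 0 < a)
    (hb : 0 < b) (x : Space) :
    𝓕⁻ (h.dilSchwartz ha hb) x = (a ^ 2 * b) • 𝓕⁻ h.schwartz (dil a b x) := by
  rw [SchwartzMap.fourierInv_coe, SchwartzMap.fourierInv_coe, Real.fourierInv_eq,
    Real.fourierInv_eq, integral_comp_dil ha hb]
  congr 1
  refine integral_congr_ae (.of_forall fun ζ ↦ ?_)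
  have h1 : inner ℝ (dil a b ζ) x = inner ℝ ζ (dil a b x) := by
    simp [inner_eq]; ring
  simp [IsCutoff.dilSchwartz, IsCutoff.schwartz, h1, dil_inv_dil ha hb]

/-! ### Kernels of heated cutoffs -/

theorem norm_iteratedFDeriv_exp (n : ℕ) (r : ℝ) :
    ‖iteratedFDeriv ℝ n (fun r : ℝ ↦ Real.exp r) r‖ = Real.exp r := by
  rw [norm_iteratedFDeriv_eq_norm_iteratedDeriv]
  have := congrFun (iteratedDeriv_eq_iterate (f := Real.exp) (n := n)) r
  rw [this, Real.iter_deriv_exp]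
  simp

/-- A polynomial factor is absorbed by half of the exponential decay. -/
theorem exists_pow_mul_exp_le (n : ℕ) (Q : ℝ) (hQ : 0 ≤ Q) :
    ∃ C : ℝ, 0 ≤ C ∧ ∀ y : ℝ, 0 ≤ y → (1 + y * Q) ^ n * Real.exp (-(y / 4)) ≤
      C * Real.exp (-(y / 8)) := by
  refine ⟨(1 + 8 * Q) ^ n * n.factorial * Real.exp 1, by positivity, fun y hy ↦ ?_⟩
  have h1 : (1 + y * Q) ≤ (1 + 8 * Q) * (1 + y / 8) := by nlinarith [mul_nonneg hy hQ]
  have h2 : (1 + y / 8) ^ n / n.factorial ≤ Real.exp (1 + y / 8) :=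
    Real.pow_div_factorial_le_exp _ (by positivity) n
  rw [div_le_iff₀ (by positivity)] at h2
  have e1 : Real.exp (-(y / 4)) = Real.exp (-(y / 8)) * Real.exp (-(y / 8)) := by
    rw [← Real.exp_add]; ring_nf
  have e2 : Real.exp (1 + y / 8) * Real.exp (-(y / 8)) = Real.exp 1 := by
    rw [← Real.exp_add]; ring_nf
  calc (1 + y * Q) ^ n * Real.exp (-(y / 4))
      ≤ ((1 + 8 * Q) * (1 + y / 8)) ^ n * Real.exp (-(y / 4)) := by gcongr
    _ = (1 + 8 * Q) ^ n * ((1 + y / 8) ^ n * Real.exp (-(y / 8))) * Real.exp (-(y / 8)) := by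
        rw [e1, mul_pow]; ring
    _ ≤ (1 + 8 * Q) ^ n * (Real.exp (1 + y / 8) * n.factorial * Real.exp (-(y / 8))) *
          Real.exp (-(y / 8)) := by gcongr
    _ = _ := by rw [mul_right_comm (Real.exp (1 + y / 8)), e2]; ring

/-- On the support of a cutoff, every derivative of `e^{-(τ |ζ_h|² + σ ζ_3²)}` is dominated by
`e^{-τ/8}`, uniformly in `σ ≥ 0`: a derivative costs a power of `τ + σ`, which is absorbed by half
of the exponential, as this is at most `e^{-(τ + σ)/4}`. -/
theorem exists_iteratedFDeriv_exp_quad_le (n : ℕ) :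
    ∃ C : ℝ, 0 ≤ C ∧ ∀ τ σ : ℝ, 0 ≤ τ → 0 ≤ σ → ∀ ζ : Space,
      1 / 4 ≤ ζ 0 ^ 2 + ζ 1 ^ 2 → ζ 0 ^ 2 + ζ 1 ^ 2 ≤ 9 → 1 / 4 ≤ ζ 2 ^ 2 → ζ 2 ^ 2 ≤ 9 →
      ∀ m ≤ n, ‖iteratedFDeriv ℝ m (fun ζ ↦ Real.exp (-quad τ σ ζ)) ζ‖ ≤
        C * Real.exp (-(τ / 8)) := by
  let q1 : Space → ℝ := fun ζ ↦ ζ 0 ^ 2 + ζ 1 ^ 2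
  let q2 : Space → ℝ := fun ζ ↦ ζ 2 ^ 2
  have c1 : ContDiff ℝ ∞ q1 := by fun_prop
  have c2 : ContDiff ℝ ∞ q2 := by fun_prop
  have hb : ∀ i : ℕ, ∃ Q : ℝ, 0 ≤ Q ∧ ∀ ζ ∈ Metric.closedBall (0 : Space) 5,
      ‖iteratedFDeriv ℝ i q1 ζ‖ ≤ Q ∧ ‖iteratedFDeriv ℝ i q2 ζ‖ ≤ Q := by
    intro i
    obtain ⟨A, hA⟩ := (isCompact_closedBall (0 : Space) 5).exists_bound_of_continuousOn
      (c1.continuous_iteratedFDeriv (m := i) (mod_cast le_top)).continuousOn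
    obtain ⟨B, hB⟩ := (isCompact_closedBall (0 : Space) 5).exists_bound_of_continuousOn
      (c2.continuous_iteratedFDeriv (m := i) (mod_cast le_top)).continuousOn
    refine ⟨max 0 (max A B), le_max_left _ _, fun ζ hζ ↦ ⟨(hA ζ hζ).trans ?_, (hB ζ hζ).trans ?_⟩⟩
    · exact (le_max_left _ _).trans (le_max_right _ _)
    · exact (le_max_right _ _).trans (le_max_right _ _)
  choose Q hQ0 hQ using hb
  set S : ℝ := ∑ i ∈ Finset.range (n + 1), Q i with hS
  have hS0 : 0 ≤ S := Finset.sum_nonneg fun i _ ↦ hQ0 i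
  obtain ⟨C, hC0, hC⟩ := exists_pow_mul_exp_le n S hS0
  refine ⟨n.factorial * C, by positivity, fun τ σ hτ hσ ζ h1 h2 h3 h4 m hm ↦ ?_⟩
  have hζ : ζ ∈ Metric.closedBall (0 : Space) 5 := by
    have := norm_sq_eq ζ
    rw [mem_closedBall_zero_iff]
    nlinarith [norm_nonneg ζ]
  have hquad : (fun ζ ↦ -quad τ σ ζ) = fun ζ ↦ (-τ) • q1 ζ + (-σ) • q2 ζ := by
    ext ζ; simp [quad, q1, q2]; ring
  have hD : ∀ i, 1 ≤ i → i ≤ m →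
      ‖iteratedFDeriv ℝ i (fun ζ ↦ -quad τ σ ζ) ζ‖ ≤ (1 + (τ + σ) * S) ^ i := by
    intro i hi him
    have d1 : ContDiffAt ℝ i q1 ζ := (c1.of_le (mod_cast le_top)).contDiffAt
    have d2 : ContDiffAt ℝ i q2 ζ := (c2.of_le (mod_cast le_top)).contDiffAt
    have e : iteratedFDeriv ℝ i (fun ζ ↦ -quad τ σ ζ) ζ =
        (-τ) • iteratedFDeriv ℝ i q1 ζ + (-σ) • iteratedFDeriv ℝ i q2 ζ := by
      rw [hquad, fun_iteratedFDeriv_add_apply (d1.const_smul (-τ)) (d2.const_smul (-σ)),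
        iteratedFDeriv_const_smul_apply' d1,
        iteratedFDeriv_const_smul_apply' d2]
    have hQS : Q i ≤ S := Finset.single_le_sum (f := Q) (fun j _ ↦ hQ0 j)
      (Finset.mem_range.2 (by omega))
    calc ‖iteratedFDeriv ℝ i (fun ζ ↦ -quad τ σ ζ) ζ‖
        ≤ τ * Q i + σ * Q i := by
          rw [e]
          refine (norm_add_le _ _).trans ?_
          rw [norm_smul, norm_smul, norm_neg, norm_neg, Real.norm_of_nonneg hτ,
            Real.norm_of_nonneg hσ]
          gcongr
          · exact (hQ i ζ hζ).1
          · exact (hQ i ζ hζ).2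
      _ ≤ 1 + (τ + σ) * S := by nlinarith
      _ ≤ (1 + (τ + σ) * S) ^ i := le_self_pow₀ (by nlinarith [mul_nonneg (add_nonneg hτ hσ) hS0])
          (by omega)
  have key := norm_iteratedFDeriv_comp_le (𝕜 := ℝ) (g := fun r : ℝ ↦ Real.exp r)
    (f := fun ζ ↦ -quad τ σ ζ) (n := m) (N := ∞) Real.contDiff_exp (contDiff_quad τ σ).neg
    (mod_cast le_top) ζ (C := Real.exp (-quad τ σ ζ)) (D := 1 + (τ + σ) * S)
    (fun i _ ↦ (norm_iteratedFDeriv_exp i _).le) hD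
  have hone : 1 ≤ 1 + (τ + σ) * S := by nlinarith [mul_nonneg (add_nonneg hτ hσ) hS0]
  have hexp : Real.exp (-quad τ σ ζ) ≤ Real.exp (-((τ + σ) / 4)) := by
    apply Real.exp_le_exp.2
    unfold quad
    nlinarith
  calc _ ≤ m.factorial * Real.exp (-quad τ σ ζ) * (1 + (τ + σ) * S) ^ m := key
    _ ≤ n.factorial * Real.exp (-((τ + σ) / 4)) * (1 + (τ + σ) * S) ^ n := by
        gcongr
    _ = n.factorial * ((1 + (τ + σ) * S) ^ n * Real.exp (-((τ + σ) / 4))) := by ring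
    _ ≤ n.factorial * (C * Real.exp (-((τ + σ) / 8))) := by
        exact mul_le_mul_of_nonneg_left (hC _ (add_nonneg hτ hσ)) (by positivity)
    _ ≤ n.factorial * (C * Real.exp (-(τ / 8))) := by gcongr; linarith
    _ = _ := by ring

theorem IsCutoff.exists_seminorm_damp_le {χ : Space → ℂ} (h : IsCutoff χ) (k n : ℕ) :
    ∃ C : ℝ, 0 ≤ C ∧ ∀ τ σ : ℝ, 0 ≤ τ → 0 ≤ σ →
      SchwartzMap.seminorm ℂ k n (h.damp τ σ).schwartz ≤ C * Real.exp (-(τ / 8)) := by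
  obtain ⟨C, hC0, hC⟩ := exists_iteratedFDeriv_exp_quad_le n
  have hb : ∀ i : ℕ, ∃ Q : ℝ, 0 ≤ Q ∧ ∀ ζ, ‖iteratedFDeriv ℝ i χ ζ‖ ≤ Q := by
    intro i
    obtain ⟨Q, hQ⟩ := (h.hasCompactSupport.iteratedFDeriv (𝕜 := ℝ) i).exists_bound_of_continuous
      (h.contDiff.continuous_iteratedFDeriv (m := i) (mod_cast le_top))
    exact ⟨Q, (norm_nonneg _).trans (hQ 0), hQ⟩
  choose Q hQ0 hQ using hb
  set S : ℝ := ∑ i ∈ Finset.range (n + 1), (n.choose i : ℝ) * Q (n - i) with hS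
  have hS0 : 0 ≤ S := Finset.sum_nonneg fun i _ ↦ mul_nonneg (by positivity) (hQ0 _)
  refine ⟨5 ^ k * (C * S), by positivity, fun τ σ hτ hσ ↦ ?_⟩
  refine SchwartzMap.seminorm_le_bound ℂ k n _ (by positivity) fun ζ ↦ ?_
  have hcoe : ⇑(h.damp τ σ).schwartz = ANS.damp χ τ σ := rfl
  rw [hcoe]
  by_cases hζ : ζ ∈ tsupport χ
  · obtain ⟨h1, h2, h3, h4⟩ := h.tsupport_bounds hζ
    have hn : ‖ζ‖ ≤ 5 := by
      have := norm_sq_eq ζ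
      nlinarith [norm_nonneg ζ]
    have key : ‖iteratedFDeriv ℝ n (ANS.damp χ τ σ) ζ‖ ≤ _ :=
      norm_iteratedFDeriv_smul_le (𝕜 := ℝ) (f := fun ζ ↦ Real.exp (-quad τ σ ζ)) (g := χ)
      (N := ∞) (n := n) (Real.contDiff_exp.comp (contDiff_quad τ σ).neg) h.contDiff ζ
      (mod_cast le_top)
    have : ‖iteratedFDeriv ℝ n (ANS.damp χ τ σ) ζ‖ ≤ C * Real.exp (-(τ / 8)) * S := by
      refine key.trans ?_
      rw [hS, Finset.mul_sum]
      refine Finset.sum_le_sum fun i hi ↦ ?_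
      have a1 := hC τ σ hτ hσ ζ h1 h2 h3 h4 i (by simpa [Nat.lt_succ_iff] using hi)
      have a2 := hQ (n - i) ζ
      calc _ ≤ (n.choose i : ℝ) * (C * Real.exp (-(τ / 8))) * Q (n - i) := by gcongr
        _ = _ := by ring
    calc ‖ζ‖ ^ k * ‖iteratedFDeriv ℝ n (ANS.damp χ τ σ) ζ‖
        ≤ 5 ^ k * (C * Real.exp (-(τ / 8)) * S) := by gcongr
      _ = _ := by ring
  · have h0 : iteratedFDeriv ℝ n (ANS.damp χ τ σ) ζ = 0 := by
      by_contra hne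
      apply hζ
      have h1 := support_iteratedFDeriv_subset (𝕜 := ℝ) n hne
      refine closure_mono ?_ h1
      intro z hz hz0
      exact hz (by simp [ANS.damp, hz0])
    rw [h0, norm_zero, mul_zero]
    positivity

/-- The kernel of `e^{-(τ |ζ_h|² + σ ζ_3²)} χ(ζ)` decays rapidly and is of size `e^{-τ/8}`,
uniformly in `τ, σ ≥ 0`. -/
theorem IsCutoff.exists_kernel_le {χ : Space → ℂ} (h : IsCutoff χ) :
    ∃ C : ℝ, 0 ≤ C ∧ ∀ τ σ : ℝ, 0 ≤ τ → 0 ≤ σ → ∀ x : Space,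
      (1 + ‖x‖) ^ 8 * ‖𝓕⁻ (h.damp τ σ).schwartz x‖ ≤ C * Real.exp (-(τ / 8)) := by
  -- the weighted sup norm of the inverse Fourier transform is a continuous seminorm
  let q : Seminorm ℂ 𝓢(Space, ℂ) :=
    ((Finset.Iic (8, 0)).sup (schwartzSeminormFamily ℂ Space ℂ)).comp
      (fourierInvCLM ℂ 𝓢(Space, ℂ)).toLinearMap
  have hq : Continuous q := by
    have h1 : Continuous
        ((Finset.Iic (8, 0)).sup (schwartzSeminormFamily ℂ Space ℂ) : Seminorm ℂ 𝓢(Space, ℂ)) := by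
      induction Finset.Iic ((8, 0) : ℕ × ℕ) using Finset.induction_on with
      | empty => exact (continuous_const : Continuous fun _ : 𝓢(Space, ℂ) ↦ (0 : ℝ))
      | insert i s _ ih =>
        rw [Finset.sup_insert, Seminorm.coe_sup]
        exact ((schwartz_withSeminorms ℂ Space ℂ).continuous_seminorm i).sup ih
    exact h1.comp (fourierInvCLM ℂ 𝓢(Space, ℂ)).continuous
  obtain ⟨s, A, -, hA⟩ := Seminorm.bound_of_continuous (schwartz_withSeminorms ℂ Space ℂ) q hq
  choose B hB0 hB using fun i : ℕ × ℕ ↦ h.exists_seminorm_damp_le i.1 i.2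
  refine ⟨2 ^ 8 * (A * ∑ i ∈ s, B i), ?_, fun τ σ hτ hσ x ↦ ?_⟩
  · have := Finset.sum_nonneg fun i (_ : i ∈ s) ↦ hB0 i
    positivity
  have h1 := SchwartzMap.one_add_le_sup_seminorm_apply (𝕜 := ℂ) (m := (8, 0)) (k := 8) (n := 0)
    le_rfl le_rfl (𝓕⁻ (h.damp τ σ).schwartz) x
  rw [norm_iteratedFDeriv_zero] at h1
  have h2 := hA (h.damp τ σ).schwartz
  have h3 : (s.sup (schwartzSeminormFamily ℂ Space ℂ)) (h.damp τ σ).schwartz ≤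
      (∑ i ∈ s, B i) * Real.exp (-(τ / 8)) := by
    refine Seminorm.finset_sup_apply_le
      (mul_nonneg (Finset.sum_nonneg fun i _ ↦ hB0 i) (Real.exp_pos _).le) fun i hi ↦ ?_
    refine (hB i τ σ hτ hσ).trans ?_
    gcongr
    exact Finset.single_le_sum (f := B) (fun j _ ↦ hB0 j) hi
  calc _ ≤ _ := h1
    _ = 2 ^ 8 * q (h.damp τ σ).schwartz := rfl
    _ ≤ 2 ^ 8 * (A * ((∑ i ∈ s, B i) * Real.exp (-(τ / 8)))) := by
        gcongr
        refine h2.trans ?_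
        rw [smul_apply, NNReal.smul_def, smul_eq_mul]
        gcongr
    _ = _ := by ring

/-! ### Horizontal and vertical variables -/

/-- The horizontal plane. -/
abbrev Plane := EuclideanSpace ℝ (Fin 2)

/-- The point `(y, z)` of `ℝ² × ℝ`. -/
def glue (y : Plane) (z : ℝ) : Space := !₂[y 0, y 1, z]

/-- The horizontal part `x_h` of a point. -/
def hor (x : Space) : Plane := !₂[x 0, x 1]

@[simp] theorem hor_glue (y : Plane) (z : ℝ) : hor (glue y z) = y := by
  ext i; fin_cases i <;> rfl

@[simp] theorem glue_two (y : Plane) (z : ℝ) : glue y z 2 = z := rfl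

theorem hor_sub (x y : Space) : hor (x - y) = hor x - hor y := by
  ext i; fin_cases i <;> rfl

theorem continuous_hor : Continuous hor := by unfold hor; fun_prop

theorem continuous_glue : Continuous fun p : Plane × ℝ ↦ glue p.1 p.2 := by unfold glue; fun_prop

theorem continuous_glue_right (y : Plane) : Continuous (glue y) := by unfold glue; fun_prop

theorem measurePreserving_glue :
    MeasurePreserving (fun p : Plane × ℝ ↦ glue p.1 p.2) (volume.prod volume) volume := by
  have m1 : MeasurePreserving (fun p : Plane × ℝ ↦ ((WithLp.ofLp p.1 : Fin 2 → ℝ), p.2))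
      (volume.prod volume) (volume.prod volume) :=
    (PiLp.volume_preserving_ofLp (Fin 2)).prod (MeasurePreserving.id volume)
  have m2 : MeasurePreserving (Prod.swap : (Fin 2 → ℝ) × ℝ → ℝ × (Fin 2 → ℝ))
      (volume.prod volume) (volume.prod volume) := Measure.measurePreserving_swap
  have m3 := (volume_preserving_piFinSuccAbove (fun _ : Fin 3 ↦ ℝ) (Fin.last 2)).symm
  have m4 := PiLp.volume_preserving_toLp (Fin 3)
  have := m4.comp (m3.comp (m2.comp m1))
  have e : (fun p : Plane × ℝ ↦ glue p.1 p.2) = WithLp.toLp 2 ∘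
      (MeasurableEquiv.piFinSuccAbove (fun _ : Fin 3 ↦ ℝ) (Fin.last 2)).symm ∘ Prod.swap ∘
        fun p : Plane × ℝ ↦ ((WithLp.ofLp p.1 : Fin 2 → ℝ), p.2) := by
    funext p
    ext i
    fin_cases i <;> rfl
  rw [e]
  exact this

theorem lintegral_space {g : Space → ℝ≥0∞} (hg : Measurable g) :
    ∫⁻ x, g x = ∫⁻ y : Plane, ∫⁻ z : ℝ, g (glue y z) := by
  rw [← measurePreserving_glue.lintegral_comp hg,
    lintegral_prod (fun p : Plane × ℝ ↦ g (glue p.1 p.2))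
      (hg.comp continuous_glue.measurable).aemeasurable]

/-- The weight `r^d (1 + r |y|)^{-4}`, an approximate identity of scale `1 / r` on a space of
dimension `d`. -/
def wt {E : Type*} [NormedAddCommGroup E] [NormedSpace ℝ E] (r : ℝ) (y : E) : ℝ≥0∞ :=
  ENNReal.ofReal (r ^ Module.finrank ℝ E * ((1 + r * ‖y‖) ^ 4)⁻¹)

section wt
variable {E : Type*} [NormedAddCommGroup E] [NormedSpace ℝ E]

theorem wt_le {r : ℝ} (hr : 0 ≤ r) (y : E) :
    wt r y ≤ ENNReal.ofReal (r ^ Module.finrank ℝ E) := by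
  refine ENNReal.ofReal_le_ofReal ?_
  have : ((1 + r * ‖y‖) ^ 4)⁻¹ ≤ 1 :=
    inv_le_one_of_one_le₀ (one_le_pow₀ (by nlinarith [mul_nonneg hr (norm_nonneg y)]))
  exact mul_le_of_le_one_right (by positivity) this

theorem wt_sub_comm (r : ℝ) (x y : E) : wt r (x - y) = wt r (y - x) := by
  simp only [wt, norm_sub_rev]

variable [MeasurableSpace E] [BorelSpace E]

@[fun_prop]
theorem measurable_wt (r : ℝ) : Measurable (wt r : E → ℝ≥0∞) := by
  unfold wt; fun_prop

variable [FiniteDimensional ℝ E]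

theorem lintegral_wt (μ : Measure E) [μ.IsAddHaarMeasure] {r : ℝ} (hr : 0 < r) :
    ∫⁻ y : E, wt r y ∂μ = ∫⁻ y : E, wt 1 y ∂μ := by
  have h := Measure.map_addHaar_smul μ hr.ne'
  have h2 : ∫⁻ y, wt 1 y ∂(μ.map (r • ·)) = ∫⁻ y : E, wt 1 (r • y) ∂μ :=
    lintegral_map (measurable_wt 1) (measurable_const_smul r)
  rw [h, lintegral_smul_measure] at h2
  have h3 : ∀ y : E, wt r y = ENNReal.ofReal (r ^ Module.finrank ℝ E) * wt 1 (r • y) := by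
    intro y
    rw [wt, wt, ← ENNReal.ofReal_mul (by positivity), norm_smul, Real.norm_of_nonneg hr.le]
    simp
  simp_rw [h3]
  rw [lintegral_const_mul _ (by fun_prop), ← h2, smul_eq_mul,
    ← mul_assoc, ← ENNReal.ofReal_mul (by positivity), abs_of_pos (by positivity),
    mul_inv_cancel₀ (by positivity), ENNReal.ofReal_one, one_mul]

theorem lintegral_wt_one_lt_top (μ : Measure E) [μ.IsAddHaarMeasure]
    (hE : Module.finrank ℝ E < 4) : ∫⁻ y : E, wt 1 y ∂μ < ⊤ := by
  have h := (integrable_one_add_norm (E := E) (μ := μ) (r := 4)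
    (by exact_mod_cast hE)).lintegral_lt_top
  refine lt_of_le_of_lt (lintegral_mono fun y ↦ ?_) h
  rw [wt]
  refine ENNReal.ofReal_le_ofReal (le_of_eq ?_)
  rw [Real.rpow_neg (by positivity)]
  norm_num

end wt

/-! ### Convolution estimates in mixed norms -/

/-- Jensen's inequality for the measure of density `k`. -/
theorem lintegral_mul_rpow_le {α : Type*} [MeasurableSpace α] (μ : Measure α) {k g : α → ℝ≥0∞}
    (hk : Measurable k) (hg : Measurable g) {s : ℝ} (hs : 1 ≤ s) :
    (∫⁻ x, k x * g x ∂μ) ^ s ≤ (∫⁻ x, k x ∂μ) ^ (s - 1) * ∫⁻ x, k x * g x ^ s ∂μ := by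
  rcases hs.eq_or_lt with rfl | hs
  · simp
  have hpq := Real.HolderConjugate.conjExponent hs
  have h := ENNReal.lintegral_mul_le_Lp_mul_Lq (μ.withDensity k) hpq hg.aemeasurable
    (aemeasurable_const (b := (1 : ℝ≥0∞)))
  simp only [Pi.mul_apply, mul_one, ENNReal.one_rpow] at h
  rw [lintegral_withDensity_eq_lintegral_mul _ hk hg,
    lintegral_withDensity_eq_lintegral_mul _ hk (hg.pow_const s),
    lintegral_withDensity_eq_lintegral_mul _ hk measurable_const] at h
  simp only [Pi.mul_apply, mul_one] at h
  have h2 := ENNReal.rpow_le_rpow h (by linarith : 0 ≤ s)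
  rw [ENNReal.mul_rpow_of_nonneg _ _ (by linarith), ← ENNReal.rpow_mul, ← ENNReal.rpow_mul,
    one_div_mul_cancel (by linarith), ENNReal.rpow_one] at h2
  have e : 1 / s.conjExponent * s = s - 1 := by
    rw [Real.conjExponent]; field_simp
  rwa [e, mul_comm] at h2

/-- The total mass of the weights `wt`, made at least one. -/
def wtMass : ℝ≥0∞ := max 1 (max (∫⁻ z : ℝ, wt 1 z) (∫⁻ y : Plane, wt 1 y))

theorem one_le_wtMass : 1 ≤ wtMass := le_max_left _ _

theorem wtMass_ne_top : wtMass ≠ ⊤ := by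
  refine (max_lt ENNReal.one_lt_top (max_lt ?_ ?_)).ne
  · exact lintegral_wt_one_lt_top volume (by simp)
  · exact lintegral_wt_one_lt_top volume (by simp)

theorem lintegral_wt_line_le {b : ℝ} (hb : 0 < b) : ∫⁻ z : ℝ, wt b z ≤ wtMass := by
  rw [lintegral_wt volume hb]
  exact (le_max_left _ _).trans (le_max_right _ _)

theorem lintegral_wt_plane_le {a : ℝ} (ha : 0 < a) : ∫⁻ y : Plane, wt a y ≤ wtMass := by
  rw [lintegral_wt volume ha]
  exact (le_max_right _ _).trans (le_max_right _ _)

theorem lintegral_wt_line_sub_le {b : ℝ} (hb : 0 < b) (z : ℝ) :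
    ∫⁻ z' : ℝ, wt b (z - z') ≤ wtMass := by
  rw [lintegral_sub_left_eq_self (fun z ↦ wt b z) z]
  exact lintegral_wt_line_le hb

theorem lintegral_wt_plane_sub_le {a : ℝ} (ha : 0 < a) (y : Plane) :
    ∫⁻ y' : Plane, wt a (y - y') ≤ wtMass := by
  rw [lintegral_sub_left_eq_self (fun y ↦ wt a y) y]
  exact lintegral_wt_plane_le ha

/-- The square of the `L²` norm of `f` on the vertical line over `y`. -/
def vertSq (f : Space → Vec) (y : Plane) : ℝ≥0∞ := ∫⁻ z : ℝ, ‖f (glue y z)‖ₑ ^ (2 : ℝ)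

/-- The convolution in the horizontal variables of `wt a` with `y ↦ ‖f(y, ·)‖²_{L²}`. -/
def horConv (a : ℝ) (f : Space → Vec) (y : Plane) : ℝ≥0∞ :=
  ∫⁻ y' : Plane, wt a (y - y') * vertSq f y'

/-- The convolution of `|K|` with `|f|`. -/
def absConv (K : Space → ℂ) (f : Space → Vec) (x : Space) : ℝ≥0∞ :=
  ∫⁻ y, ‖K (x - y)‖ₑ * ‖f y‖ₑ

theorem mixedNormFun_eq (p : ℝ) (f : Space → Vec) :
    mixedNormFun p f = (∫⁻ y, vertSq f y ^ (p / 2)) ^ (1 / p) := rfl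

theorem measurable_enorm_glue {f : Space → Vec} (hf : StronglyMeasurable f) :
    Measurable fun p : Plane × ℝ ↦ ‖f (glue p.1 p.2)‖ₑ :=
  hf.enorm.comp continuous_glue.measurable

theorem measurable_enorm_glue_rpow {f : Space → Vec} (hf : StronglyMeasurable f) (y : Plane)
    (r : ℝ) : Measurable fun z : ℝ ↦ ‖f (glue y z)‖ₑ ^ r := by
  have h : Measurable fun z : ℝ ↦ ‖f (glue y z)‖ₑ :=
    hf.enorm.comp (continuous_glue_right y).measurable
  exact h.pow_const r

theorem measurable_vertSq {f : Space → Vec} (hf : StronglyMeasurable f) :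
    Measurable (vertSq f) :=
  ((measurable_enorm_glue hf).pow_const _).lintegral_prod_right'

theorem measurable_horConv {f : Space → Vec} (hf : StronglyMeasurable f) (a : ℝ) :
    Measurable (horConv a f) := by
  have h : Measurable fun p : Plane × Plane ↦ wt a (p.1 - p.2) * vertSq f p.2 :=
    ((measurable_wt a).comp (measurable_fst.sub measurable_snd)).mul
      ((measurable_vertSq hf).comp measurable_snd)
  exact h.lintegral_prod_right'

section
variable {K : Space → ℂ} {E : ℝ≥0∞} {a b : ℝ} {f : Space → Vec}

/-- Cauchy–Schwarz for the measure whose density is the product weight. -/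
theorem absConv_sq_le (ha : 0 < a) (hb : 0 < b)
    (hK : ∀ x, ‖K x‖ₑ ≤ E * (wt a (hor x) * wt b (x 2))) (hf : StronglyMeasurable f) (x : Space) :
    absConv K f x ^ (2 : ℝ) ≤ E ^ (2 : ℝ) * wtMass ^ 2 * ∫⁻ y' : Plane, wt a (hor x - y') *
      ∫⁻ z' : ℝ, wt b (x 2 - z') * ‖f (glue y' z')‖ₑ ^ (2 : ℝ) := by
  set k : Space → ℝ≥0∞ := fun y ↦ wt a (hor x - hor y) * wt b (x 2 - y 2) with hk
  have km : Measurable k := by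
    have := continuous_hor.measurable
    have h2 : Measurable fun y : Space ↦ y 2 := by fun_prop
    exact ((measurable_wt a).comp (this.const_sub _)).mul ((measurable_wt b).comp (h2.const_sub _))
  have fm := hf.enorm
  have h1 : absConv K f x ≤ E * ∫⁻ y, k y * ‖f y‖ₑ := by
    have kf : Measurable fun y ↦ k y * ‖f y‖ₑ := km.mul fm
    rw [← lintegral_const_mul _ kf]
    refine lintegral_mono fun y ↦ ?_
    have := hK (x - y)
    rw [hor_sub] at this
    calc _ ≤ E * k y * ‖f y‖ₑ := by gcongr; exact this
      _ = _ := by ring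
  have hint : ∀ g : Space → ℝ≥0∞, Measurable g → ∫⁻ y, k y * g y =
      ∫⁻ y' : Plane, wt a (hor x - y') * ∫⁻ z' : ℝ, wt b (x 2 - z') * g (glue y' z') := by
    intro g hg
    have kg : Measurable fun y ↦ k y * g y := km.mul hg
    rw [lintegral_space kg]
    refine lintegral_congr fun y' ↦ ?_
    have gm : Measurable fun z' ↦ g (glue y' z') :=
      hg.comp (continuous_glue_right y').measurable
    have wm : Measurable fun z' : ℝ ↦ wt b (x 2 - z') * g (glue y' z') :=
      ((measurable_wt b).comp (measurable_id.const_sub _)).mul gm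
    rw [← lintegral_const_mul _ wm]
    refine lintegral_congr fun z' ↦ ?_
    simp only [hk, hor_glue, glue_two]
    ring
  have hmass : ∫⁻ y, k y ≤ wtMass ^ 2 := by
    have := hint (fun _ ↦ 1) measurable_const
    simp only [mul_one] at this
    rw [this]
    calc _ ≤ ∫⁻ y' : Plane, wt a (hor x - y') * wtMass := by
          gcongr; exact lintegral_wt_line_sub_le hb _
      _ = (∫⁻ y' : Plane, wt a (hor x - y')) * wtMass := lintegral_mul_const _ (by fun_prop)
      _ ≤ wtMass * wtMass := by gcongr; exact lintegral_wt_plane_sub_le ha _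
      _ = _ := by ring
  have h2 := lintegral_mul_rpow_le volume km fm (s := 2) (by norm_num)
  calc absConv K f x ^ (2 : ℝ) ≤ (E * ∫⁻ y, k y * ‖f y‖ₑ) ^ (2 : ℝ) := by gcongr
    _ = E ^ (2 : ℝ) * (∫⁻ y, k y * ‖f y‖ₑ) ^ (2 : ℝ) := ENNReal.mul_rpow_of_nonneg _ _ (by norm_num)
    _ ≤ E ^ (2 : ℝ) * ((∫⁻ y, k y) ^ ((2 : ℝ) - 1) * ∫⁻ y, k y * ‖f y‖ₑ ^ (2 : ℝ)) := by gcongr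
    _ ≤ E ^ (2 : ℝ) * (wtMass ^ 2 * ∫⁻ y, k y * ‖f y‖ₑ ^ (2 : ℝ)) := by
        gcongr
        rw [show (2 : ℝ) - 1 = 1 by norm_num, ENNReal.rpow_one]
        exact hmass
    _ = _ := by rw [hint _ (fm.pow_const _), mul_assoc]

/-- Young's inequality `L² → L^∞` in the vertical variable. -/
theorem absConv_sq_le_horConv (ha : 0 < a) (hb : 0 < b)
    (hK : ∀ x, ‖K x‖ₑ ≤ E * (wt a (hor x) * wt b (x 2))) (hf : StronglyMeasurable f) (x : Space) :
    absConv K f x ^ (2 : ℝ) ≤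
      E ^ (2 : ℝ) * wtMass ^ 2 * ENNReal.ofReal b * horConv a f (hor x) := by
  refine (absConv_sq_le ha hb hK hf x).trans ?_
  rw [mul_assoc _ (ENNReal.ofReal b)]
  gcongr
  rw [horConv, ← lintegral_const_mul _ (by
    have := measurable_vertSq hf
    fun_prop)]
  refine lintegral_mono fun y' ↦ ?_
  have fm := measurable_enorm_glue_rpow hf y' 2
  calc _ ≤ wt a (hor x - y') * ∫⁻ z' : ℝ, ENNReal.ofReal b * ‖f (glue y' z')‖ₑ ^ (2 : ℝ) := by
        gcongr with z'
        simpa using wt_le hb.le (x 2 - z')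
    _ = _ := by
        rw [lintegral_const_mul _ fm, vertSq]; ring

/-- Young's inequality `L² → L²` in the vertical variable. -/
theorem lintegral_absConv_sq_le_horConv (ha : 0 < a) (hb : 0 < b)
    (hK : ∀ x, ‖K x‖ₑ ≤ E * (wt a (hor x) * wt b (x 2))) (hf : StronglyMeasurable f) (y : Plane) :
    ∫⁻ z : ℝ, absConv K f (glue y z) ^ (2 : ℝ) ≤
      E ^ (2 : ℝ) * wtMass ^ 3 * horConv a f y := by
  have m4 : ∀ y' : Plane, Measurable fun q : ℝ × ℝ ↦
      wt b (q.1 - q.2) * ‖f (glue y' q.2)‖ₑ ^ (2 : ℝ) := fun y' ↦ by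
    have h1 : Measurable fun q : ℝ × ℝ ↦ (wt b (q.1 - q.2) : ℝ≥0∞) :=
      (measurable_wt b).comp (measurable_fst.sub measurable_snd)
    have h2 : Measurable fun q : ℝ × ℝ ↦ ‖f (glue y' q.2)‖ₑ ^ (2 : ℝ) :=
      (measurable_enorm_glue_rpow hf y' 2).comp measurable_snd
    exact h1.mul h2
  have m2 : Measurable fun q : ℝ × Plane ↦
      wt a (y - q.2) * ∫⁻ z' : ℝ, wt b (q.1 - z') * ‖f (glue q.2 z')‖ₑ ^ (2 : ℝ) := by
    have h1 : Measurable fun r : (ℝ × Plane) × ℝ ↦ (wt b (r.1.1 - r.2) : ℝ≥0∞) :=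
      (measurable_wt b).comp (measurable_fst.fst.sub measurable_snd)
    have h2 : Measurable fun r : (ℝ × Plane) × ℝ ↦ ‖f (glue r.1.2 r.2)‖ₑ :=
      hf.enorm.comp (Continuous.measurable (by unfold glue; fun_prop))
    have h3 : Measurable fun r : (ℝ × Plane) × ℝ ↦
      wt b (r.1.1 - r.2) * ‖f (glue r.1.2 r.2)‖ₑ ^ (2 : ℝ) := h1.mul (h2.pow_const _)
    have h4 : Measurable fun q : ℝ × Plane ↦
      ∫⁻ z' : ℝ, wt b (q.1 - z') * ‖f (glue q.2 z')‖ₑ ^ (2 : ℝ) := h3.lintegral_prod_right'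
    have h5 : Measurable fun q : ℝ × Plane ↦ (wt a (y - q.2) : ℝ≥0∞) :=
      (measurable_wt a).comp (measurable_snd.const_sub _)
    exact h5.mul h4
  have m3 : Measurable fun z : ℝ ↦ ∫⁻ y' : Plane, wt a (y - y') *
      ∫⁻ z' : ℝ, wt b (z - z') * ‖f (glue y' z')‖ₑ ^ (2 : ℝ) := m2.lintegral_prod_right'
  calc ∫⁻ z : ℝ, absConv K f (glue y z) ^ (2 : ℝ)
      ≤ ∫⁻ z : ℝ, E ^ (2 : ℝ) * wtMass ^ 2 * ∫⁻ y' : Plane, wt a (y - y') *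
          ∫⁻ z' : ℝ, wt b (z - z') * ‖f (glue y' z')‖ₑ ^ (2 : ℝ) := by
        refine lintegral_mono fun z ↦ ?_
        simpa using absConv_sq_le ha hb hK hf (glue y z)
    _ = E ^ (2 : ℝ) * wtMass ^ 2 * ∫⁻ y' : Plane, wt a (y - y') * ∫⁻ z : ℝ,
          ∫⁻ z' : ℝ, wt b (z - z') * ‖f (glue y' z')‖ₑ ^ (2 : ℝ) := by
        rw [lintegral_const_mul _ m3, lintegral_lintegral_swap m2.aemeasurable]
        congr 1
        refine lintegral_congr fun y' ↦ ?_
        rw [lintegral_const_mul _ (m4 y').lintegral_prod_right']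
    _ ≤ E ^ (2 : ℝ) * wtMass ^ 2 * ∫⁻ y' : Plane, wtMass * (wt a (y - y') * vertSq f y') := by
        refine mul_le_mul' le_rfl (lintegral_mono fun y' ↦ ?_)
        have fm' := measurable_enorm_glue_rpow hf y' 2
        rw [lintegral_lintegral_swap (m4 y').aemeasurable]
        calc _ = wt a (y - y') * ∫⁻ z' : ℝ, (∫⁻ z : ℝ, wt b (z - z')) *
                ‖f (glue y' z')‖ₑ ^ (2 : ℝ) := by
              congr 1
              refine lintegral_congr fun z' ↦ ?_
              rw [lintegral_mul_const _ (by fun_prop)]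
          _ ≤ wt a (y - y') * ∫⁻ z' : ℝ, wtMass * ‖f (glue y' z')‖ₑ ^ (2 : ℝ) := by
              gcongr with z'
              simp_rw [wt_sub_comm b _ z']
              exact lintegral_wt_line_sub_le hb z'
          _ = _ := by rw [lintegral_const_mul _ fm', vertSq]; ring
    _ = _ := by
        rw [lintegral_const_mul _ (by
          have := measurable_vertSq hf
          fun_prop), horConv]
        ring

end

/-- Jensen's inequality for `horConv`. -/
theorem horConv_rpow_le {a : ℝ} (ha : 0 < a) {f : Space → Vec} (hf : StronglyMeasurable f)
    {s : ℝ} (hs : 1 ≤ s) (hs2 : s ≤ 2) (y : Plane) :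
    horConv a f y ^ s ≤ wtMass * ∫⁻ y', wt a (y - y') * vertSq f y' ^ s := by
  refine (lintegral_mul_rpow_le volume (by fun_prop) (measurable_vertSq hf) hs).trans ?_
  gcongr
  calc _ ≤ wtMass ^ (s - 1) := by
        refine ENNReal.rpow_le_rpow (lintegral_wt_plane_sub_le ha y) (by linarith)
    _ ≤ wtMass ^ (1 : ℝ) := ENNReal.rpow_le_rpow_of_exponent_le one_le_wtMass (by linarith)
    _ = wtMass := ENNReal.rpow_one _

theorem rpow_le_self_of_one_le {x : ℝ≥0∞} (hx : 1 ≤ x) {s : ℝ} (hs : s ≤ 1) : x ^ s ≤ x := by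
  simpa using ENNReal.rpow_le_rpow_of_exponent_le hx hs

/-- Bernstein's inequality `L^p → L^∞` in the horizontal variables. -/
theorem horConv_rpow_le_sup {a : ℝ} (ha : 0 < a) {f : Space → Vec} (hf : StronglyMeasurable f)
    {s : ℝ} (hs : 1 ≤ s) (hs2 : s ≤ 2) (y : Plane) :
    horConv a f y ^ s ≤ wtMass * ENNReal.ofReal (a ^ 2) * ∫⁻ y', vertSq f y' ^ s := by
  refine (horConv_rpow_le ha hf hs hs2 y).trans ?_
  rw [mul_assoc, ← lintegral_const_mul _ ((measurable_vertSq hf).pow_const _)]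
  gcongr with y'
  simpa using wt_le ha.le (y - y')

theorem horConv_le {a : ℝ} (ha : 0 < a) {f : Space → Vec} (hf : StronglyMeasurable f)
    {p : ℝ} (hp : 2 ≤ p) (hp4 : p ≤ 4) (y : Plane) :
    horConv a f y ≤ wtMass * ENNReal.ofReal a ^ (4 / p) * mixedNormFun p f ^ (2 : ℝ) := by
  have hp0 : 0 < p := by linarith
  have h := ENNReal.rpow_le_rpow
    (horConv_rpow_le_sup ha hf (s := p / 2) (by linarith) (by linarith) y)
    (by positivity : 0 ≤ 2 / p)
  rw [← ENNReal.rpow_mul, show p / 2 * (2 / p) = 1 by field_simp, ENNReal.rpow_one,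
    ENNReal.mul_rpow_of_nonneg _ _ (by positivity),
    ENNReal.mul_rpow_of_nonneg _ _ (by positivity)] at h
  refine h.trans ?_
  rw [mixedNormFun_eq, ← ENNReal.rpow_mul, show 1 / p * 2 = 2 / p by ring,
    ENNReal.ofReal_pow ha.le, ← ENNReal.rpow_natCast, ← ENNReal.rpow_mul,
    show ((2 : ℕ) : ℝ) * (2 / p) = 4 / p by push_cast; ring]
  gcongr
  exact rpow_le_self_of_one_le one_le_wtMass (by rw [div_le_one hp0]; exact hp)

/-- Bernstein's inequality `L^p → L^4` in the horizontal variables, obtained from the endpoint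
estimates `L^p → L^∞` and `L^p → L^p`. -/
theorem lintegral_horConv_sq_le {a : ℝ} (ha : 0 < a) {f : Space → Vec} (hf : StronglyMeasurable f)
    {p : ℝ} (hp : 2 ≤ p) (hp4 : p ≤ 4) :
    ∫⁻ y, horConv a f y ^ (2 : ℝ) ≤
      wtMass ^ 3 * (ENNReal.ofReal a ^ (4 / p - 1) * mixedNormFun p f ^ (2 : ℝ)) ^ (2 : ℝ) := by
  have hp0 : 0 < p := by linarith
  set s := p / 2 with hs
  have hs1 : 1 ≤ s := by rw [hs]; linarith
  have hs2 : s ≤ 2 := by rw [hs]; linarith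
  have hs0 : 0 < s := by linarith
  set A := ∫⁻ y', vertSq f y' ^ s with hA
  have m := measurable_horConv hf a
  have mv := (measurable_vertSq hf).pow_const s
  -- this is where `p ≤ 4` is needed
  have he : 0 ≤ 2 / s - 1 := by
    rw [sub_nonneg, le_div_iff₀ hs0]; linarith
  have he1 : 2 / s - 1 ≤ 1 := by
    have : 2 / s ≤ 2 := by rw [div_le_iff₀ hs0]; linarith
    linarith
  set M := wtMass * ENNReal.ofReal (a ^ 2) * A with hM
  have h1 : ∀ y, horConv a f y ^ (2 : ℝ) ≤ M ^ (2 / s - 1) * horConv a f y ^ s := by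
    intro y
    have : horConv a f y ^ (2 : ℝ) = (horConv a f y ^ s) ^ (2 / s - 1) * horConv a f y ^ s := by
      rw [← ENNReal.rpow_mul, ← ENNReal.rpow_add_of_nonneg _ _ (mul_nonneg hs0.le he) hs0.le]
      congr 1
      field_simp
      ring
    rw [this]
    gcongr
    exact horConv_rpow_le_sup ha hf hs1 hs2 y
  have h2 : ∫⁻ y, horConv a f y ^ s ≤ wtMass ^ 2 * A := by
    have mm : Measurable fun q : Plane × Plane ↦ wt a (q.1 - q.2) * vertSq f q.2 ^ s :=
      ((measurable_wt a).comp (by fun_prop)).mul (mv.comp measurable_snd)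
    calc _ ≤ ∫⁻ y, wtMass * ∫⁻ y', wt a (y - y') * vertSq f y' ^ s :=
          lintegral_mono fun y ↦ horConv_rpow_le ha hf hs1 hs2 y
      _ = wtMass * ∫⁻ y' : Plane, ∫⁻ y : Plane, wt a (y - y') * vertSq f y' ^ s := by
          rw [lintegral_const_mul _ mm.lintegral_prod_right',
            lintegral_lintegral_swap mm.aemeasurable]
      _ ≤ wtMass * ∫⁻ y', wtMass * vertSq f y' ^ s := by
          gcongr with y'
          rw [lintegral_mul_const _ (by fun_prop)]
          gcongr
          simp_rw [wt_sub_comm a _ y']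
          exact lintegral_wt_plane_sub_le ha y'
      _ = _ := by rw [lintegral_const_mul _ mv]; ring
  calc ∫⁻ y, horConv a f y ^ (2 : ℝ)
      ≤ ∫⁻ y, M ^ (2 / s - 1) * horConv a f y ^ s := lintegral_mono h1
    _ = M ^ (2 / s - 1) * ∫⁻ y, horConv a f y ^ s := lintegral_const_mul _ (m.pow_const _)
    _ ≤ M ^ (2 / s - 1) * (wtMass ^ 2 * A) := by gcongr
    _ ≤ wtMass * ENNReal.ofReal (a ^ 2) ^ (2 / s - 1) * A ^ (2 / s - 1) * (wtMass ^ 2 * A) := by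
        rw [hM, ENNReal.mul_rpow_of_nonneg _ _ he, ENNReal.mul_rpow_of_nonneg _ _ he]
        gcongr
        exact rpow_le_self_of_one_le one_le_wtMass he1
    _ = wtMass ^ 3 * (ENNReal.ofReal (a ^ 2) ^ (2 / s - 1) * (A ^ (2 / s - 1) * A)) := by ring
    _ = _ := by
        have e1 : A ^ (2 / s - 1) * A = A ^ (2 / s) := by
          conv_lhs => rw [← ENNReal.rpow_one A, ← ENNReal.rpow_mul, one_mul]
          rw [← ENNReal.rpow_add_of_nonneg _ _ he zero_le_one]
          congr 1; ring
        rw [e1, mixedNormFun_eq, ENNReal.mul_rpow_of_nonneg _ _ (by norm_num), ← ENNReal.rpow_mul,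
          ← ENNReal.rpow_mul, ← ENNReal.rpow_mul, ENNReal.ofReal_pow ha.le,
          ← ENNReal.rpow_natCast (ENNReal.ofReal a),
          ← ENNReal.rpow_mul, hA]
        congr 3
        · rw [hs]; push_cast; field_simp; ring
        · rw [hs]; field_simp

/-! ### Distributions represented by functions -/

theorem Represents.ae_eq {T : 𝓢'(Space, Vec)} {f g : Space → Vec} (hf : Represents T f)
    (hg : Represents T g) : f =ᵐ[volume] g := by
  refine ae_eq_of_integral_contDiff_smul_eq hf.1 hg.1 fun u hu hc ↦ ?_
  have hc' : HasCompactSupport (Complex.ofRealCLM ∘ u) := hc.comp_left rfl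
  have hu' : ContDiff ℝ ∞ (Complex.ofRealCLM ∘ u) := by fun_prop
  have h1 := (hf.2 (hc'.toSchwartzMap hu')).2
  have h2 := (hg.2 (hc'.toSchwartzMap hu')).2
  simpa using h1.symm.trans h2

theorem Represents.congr_ae {T : 𝓢'(Space, Vec)} {f g : Space → Vec} (hf : Represents T f)
    (h : f =ᵐ[volume] g) : Represents T g := by
  refine ⟨hf.1.congr h, fun ψ ↦ ?_⟩
  have h2 : (fun x ↦ ψ x • f x) =ᵐ[volume] fun x ↦ ψ x • g x := by
    filter_upwards [h] with x hx
    rw [hx]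
  exact ⟨(hf.2 ψ).1.congr h2, (hf.2 ψ).2.trans (integral_congr_ae h2)⟩

theorem mixedNormFun_congr_ae (p : ℝ) {f g : Space → Vec} (h : f =ᵐ[volume] g) :
    mixedNormFun p f = mixedNormFun p g := by
  have h1 : ∀ᵐ q ∂((volume : Measure Plane).prod (volume : Measure ℝ)),
      f (glue q.1 q.2) = g (glue q.1 q.2) :=
    measurePreserving_glue.quasiMeasurePreserving.ae h
  have h2 := Measure.ae_ae_of_ae_prod h1
  rw [mixedNormFun_eq, mixedNormFun_eq]
  congr 1
  refine lintegral_congr_ae ?_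
  filter_upwards [h2] with y hy
  congr 1
  refine lintegral_congr_ae ?_
  filter_upwards [hy] with z hz
  rw [hz]

theorem Represents.aestronglyMeasurable {T : 𝓢'(Space, Vec)} {f : Space → Vec}
    (hf : Represents T f) : AEStronglyMeasurable f volume :=
  hf.1.aestronglyMeasurable

/-- The infimum in the definition of `mixedNorm` is attained, because the function that
represents a distribution is unique up to null sets. -/
theorem exists_represents_of_mixedNorm_ne_top {p : ℝ} {T : 𝓢'(Space, Vec)}
    (h : mixedNorm p T ≠ ⊤) :
    ∃ f, StronglyMeasurable f ∧ Represents T f ∧ mixedNormFun p f = mixedNorm p T := by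
  obtain ⟨f, hf⟩ : ∃ f, Represents T f := by
    by_contra hne
    push Not at hne
    exact h (by simp [mixedNorm, hne])
  have hm := hf.aestronglyMeasurable
  have hr := hf.congr_ae hm.ae_eq_mk
  refine ⟨hm.mk f, hm.stronglyMeasurable_mk, hr, le_antisymm ?_ ?_⟩
  · exact le_iInf₂ fun g hg ↦ (mixedNormFun_congr_ae p (hr.ae_eq hg)).le
  · exact iInf₂_le (f := fun g (_ : Represents T g) ↦ mixedNormFun p g) _ hr

/-- A bounded measurable function represents the distribution that it induces. -/
theorem represents_of_bounded {T : 𝓢'(Space, Vec)} {F : Space → Vec}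
    (hF : AEStronglyMeasurable F volume) {A : ℝ≥0∞} (hA : A ≠ ⊤) (hb : ∀ x, ‖F x‖ₑ ≤ A)
    (h : ∀ ψ : 𝓢(Space, ℂ), T ψ = ∫ x, ψ x • F x) : Represents T F := by
  have hb' : ∀ x, ‖F x‖ ≤ A.toReal := fun x ↦ by
    rw [← toReal_enorm]; exact ENNReal.toReal_mono hA (hb x)
  refine ⟨?_, fun ψ ↦ ⟨?_, h ψ⟩⟩
  · have : MemLp F ⊤ volume := memLp_top_of_bound hF A.toReal (.of_forall hb')
    exact this.locallyIntegrable le_top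
  · exact ψ.integrable.smul_bdd (C := A.toReal) hF (.of_forall hb')

/-- The convolution of a scalar kernel with a vector field. -/
def kconv (K : Space → ℂ) (f : Space → Vec) (x : Space) : Vec := ∫ y, K (x - y) • f y

theorem enorm_kconv_le (K : Space → ℂ) (f : Space → Vec) (x : Space) :
    ‖kconv K f x‖ₑ ≤ absConv K f x := by
  refine (enorm_integral_le_lintegral_enorm _).trans (lintegral_mono fun y ↦ ?_)
  rw [enorm_smul]

section
variable {K : Space → ℂ} {f : Space → Vec}

theorem stronglyMeasurable_kernel (hK : Continuous K) (hf : StronglyMeasurable f) :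
    StronglyMeasurable fun q : Space × Space ↦ K (q.1 - q.2) • f q.2 :=
  (hK.comp (continuous_fst.sub continuous_snd)).stronglyMeasurable.smul
    (hf.comp_measurable measurable_snd)

theorem stronglyMeasurable_kconv (hK : Continuous K) (hf : StronglyMeasurable f) :
    StronglyMeasurable (kconv K f) :=
  (stronglyMeasurable_kernel hK hf).integral_prod_right'

/-- Fubini's theorem for the pairing of an integrable function with a convolution. -/
theorem integral_smul_kconv (hK : Continuous K) (hf : StronglyMeasurable f) {A : ℝ≥0∞}
    (hA : A ≠ ⊤) (hb : ∀ x, absConv K f x ≤ A) {v : Space → ℂ} (hv : Integrable v) :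
    ∫ x, v x • kconv K f x = ∫ y, (∫ x, v x * K (x - y)) • f y := by
  have hm : AEStronglyMeasurable (fun q : Space × Space ↦ v q.1 • K (q.1 - q.2) • f q.2)
      (volume.prod volume) :=
    hv.aestronglyMeasurable.comp_fst.smul (stronglyMeasurable_kernel hK hf).aestronglyMeasurable
  have hi : Integrable (fun q : Space × Space ↦ v q.1 • K (q.1 - q.2) • f q.2)
      (volume.prod volume) := by
    refine ⟨hm, ?_⟩
    rw [hasFiniteIntegral_iff_enorm, lintegral_prod _ hm.enorm]
    calc _ ≤ ∫⁻ x, ‖v x‖ₑ * A := by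
          refine lintegral_mono fun x ↦ ?_
          simp only [enorm_smul]
          rw [lintegral_const_mul' _ _ enorm_ne_top]
          gcongr
          exact hb x
      _ = (∫⁻ x, ‖v x‖ₑ) * A := lintegral_mul_const' _ _ hA
      _ < ⊤ := ENNReal.mul_lt_top hv.2 hA.lt_top
  calc ∫ x, v x • kconv K f x = ∫ x, ∫ y, v x • K (x - y) • f y := by
        simp_rw [integral_smul]; rfl
    _ = ∫ y, ∫ x, v x • K (x - y) • f y := integral_integral_swap hi
    _ = _ := by
        refine integral_congr_ae (.of_forall fun y ↦ ?_)
        simp only [smul_smul]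
        rw [integral_smul_const]

end

/-- The kernel of the Fourier multiplier with symbol `M`. -/
def kernel (M : 𝓢(Space, ℂ)) : 𝓢(Space, ℂ) := 𝓕⁻ M

/-- Pairing with a translated kernel `K(· - y)`, read on the Fourier side. -/
theorem integral_mul_kernel_sub (M : 𝓢(Space, ℂ)) {v : Space → ℂ} (hv : Integrable v)
    (y : Space) :
    ∫ x, v x * kernel M (x - y) = 𝓕 (fun η ↦ M η * 𝓕⁻ v η) y := by
  set g : Space → ℂ := fun η ↦ Real.fourierChar (-inner ℝ η y) • M η with hg
  have hgi : Integrable g := (Real.fourierIntegral_convergent_iff (μ := volume) y).2 M.integrable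
  have h := VectorFourier.integral_fourierIntegral_smul_eq_flip (L := -innerₗ Space)
    (μ := volume) (ν := volume) (f := g) (g := v) Real.continuous_fourierChar
    (by simpa using (continuous_inner (𝕜 := ℝ) (E := Space)).fun_neg) hgi hv
  have e1 : ∀ x, VectorFourier.fourierIntegral Real.fourierChar volume (-innerₗ Space) g x =
      kernel M (x - y) := by
    intro x
    change 𝓕⁻ g x = _
    rw [kernel, SchwartzMap.fourierInv_coe, Real.fourierInv_eq, Real.fourierInv_eq]
    refine integral_congr_ae (.of_forall fun η ↦ ?_)
    simp only [hg]
    rw [smul_smul, ← AddChar.map_add_eq_mul, inner_sub_right, sub_eq_add_neg]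
  have e2 : (-innerₗ Space).flip = -innerₗ Space := by
    ext x y
    simp [real_inner_comm]
  rw [e2] at h
  have e3 : ∀ x, VectorFourier.fourierIntegral Real.fourierChar volume (-innerₗ Space) v x =
      𝓕⁻ v x := fun x ↦ rfl
  simp only [e1, e3, smul_eq_mul] at h
  rw [Real.fourier_eq]
  calc _ = ∫ x, kernel M (x - y) * v x := by simp_rw [mul_comm]
    _ = _ := h
    _ = _ := by
      refine integral_congr_ae (.of_forall fun η ↦ ?_)
      simp only [hg, smul_mul_assoc]

/-- A Fourier multiplier with Schwartz symbol acts on a function by convolution with its kernel. -/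
theorem represents_fourierMultiplier (M : 𝓢(Space, ℂ)) {T : 𝓢'(Space, Vec)} {f : Space → Vec}
    (hf : StronglyMeasurable f) (hT : Represents T f) {A : ℝ≥0∞} (hA : A ≠ ⊤)
    (hb : ∀ x, absConv (kernel M) f x ≤ A) :
    Represents (TemperedDistribution.fourierMultiplierCLM Vec M T) (kconv (kernel M) f) := by
  have hK : Continuous (kernel M) := (kernel M).continuous
  refine represents_of_bounded (stronglyMeasurable_kconv hK hf).aestronglyMeasurable hA
    (fun x ↦ (enorm_kconv_le _ _ _).trans (hb x)) fun ψ ↦ ?_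
  rw [integral_smul_kconv hK hf hA hb ψ.integrable,
    TemperedDistribution.fourierMultiplierCLM_apply_apply, (hT.2 _).2]
  refine integral_congr_ae (.of_forall fun y ↦ ?_)
  simp only
  congr 1
  have e : (fun η ↦ M η * 𝓕⁻ (ψ : Space → ℂ) η) = SchwartzMap.smulLeftCLM ℂ M (𝓕⁻ ψ) := by
    ext η
    rw [SchwartzMap.smulLeftCLM_apply_apply M.hasTemperateGrowth, SchwartzMap.fourierInv_coe]
    rfl
  rw [integral_mul_kernel_sub M ψ.integrable, SchwartzMap.fourier_coe, e]

/-- Multiplication by a convolution enlarges the Fourier support by at most the support of the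
symbol. -/
theorem fourierInv_smul_kconv_eq_zero (M : 𝓢(Space, ℂ)) {f : Space → Vec}
    (hf : StronglyMeasurable f) {A : ℝ≥0∞} (hA : A ≠ ⊤) (hb : ∀ x, absConv (kernel M) f x ≤ A)
    {v : Space → ℂ} (hv : Integrable v) {ζ : Space}
    (h : ∀ η, M η ≠ 0 → 𝓕⁻ v (η + ζ) = 0) :
    𝓕⁻ (fun x ↦ v x • kconv (kernel M) f x) ζ = 0 := by
  set w : Space → ℂ := fun x ↦ Real.fourierChar (inner ℝ x ζ) • v x with hw
  have hwi : Integrable w := by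
    have := (Real.fourierIntegral_convergent_iff (μ := volume) (f := v) (-ζ)).2 hv
    simpa [inner_neg_right] using this
  have e1 : 𝓕⁻ (fun x ↦ v x • kconv (kernel M) f x) ζ = ∫ x, w x • kconv (kernel M) f x := by
    rw [Real.fourierInv_eq]
    simp only [hw, smul_assoc]
  rw [e1, integral_smul_kconv (kernel M).continuous hf hA hb hwi]
  refine integral_eq_zero_of_ae (.of_forall fun y ↦ ?_)
  have e2 : (fun η ↦ M η * 𝓕⁻ w η) = fun _ ↦ 0 := by
    ext η
    by_cases hη : M η = 0
    · simp [hη]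
    · have : 𝓕⁻ w η = 𝓕⁻ v (η + ζ) := by
        rw [Real.fourierInv_eq, Real.fourierInv_eq]
        refine integral_congr_ae (.of_forall fun x ↦ ?_)
        simp only [hw]
        rw [smul_smul, ← AddChar.map_add_eq_mul, inner_add_right]
      rw [this, h η hη, mul_zero]
  simp only [Pi.zero_apply]
  rw [integral_mul_kernel_sub M hwi, e2]
  simp [Real.fourier_eq]

/-! ### Bernstein estimates for one block -/

/-- The frequency `2^k / 2π`: in the normalization `e^{2πi x·η}` of the Fourier transform, the
dyadic shell of index `k` lives at `|η| ∼ 2^k / 2π`. -/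
def freq (k : ℤ) : ℝ := (2 : ℝ) ^ k / (2 * Real.pi)

theorem freq_pos (k : ℤ) : 0 < freq k := by unfold freq; positivity

theorem ofReal_two_zpow (k : ℤ) : ENNReal.ofReal ((2 : ℝ) ^ k) = (2 : ℝ≥0∞) ^ (k : ℝ) := by
  rw [← Real.rpow_intCast, ← ENNReal.ofReal_rpow_of_pos (by norm_num)]
  norm_num

theorem ofReal_freq_le (k : ℤ) : ENNReal.ofReal (freq k) ≤ (2 : ℝ≥0∞) ^ (k : ℝ) := by
  rw [← ofReal_two_zpow]
  refine ENNReal.ofReal_le_ofReal (div_le_self (by positivity) ?_)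
  linarith [Real.pi_gt_three]

theorem two_rpow_add (x y : ℝ) : (2 : ℝ≥0∞) ^ (x + y) = 2 ^ x * 2 ^ y :=
  ENNReal.rpow_add _ _ (by norm_num) (by norm_num)

theorem two_rpow_ne_top (x : ℝ) : (2 : ℝ≥0∞) ^ x ≠ ⊤ :=
  ENNReal.rpow_ne_top_of_ne_zero (by norm_num) (by norm_num)

theorem two_rpow_ne_zero (x : ℝ) : (2 : ℝ≥0∞) ^ x ≠ 0 :=
  (ENNReal.rpow_pos (by norm_num) (by norm_num)).ne'

theorem two_rpow_mono {x y : ℝ} (h : x ≤ y) : (2 : ℝ≥0∞) ^ x ≤ 2 ^ y :=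
  ENNReal.rpow_le_rpow_of_exponent_le (by norm_num) h

/-- The Schwartz symbol `e^{-(τ |ζ_h|² + σ ζ_3²)} χ(ζ)` at `ζ = (2π 2^{-k} η_h, 2π 2^{-l} η_3)`. -/
def blockSymbol {χ : Space → ℂ} (h : IsCutoff χ) (τ σ : ℝ) (k l : ℤ) : 𝓢(Space, ℂ) :=
  (h.damp τ σ).dilSchwartz (freq_pos k) (freq_pos l)

theorem blockSymbol_apply {χ : Space → ℂ} (h : IsCutoff χ) (τ σ : ℝ) (k l : ℤ) (η : Space) :
    blockSymbol h τ σ k l η = damp χ τ σ (dil (freq k)⁻¹ (freq l)⁻¹ η) := rfl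

theorem norm_hor_sq (x : Space) : ‖hor x‖ ^ 2 = x 0 ^ 2 + x 1 ^ 2 := by
  rw [EuclideanSpace.norm_sq_eq, Fin.sum_univ_two]; simp [hor]

/-- The kernel of a block is dominated by the product of the weights at the scales of the block:
`(1 + |x|)^8` dominates both `(1 + |x_h|)^4 (1 + |x_3|)^4` and its dilates. -/
theorem IsCutoff.exists_kernel_blockSymbol_le {χ : Space → ℂ} (h : IsCutoff χ) :
    ∃ C : ℝ, 0 ≤ C ∧ ∀ τ σ : ℝ, 0 ≤ τ → 0 ≤ σ → ∀ (k l : ℤ) (x : Space),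
      ‖kernel (blockSymbol h τ σ k l) x‖ₑ ≤ ENNReal.ofReal (C * Real.exp (-(τ / 8))) *
        (wt (freq k) (hor x) * wt (freq l) (x 2)) := by
  obtain ⟨C, hC0, hC⟩ := h.exists_kernel_le
  refine ⟨C, hC0, fun τ σ hτ hσ k l x ↦ ?_⟩
  have ha := freq_pos k
  have hb := freq_pos l
  set a := freq k
  set b := freq l
  have h1 := hC τ σ hτ hσ (dil a b x)
  have e : kernel (blockSymbol h τ σ k l) x =
      (a ^ 2 * b) • 𝓕⁻ (h.damp τ σ).schwartz (dil a b x) :=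
    fourierInv_dilSchwartz (h.damp τ σ) ha hb x
  set N := ‖dil a b x‖ with hN
  have hN2 : N ^ 2 = a ^ 2 * ‖hor x‖ ^ 2 + (b * |x 2|) ^ 2 := by
    rw [hN, norm_sq_eq, norm_hor_sq, mul_pow, sq_abs]
    simp only [dil_zero_apply, dil_one_apply, dil_two_apply]
    ring
  have n1 : a * ‖hor x‖ ≤ N := by
    refine le_of_sq_le_sq ?_ (norm_nonneg _)
    nlinarith [sq_nonneg (b * |x 2|)]
  have n2 : b * |x 2| ≤ N := by
    refine le_of_sq_le_sq ?_ (norm_nonneg _)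
    nlinarith [sq_nonneg (a * ‖hor x‖)]
  have hw : (1 + a * ‖hor x‖) ^ 4 * (1 + b * |x 2|) ^ 4 ≤ (1 + N) ^ 8 := by
    calc _ ≤ (1 + N) ^ 4 * (1 + N) ^ 4 := by gcongr
      _ = _ := by ring
  have h2 : ‖𝓕⁻ (h.damp τ σ).schwartz (dil a b x)‖ ≤ C * Real.exp (-(τ / 8)) *
      (((1 + a * ‖hor x‖) ^ 4)⁻¹ * ((1 + b * |x 2|) ^ 4)⁻¹) := by
    rw [← mul_inv, ← div_eq_mul_inv, le_div_iff₀ (by positivity)]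
    refine le_trans ?_ h1
    rw [mul_comm]
    gcongr
  rw [wt, wt, ← ENNReal.ofReal_mul (by positivity), ← ENNReal.ofReal_mul (by positivity), e,
    ← ofReal_norm]
  refine ENNReal.ofReal_le_ofReal ?_
  rw [norm_smul, Real.norm_of_nonneg (by positivity)]
  calc _ ≤ a ^ 2 * b * (C * Real.exp (-(τ / 8)) *
      (((1 + a * ‖hor x‖) ^ 4)⁻¹ * ((1 + b * |x 2|) ^ 4)⁻¹)) := by gcongr
    _ = _ := by simp; ring

/-- The Besov weight of a block: `2^{(-2 + 4/p) k} ‖f‖²_{L^p_h(L²_v)}`. -/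
def blockMass (p : ℝ) (k : ℤ) (f : Space → Vec) : ℝ≥0∞ :=
  (2 : ℝ≥0∞) ^ ((-2 + 4 / p) * (k : ℝ)) * mixedNormFun p f ^ (2 : ℝ)

theorem horConv_freq_le (k : ℤ) {f : Space → Vec} (hf : StronglyMeasurable f)
    {p : ℝ} (hp : 2 ≤ p) (hp4 : p ≤ 4) (y : Plane) :
    horConv (freq k) f y ≤ wtMass * 2 ^ (2 * (k : ℝ)) * blockMass p k f := by
  refine (horConv_le (freq_pos k) hf hp hp4 y).trans ?_
  have h0 : 0 < p := by linarith
  have e : ENNReal.ofReal (freq k) ^ (4 / p) ≤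
      2 ^ (2 * (k : ℝ)) * 2 ^ ((-2 + 4 / p) * (k : ℝ)) := by
    refine (ENNReal.rpow_le_rpow (ofReal_freq_le k) (by positivity)).trans (le_of_eq ?_)
    rw [← two_rpow_add, ← ENNReal.rpow_mul]
    congr 1; ring
  rw [blockMass]
  calc _ ≤ wtMass * (2 ^ (2 * (k : ℝ)) * 2 ^ ((-2 + 4 / p) * (k : ℝ))) *
        mixedNormFun p f ^ (2 : ℝ) := by gcongr
    _ = _ := by ring

theorem lintegral_horConv_freq_sq_le (k : ℤ) {f : Space → Vec} (hf : StronglyMeasurable f)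
    {p : ℝ} (hp : 2 ≤ p) (hp4 : p ≤ 4) :
    ∫⁻ y, horConv (freq k) f y ^ (2 : ℝ) ≤
      wtMass ^ 3 * (2 ^ (k : ℝ) * blockMass p k f) ^ (2 : ℝ) := by
  refine (lintegral_horConv_sq_le (freq_pos k) hf hp hp4).trans ?_
  have h0 : 0 < p := by linarith
  have h1 : 0 ≤ 4 / p - 1 := by rw [sub_nonneg, le_div_iff₀ h0]; linarith
  have e : ENNReal.ofReal (freq k) ^ (4 / p - 1) ≤
      2 ^ (k : ℝ) * 2 ^ ((-2 + 4 / p) * (k : ℝ)) := by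
    refine (ENNReal.rpow_le_rpow (ofReal_freq_le k) h1).trans (le_of_eq ?_)
    rw [← two_rpow_add, ← ENNReal.rpow_mul]
    congr 1; ring
  rw [blockMass, ← mul_assoc (2 ^ (k : ℝ))]
  gcongr

theorem sq_ofReal_exp (C τ : ℝ) (hC : 0 ≤ C) :
    ENNReal.ofReal (C * Real.exp (-(τ / 8))) ^ (2 : ℝ) =
      ENNReal.ofReal (C ^ 2) * ENNReal.ofReal (Real.exp (-(τ / 4))) := by
  rw [← ENNReal.ofReal_mul (by positivity), ENNReal.ofReal_rpow_of_nonneg (by positivity)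
    (by norm_num)]
  congr 1
  norm_num
  rw [mul_pow, ← Real.exp_nat_mul]
  congr 2
  push_cast; ring

/-- Anisotropic Bernstein and heat estimates for one block. -/
theorem IsCutoff.exists_block_bounds {χ : Space → ℂ} (h : IsCutoff χ) :
    ∃ C : ℝ≥0∞, C ≠ ⊤ ∧ ∀ τ σ : ℝ, 0 ≤ τ → 0 ≤ σ → ∀ (k l : ℤ) (f : Space → Vec),
      StronglyMeasurable f →
      (∀ x, absConv (kernel (blockSymbol h τ σ k l)) f x ^ (2 : ℝ) ≤
        C * ENNReal.ofReal (Real.exp (-(τ / 4))) * 2 ^ (l : ℝ) * horConv (freq k) f (hor x)) ∧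
      ∀ y, ∫⁻ z : ℝ, absConv (kernel (blockSymbol h τ σ k l)) f (glue y z) ^ (2 : ℝ) ≤
        C * ENNReal.ofReal (Real.exp (-(τ / 4))) * horConv (freq k) f y := by
  obtain ⟨C, hC0, hC⟩ := h.exists_kernel_blockSymbol_le
  refine ⟨ENNReal.ofReal (C ^ 2) * wtMass ^ 3,
    ENNReal.mul_ne_top ENNReal.ofReal_ne_top (ENNReal.pow_ne_top wtMass_ne_top),
    fun τ σ hτ hσ k l f hf ↦ ⟨fun x ↦ ?_, fun y ↦ ?_⟩⟩
  · have := absConv_sq_le_horConv (freq_pos k) (freq_pos l) (hC τ σ hτ hσ k l) hf x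
    rw [sq_ofReal_exp C τ hC0] at this
    refine this.trans ?_
    calc _ ≤ ENNReal.ofReal (C ^ 2) * ENNReal.ofReal (Real.exp (-(τ / 4))) * wtMass ^ 3 *
          2 ^ (l : ℝ) * horConv (freq k) f (hor x) := by
          gcongr
          · exact one_le_wtMass
          · norm_num
          · exact ofReal_freq_le l
      _ = _ := by ring
  · have := lintegral_absConv_sq_le_horConv (freq_pos k) (freq_pos l) (hC τ σ hτ hσ k l) hf y
    rw [sq_ofReal_exp C τ hC0] at this
    exact this.trans (le_of_eq (by ring))

/-! ### Series of functions in the tempered distributions -/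

theorem exists_represents_of_bounded {F : Space → Vec} (hF : AEStronglyMeasurable F volume)
    {A : ℝ≥0∞} (hA : A ≠ ⊤) (hb : ∀ x, ‖F x‖ₑ ≤ A) : ∃ T, Represents T F := by
  have hb' : ∀ x, ‖F x‖ ≤ A.toReal := fun x ↦ by
    rw [← toReal_enorm]; exact ENNReal.toReal_mono hA (hb x)
  have hL : MemLp F ⊤ volume := memLp_top_of_bound hF A.toReal (.of_forall hb')
  refine ⟨Lp.toTemperedDistribution (hL.toLp F), represents_of_bounded hF hA hb fun ψ ↦ ?_⟩
  rw [Lp.toTemperedDistribution_apply]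
  refine integral_congr_ae ?_
  filter_upwards [hL.coeFn_toLp] with x hx
  rw [hx]

theorem hasSum_of_forall_apply {ι : Type*} {T : ι → 𝓢'(Space, Vec)} {S : 𝓢'(Space, Vec)}
    (h : ∀ ψ, HasSum (fun i ↦ T i ψ) (S ψ)) : HasSum T S := by
  unfold HasSum
  rw [PointwiseConvergenceCLM.tendsto_iff_forall_tendsto]
  intro ψ
  have := h ψ
  unfold HasSum at this
  convert this using 2 with s
  induction s using Finset.cons_induction with
  | empty => simp
  | cons i s hi ih => simp [Finset.sum_cons, ih]

/-- A series of functions whose sup norms are summable converges in the tempered distributions,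
and its sum is the pointwise sum. -/
theorem exists_hasSum_of_bounded {ι : Type*} [Countable ι] {T : ι → 𝓢'(Space, Vec)}
    {F : ι → Space → Vec} {A : ι → ℝ≥0∞} (hm : ∀ i, AEStronglyMeasurable (F i) volume)
    (hb : ∀ i x, ‖F i x‖ₑ ≤ A i) (hA : ∑' i, A i ≠ ⊤) (hT : ∀ i, Represents (T i) (F i)) :
    ∃ S, HasSum T S ∧ AEStronglyMeasurable (fun x ↦ ∑' i, F i x) volume ∧
      (∀ x, ‖∑' i, F i x‖ₑ ≤ ∑' i, A i) ∧ Represents S fun x ↦ ∑' i, F i x := by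
  have hAi : ∀ i, A i ≠ ⊤ := fun i ↦ ENNReal.ne_top_of_tsum_ne_top hA i
  have hsA : Summable fun i ↦ (A i).toReal := ENNReal.summable_toReal hA
  have hb' : ∀ i x, ‖F i x‖ ≤ (A i).toReal := fun i x ↦ by
    rw [← toReal_enorm]; exact ENNReal.toReal_mono (hAi i) (hb i x)
  have hs : ∀ x, Summable fun i ↦ F i x := fun x ↦
    Summable.of_norm_bounded hsA fun i ↦ hb' i x
  have hsm : AEStronglyMeasurable (fun x ↦ ∑' i, F i x) volume := by
    refine aestronglyMeasurable_of_tendsto_ae (u := (atTop : Filter (Finset ι)))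
      (f := fun s x ↦ ∑ i ∈ s, F i x) (fun s ↦ ?_) (.of_forall fun x ↦ (hs x).hasSum)
    exact Finset.aestronglyMeasurable_fun_sum s fun i _ ↦ hm i
  have hsb : ∀ x, ‖∑' i, F i x‖ₑ ≤ ∑' i, A i := fun x ↦ by
    have h1 : ‖∑' i, F i x‖ ≤ ∑' i, (A i).toReal :=
      tsum_of_norm_bounded hsA.hasSum fun i ↦ hb' i x
    rw [← ofReal_norm, ← ENNReal.ofReal_toReal hA, ENNReal.tsum_toReal_eq hAi]
    exact ENNReal.ofReal_le_ofReal h1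
  obtain ⟨S, hS⟩ := exists_represents_of_bounded hsm hA hsb
  refine ⟨S, hasSum_of_forall_apply fun ψ ↦ ?_, hsm, hsb, hS⟩
  rw [(hS.2 ψ).2]
  simp_rw [(hT _).2 ψ |>.2]
  have e : ∀ x, ψ x • ∑' i, F i x = ∑' i, ψ x • F i x := fun x ↦ ((hs x).tsum_const_smul _).symm
  simp_rw [e]
  refine hasSum_integral_of_summable_integral_norm (fun i ↦ ((hT i).2 ψ).1) ?_
  refine Summable.of_nonneg_of_le (fun i ↦ integral_nonneg fun x ↦ norm_nonneg _) (fun i ↦ ?_)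
    (hsA.mul_left (∫ x, ‖ψ x‖))
  rw [← integral_mul_const]
  refine integral_mono ((hT i).2 ψ).1.norm (ψ.integrable.norm.mul_const _) fun x ↦ ?_
  simp only [norm_smul]
  gcongr
  exact hb' i x

/-! ### Bounded multipliers on square integrable fields -/

theorem represents_Lp (v : Lp Vec 2 (volume : Measure Space)) :
    Represents (Lp.toTemperedDistribution v) v := by
  refine ⟨(Lp.memLp v).locallyIntegrable (by norm_num), fun ψ ↦ ⟨?_, by simp⟩⟩
  exact memLp_one_iff_integrable.1 ((Lp.memLp v).smul (p := 2) (q := 2) (ψ.memLp 2))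

theorem normL2_Lp_le (v : Lp Vec 2 (volume : Measure Space)) :
    normL2 (Lp.toTemperedDistribution v) ≤ ‖v‖ₑ := by
  refine (iInf₂_le (f := fun f (_ : Represents _ f) ↦ eLpNorm f 2 volume) _
    (represents_Lp v)).trans (le_of_eq ?_)
  rw [Lp.enorm_def]

/-- A bounded Fourier multiplier acts on `L²`, by Plancherel's theorem. -/
theorem exists_Lp_fourierMultiplier {N : 𝓢'(Space, Vec)} {n : Space → Vec} (hN : Represents N n)
    (hn : eLpNorm n 2 volume ≠ ⊤) {b : Space → ℂ} (hb : b.HasTemperateGrowth) {C : ℝ}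
    (hC : ∀ x, ‖b x‖ ≤ C) :
    ∃ v : Lp Vec 2 (volume : Measure Space),
      TemperedDistribution.fourierMultiplierCLM Vec b N = Lp.toTemperedDistribution v ∧
      ‖v‖ₑ ≤ ENNReal.ofReal C * eLpNorm n 2 volume := by
  have hn2 : MemLp n 2 volume := ⟨hN.aestronglyMeasurable, hn.lt_top⟩
  set u : Lp Vec 2 (volume : Measure Space) := hn2.toLp n with hu
  have hNu : N = Lp.toTemperedDistribution u := by
    ext1 ψ
    rw [(hN.2 ψ).2, Lp.toTemperedDistribution_apply]
    refine integral_congr_ae ?_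
    filter_upwards [hn2.coeFn_toLp] with x hx
    rw [hx]
  have hC0 : 0 ≤ C := (norm_nonneg _).trans (hC 0)
  have hbL : MemLp b ⊤ (volume : Measure Space) :=
    memLp_top_of_bound hb.1.continuous.aestronglyMeasurable C (.of_forall hC)
  set w : Lp Vec 2 (volume : Measure Space) := hbL.toLp b • 𝓕 u with hw
  refine ⟨𝓕⁻ w, ?_, ?_⟩
  · rw [TemperedDistribution.fourierMultiplierCLM_apply, hNu, Lp.fourier_toTemperedDistribution_eq,
      ← Lp.toTemperedDistribution_smul_eq (p := ⊤) (q := 2) (r := 2) hb hbL (𝓕 u), ← hw,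
      Lp.fourierInv_toTemperedDistribution_eq]
  · have h1 : ‖𝓕⁻ w‖ = ‖w‖ := (Lp.fourierTransformₗᵢ Space Vec).symm.norm_map w
    have h2 : ‖w‖ ≤ C * ‖u‖ := by
      refine (Lp.norm_smul_le (p := ⊤) (q := 2) (r := 2) (hbL.toLp b) (𝓕 u)).trans ?_
      rw [Lp.norm_fourier_eq]
      gcongr
      rw [Lp.norm_toLp]
      refine ENNReal.toReal_le_of_le_ofReal hC0 ?_
      exact eLpNormEssSup_le_of_ae_bound (.of_forall hC)
    have h3 : ‖u‖ₑ = eLpNorm n 2 volume := by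
      rw [hu, Lp.enorm_toLp]
    rw [← h3, ← ofReal_norm, ← ofReal_norm, ← ENNReal.ofReal_mul hC0, h1]
    exact ENNReal.ofReal_le_ofReal h2

/-- The triangle inequality for series that converge in the tempered distributions. -/
theorem normL2_le_tsum {ι : Type*} {T : ι → 𝓢'(Space, Vec)} {S : 𝓢'(Space, Vec)} (hS : HasSum T S)
    (v : ι → Lp Vec 2 (volume : Measure Space))
    (hv : ∀ i, T i = Lp.toTemperedDistribution (v i)) : normL2 S ≤ ∑' i, ‖v i‖ₑ := by
  by_cases hf : ∑' i, ‖v i‖ₑ = ⊤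
  · rw [hf]; exact le_top
  have hs : Summable fun i ↦ ‖v i‖ := by
    have := ENNReal.summable_toReal hf
    simpa using this
  have h1 : HasSum (fun i ↦ Lp.toTemperedDistributionCLM Vec volume 2 (v i))
      (Lp.toTemperedDistributionCLM Vec volume 2 (∑' i, v i)) :=
    (Lp.toTemperedDistributionCLM Vec volume 2).hasSum hs.of_norm.hasSum
  have h2 : S = Lp.toTemperedDistribution (∑' i, v i) := by
    refine hS.unique ?_
    have e : T = fun i ↦ Lp.toTemperedDistributionCLM Vec volume 2 (v i) := funext hv
    rw [e]
    exact h1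
  rw [h2]
  refine (normL2_Lp_le _).trans ?_
  rw [← ofReal_norm]
  refine (ENNReal.ofReal_le_ofReal (norm_tsum_le_tsum_norm hs)).trans ?_
  rw [ENNReal.ofReal_tsum_of_nonneg (fun _ ↦ norm_nonneg _) hs]
  simp

/-! ### The Fourier support of a product -/

/-- The product of two convolutions has its Fourier support in the sum of the supports of the
symbols: it is annihilated by a multiplier `b` that vanishes there. -/
theorem fourierMultiplier_mul_kconv_eq_zero (M₁ : 𝓢(Space, ℂ)) (M₂ : Fin 3 → 𝓢(Space, ℂ))
    {f₁ f₂ : Space → Vec} (hf₁ : StronglyMeasurable f₁) (hf₂ : StronglyMeasurable f₂)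
    {A₁ A₂ : ℝ≥0∞} (hA₁ : A₁ ≠ ⊤) (hA₂ : A₂ ≠ ⊤) (hb₁ : ∀ x, absConv (kernel M₁) f₁ x ≤ A₁)
    (hb₂ : ∀ m x, absConv (kernel (M₂ m)) f₂ x ≤ A₂) (c : Fin 3 → ℂ) {b : Space → ℂ}
    (hb : b.HasTemperateGrowth) (hsupp : ∀ m η η', M₁ η ≠ 0 → M₂ m η' ≠ 0 → b (η + η') = 0)
    {N : 𝓢'(Space, Vec)}
    (hN : Represents N fun x ↦
      ∑ m, kconv (kernel M₁) f₁ x m • c m • kconv (kernel (M₂ m)) f₂ x) :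
    TemperedDistribution.fourierMultiplierCLM Vec b N = 0 := by
  ext1 ψ
  -- the claim is `∫ ψ' N = 0` for a test function `ψ'` whose inverse transform vanishes where `b` does
  set ψ' : 𝓢(Space, ℂ) := 𝓕 (SchwartzMap.smulLeftCLM ℂ b (𝓕⁻ ψ)) with hψ'
  have hψb : ∀ ζ, b ζ = 0 → 𝓕⁻ (ψ' : Space → ℂ) ζ = 0 := by
    intro ζ hζ
    rw [← SchwartzMap.fourierInv_coe, hψ', FourierTransform.fourierInv_fourier_eq,
      SchwartzMap.smulLeftCLM_apply_apply hb, hζ, zero_smul]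
  rw [TemperedDistribution.fourierMultiplierCLM_apply_apply, ← hψ', (hN.2 ψ').2]
  set F := kconv (kernel M₁) f₁ with hF
  have hFm : AEStronglyMeasurable F volume :=
    (stronglyMeasurable_kconv (kernel M₁).continuous hf₁).aestronglyMeasurable
  have hFb : ∀ x, ‖F x‖ ≤ A₁.toReal := fun x ↦ by
    rw [← toReal_enorm]
    exact ENNReal.toReal_mono hA₁ ((enorm_kconv_le _ _ _).trans (hb₁ x))
  have hFi : Integrable fun x ↦ ψ' x • F x :=
    ψ'.integrable.smul_bdd (C := A₁.toReal) hFm (.of_forall hFb)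
  have hvi : ∀ m, Integrable fun x ↦ ψ' x * F x m := fun m ↦
    (EuclideanSpace.proj (𝕜 := ℂ) m : Vec →L[ℂ] ℂ).integrable_comp hFi
  have hG : ∀ m x, ‖kconv (kernel (M₂ m)) f₂ x‖ ≤ A₂.toReal := fun m x ↦ by
    rw [← toReal_enorm]
    exact ENNReal.toReal_mono hA₂ ((enorm_kconv_le _ _ _).trans (hb₂ m x))
  have hGi : ∀ m, Integrable fun x ↦ (ψ' x * F x m) • kconv (kernel (M₂ m)) f₂ x := fun m ↦
    (hvi m).smul_bdd (C := A₂.toReal)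
      (stronglyMeasurable_kconv (kernel (M₂ m)).continuous hf₂).aestronglyMeasurable
      (.of_forall (hG m))
  -- multiplying `ψ'` by the first convolution leaves a function without frequencies in the support
  -- of the second symbol
  have hv0 : ∀ m η', M₂ m η' ≠ 0 → 𝓕⁻ (fun x ↦ ψ' x * F x m) η' = 0 := by
    intro m η' hη'
    have h1 := fourierInv_smul_kconv_eq_zero M₁ hf₁ hA₁ hb₁ ψ'.integrable (ζ := η')
      fun η hη ↦ hψb _ (hsupp m η η' hη hη')
    rw [Real.fourierInv_eq] at h1 ⊢
    have hi : Integrable fun x ↦ Real.fourierChar (inner ℝ x η') • ψ' x • F x := by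
      have := (Real.fourierIntegral_convergent_iff (μ := volume) (-η')).2 hFi
      simpa [inner_neg_right] using this
    have h2 := (EuclideanSpace.proj (𝕜 := ℂ) m : Vec →L[ℂ] ℂ).integral_comp_comm hi
    rw [h1, map_zero] at h2
    rw [← h2]
    refine integral_congr_ae (.of_forall fun x ↦ ?_)
    simp [Circle.smul_def]
  -- multiplying by the second convolution then gives a function without the frequency `0`
  have h3 : ∀ m, ∫ x, (ψ' x * F x m) • kconv (kernel (M₂ m)) f₂ x = 0 := by
    intro m
    have := fourierInv_smul_kconv_eq_zero (M₂ m) hf₂ hA₂ (hb₂ m) (hvi m) (ζ := 0)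
      fun η hη ↦ by rw [add_zero]; exact hv0 m η hη
    rw [Real.fourierInv_eq] at this
    simpa using this
  have e : ∀ x, ψ' x • ∑ m, F x m • c m • kconv (kernel (M₂ m)) f₂ x =
      ∑ m, c m • (ψ' x * F x m) • kconv (kernel (M₂ m)) f₂ x := by
    intro x
    rw [Finset.smul_sum]
    refine Finset.sum_congr rfl fun m _ ↦ ?_
    simp only [smul_smul]
    congr 1
    ring
  simp_rw [e]
  have hcG : ∀ m, Integrable fun x ↦ c m • (ψ' x * F x m) • kconv (kernel (M₂ m)) f₂ x :=
    fun m ↦ (hGi m).smul (c m)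
  rw [integral_finsetSum _ fun m _ ↦ hcG m]
  change _ = (0 : Vec)
  simp [integral_smul, h3]

/-! ### Symbols of the blocks -/

theorem hasTemperateGrowth_coord (m : Fin 3) : (fun η : Space ↦ η m).HasTemperateGrowth :=
  (EuclideanSpace.proj (𝕜 := ℝ) m : Space →L[ℝ] ℝ).hasTemperateGrowth

theorem hasTemperateGrowth_quad (τ σ : ℝ) : (quad τ σ).HasTemperateGrowth := by
  have h0 := hasTemperateGrowth_coord 0
  have h1 := hasTemperateGrowth_coord 1
  have h2 := hasTemperateGrowth_coord 2
  unfold quad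
  fun_prop

/-- `r ↦ e^{-r}` has bounded derivatives on `[0, ∞)`, where `q` takes its values. -/
theorem hasTemperateGrowth_exp_neg {q : Space → ℝ} (hq : q.HasTemperateGrowth)
    (h0 : ∀ x, 0 ≤ q x) : (fun x ↦ Real.exp (-q x)).HasTemperateGrowth := by
  have hs : ContDiff ℝ ∞ fun x : ℝ ↦ Real.exp (-x) := by fun_prop
  refine Function.HasTemperateGrowth.comp' (g := fun x ↦ Real.exp (-x)) (t := Set.Ici 0) ?_
    (uniqueDiffOn_Ici 0) hs.contDiffOn (fun N ↦ ⟨0, 1, zero_le_one, fun n _ x hx ↦ ?_⟩) hq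
  · rintro _ ⟨x, rfl⟩
    exact h0 x
  · rw [norm_iteratedFDerivWithin_eq_norm_iteratedDerivWithin,
      iteratedDerivWithin_eq_iteratedDeriv (uniqueDiffOn_Ici 0)
        (hs.contDiffAt.of_le (mod_cast le_top)) hx, iteratedDeriv_comp_neg, iteratedDeriv_eq_iterate,
      Real.iter_deriv_exp]
    simpa [norm_smul] using hx

/-- `φ(√r)`: since `φ` vanishes near `0`, this is a smooth function of `r`. -/
def sqProfile (φ : ℝ → ℝ) (r : ℝ) : ℝ := φ √r

section
variable {φ : ℝ → ℝ} (hφ : IsDyadicProfile φ)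
include hφ

theorem IsDyadicProfile.bounds {r : ℝ} (hr : φ r ≠ 0) : 3 / 4 < r ∧ r < 8 / 3 :=
  hφ.tsupport_subset (subset_tsupport φ hr)

theorem IsDyadicProfile.sq_bounds {r : ℝ} (hr : sqProfile φ r ≠ 0) : 9 / 16 ≤ r ∧ r ≤ 64 / 9 := by
  obtain ⟨h1, h2⟩ := hφ.bounds hr
  have h0 : 0 ≤ r := by
    by_contra h
    rw [Real.sqrt_eq_zero_of_nonpos (by linarith)] at h1
    linarith
  have := Real.sq_sqrt h0
  constructor <;> nlinarith

theorem IsDyadicProfile.hasTemperateGrowth_sqProfile : (sqProfile φ).HasTemperateGrowth := by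
  refine HasCompactSupport.hasTemperateGrowth
    (HasCompactSupport.intro (isCompact_Icc (a := (9 / 16 : ℝ)) (b := 64 / 9)) fun r hr ↦ ?_) ?_
  · by_contra h
    exact hr (hφ.sq_bounds h)
  · rw [contDiff_iff_contDiffAt]
    intro r
    rcases lt_or_ge r (9 / 16) with h | h
    · refine (contDiffAt_const (c := (0 : ℝ))).congr_of_eventuallyEq ?_
      filter_upwards [Iio_mem_nhds h] with s hs
      by_contra h'
      exact absurd (hφ.sq_bounds h').1 (not_le.2 hs)
    · exact hφ.contDiff.contDiffAt.comp r (Real.contDiffAt_sqrt (by linarith))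

theorem IsDyadicProfile.exists_bound : ∃ C : ℝ, ∀ r, ‖φ r‖ ≤ C :=
  hφ.contDiff.continuous.bounded_above_of_compact_support hφ.hasCompactSupport

end

theorem two_zpow_mul_eq (k : ℤ) (x : ℝ) :
    (2 : ℝ) ^ (-k) * ((2 * Real.pi) * x) = (freq k)⁻¹ * x := by
  unfold freq
  rw [zpow_neg]
  field_simp

theorem two_pi_mul_eq (k : ℤ) (x : ℝ) : (2 * Real.pi) * x = 2 ^ k * ((freq k)⁻¹ * x) := by
  unfold freq
  field_simp

theorem horSymbol_eq (φ : ℝ → ℝ) (k l : ℤ) (η : Space) :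
    horSymbol φ k ((2 * Real.pi) • η) = sqProfile φ (dil (freq k)⁻¹ (freq l)⁻¹ η 0 ^ 2 +
      dil (freq k)⁻¹ (freq l)⁻¹ η 1 ^ 2) := by
  unfold horSymbol sqProfile horNorm
  congr 1
  rw [← Real.sqrt_sq (show (0 : ℝ) ≤ 2 ^ (-k) by positivity), ← Real.sqrt_mul (by positivity)]
  congr 1
  simp only [dil_zero_apply, dil_one_apply, ← two_zpow_mul_eq]
  simp
  ring

theorem verSymbol_eq (φ : ℝ → ℝ) (k l : ℤ) (η : Space) :
    verSymbol φ l ((2 * Real.pi) • η) = sqProfile φ (dil (freq k)⁻¹ (freq l)⁻¹ η 2 ^ 2) := by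
  unfold verSymbol sqProfile
  congr 1
  rw [Real.sqrt_sq_eq_abs, dil_two_apply, ← two_zpow_mul_eq, abs_mul,
    abs_of_pos (show (0 : ℝ) < 2 ^ (-l) by positivity)]
  simp

section
variable {φ : ℝ → ℝ} (hφ : IsDyadicProfile φ)
include hφ

theorem IsDyadicProfile.hasTemperateGrowth_horSymbol (k : ℤ) :
    (fun η : Space ↦ ((horSymbol φ k ((2 * Real.pi) • η) : ℝ) : ℂ)).HasTemperateGrowth := by
  have h1 := hφ.hasTemperateGrowth_sqProfile
  have h2 : (fun η : Space ↦ quad 1 0 (dil (freq k)⁻¹ (freq 0)⁻¹ η)).HasTemperateGrowth :=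
    (hasTemperateGrowth_quad 1 0).comp (dil (freq k)⁻¹ (freq 0)⁻¹).hasTemperateGrowth
  have h3 := Function.Complex.hasTemperateGrowth_ofReal.comp (h1.comp h2)
  refine cast (congrArg _ (funext fun η ↦ ?_)) h3
  simp [horSymbol_eq φ k 0 η, quad]

theorem IsDyadicProfile.hasTemperateGrowth_verSymbol (l : ℤ) :
    (fun η : Space ↦ ((verSymbol φ l ((2 * Real.pi) • η) : ℝ) : ℂ)).HasTemperateGrowth := by
  have h1 := hφ.hasTemperateGrowth_sqProfile
  have h2 : (fun η : Space ↦ quad 0 1 (dil (freq 0)⁻¹ (freq l)⁻¹ η)).HasTemperateGrowth :=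
    (hasTemperateGrowth_quad 0 1).comp (dil (freq 0)⁻¹ (freq l)⁻¹).hasTemperateGrowth
  have h3 := Function.Complex.hasTemperateGrowth_ofReal.comp (h1.comp h2)
  refine cast (congrArg _ (funext fun η ↦ ?_)) h3
  simp [verSymbol_eq φ 0 l η, quad]

/-- Two multipliers that agree on the Fourier support of a block act on it in the same way. -/
theorem IsDyadicProfile.fourierMultiplier_block_congr {g g' : Space → ℂ}
    (hg : g.HasTemperateGrowth) (hg' : g'.HasTemperateGrowth) {k l : ℤ}
    (h : ∀ η, (9 / 16 ≤ dil (freq k)⁻¹ (freq l)⁻¹ η 0 ^ 2 + dil (freq k)⁻¹ (freq l)⁻¹ η 1 ^ 2 ∧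
      dil (freq k)⁻¹ (freq l)⁻¹ η 0 ^ 2 + dil (freq k)⁻¹ (freq l)⁻¹ η 1 ^ 2 ≤ 64 / 9 ∧
      9 / 16 ≤ dil (freq k)⁻¹ (freq l)⁻¹ η 2 ^ 2 ∧ dil (freq k)⁻¹ (freq l)⁻¹ η 2 ^ 2 ≤ 64 / 9) →
      g η = g' η) (a : 𝓢'(Space, Vec)) :
    TemperedDistribution.fourierMultiplierCLM Vec g (deltaH φ k (deltaV φ l a)) =
      TemperedDistribution.fourierMultiplierCLM Vec g' (deltaH φ k (deltaV φ l a)) := by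
  have hh := hφ.hasTemperateGrowth_horSymbol k
  have hv := hφ.hasTemperateGrowth_verSymbol l
  simp only [deltaH, deltaV, multiplier]
  rw [TemperedDistribution.fourierMultiplierCLM_fourierMultiplierCLM_apply hv hh,
    TemperedDistribution.fourierMultiplierCLM_fourierMultiplierCLM_apply (hv.mul hh) hg,
    TemperedDistribution.fourierMultiplierCLM_fourierMultiplierCLM_apply (hv.mul hh) hg']
  congr 2
  funext η
  simp only [Pi.mul_apply]
  by_cases h1 : horSymbol φ k ((2 * Real.pi) • η) = 0
  · simp [h1]
  by_cases h2 : verSymbol φ l ((2 * Real.pi) • η) = 0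
  · simp [h2]
  rw [horSymbol_eq φ k l] at h1
  rw [verSymbol_eq φ k l] at h2
  have h3 := hφ.sq_bounds h1
  have h4 := hφ.sq_bounds h2
  rw [h η ⟨h3.1, h3.2, h4.1, h4.2⟩]

end

/-- A smooth function on the line, equal to `1` on `[1/2, 15/2]` and to `0` off `(1/4, 31/4)`. -/
def bump : ContDiffBump (4 : ℝ) := ⟨7 / 2, 15 / 4, by norm_num, by norm_num⟩

theorem bump_eq_one {r : ℝ} (h1 : 9 / 16 ≤ r) (h2 : r ≤ 64 / 9) : bump r = 1 := by
  refine bump.one_of_mem_closedBall ?_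
  rw [Metric.mem_closedBall, Real.dist_eq, abs_le]
  simp only [bump]
  constructor <;> linarith

theorem bump_bounds {r : ℝ} (h : bump r ≠ 0) : 1 / 4 ≤ r ∧ r ≤ 9 := by
  have h1 : r ∈ Function.support bump := h
  rw [bump.support_eq, Metric.mem_ball, Real.dist_eq, abs_lt] at h1
  simp only [bump] at h1
  constructor <;> linarith [h1.1, h1.2]

/-- The basic cutoff: smooth, and equal to `1` where both `|ζ_h|` and `|ζ_3|` lie in
`[3/4, 8/3]`. -/
def cutoff (ζ : Space) : ℂ := (bump (ζ 0 ^ 2 + ζ 1 ^ 2) * bump (ζ 2 ^ 2) : ℝ)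

theorem isCutoff_mul_cutoff {g : Space → ℂ} (hg : ContDiff ℝ ∞ fun ζ ↦ g ζ * cutoff ζ) :
    IsCutoff fun ζ ↦ g ζ * cutoff ζ where
  contDiff := hg
  bounds ζ hζ := by
    have h1 : bump (ζ 0 ^ 2 + ζ 1 ^ 2) ≠ 0 := fun h ↦ hζ (by simp [cutoff, h])
    have h2 : bump (ζ 2 ^ 2) ≠ 0 := fun h ↦ hζ (by simp [cutoff, h])
    exact ⟨(bump_bounds h1).1, (bump_bounds h1).2, (bump_bounds h2).1, (bump_bounds h2).2⟩

theorem contDiff_cutoff : ContDiff ℝ ∞ cutoff := by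
  have h := bump.contDiff (n := (⊤ : ℕ∞))
  have h1 : ContDiff ℝ ∞ fun ζ : Space ↦ bump (ζ 0 ^ 2 + ζ 1 ^ 2) :=
    h.comp (f := fun ζ : Space ↦ ζ 0 ^ 2 + ζ 1 ^ 2) (by fun_prop)
  have h2 : ContDiff ℝ ∞ fun ζ : Space ↦ bump (ζ 2 ^ 2) :=
    h.comp (f := fun ζ : Space ↦ ζ 2 ^ 2) (by fun_prop)
  exact Complex.ofRealCLM.contDiff.comp (h1.mul h2)

theorem isCutoff_cutoff : IsCutoff cutoff := by
  simpa using isCutoff_mul_cutoff (g := fun _ ↦ 1) (by simpa using contDiff_cutoff)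

/-- The symbol of `∂_m` times the basic cutoff. -/
def derivCutoff (m : Fin 3) (ζ : Space) : ℂ := Complex.I * (ζ m : ℝ) * cutoff ζ

theorem isCutoff_derivCutoff (m : Fin 3) : IsCutoff (derivCutoff m) := by
  refine isCutoff_mul_cutoff (g := fun ζ ↦ Complex.I * (ζ m : ℝ)) (ContDiff.mul ?_ contDiff_cutoff)
  exact contDiff_const.mul (Complex.ofRealCLM.contDiff.comp (f := fun ζ : Space ↦ ζ m)
    (by fun_prop))

/-- The basic cutoff divided by `|ζ_h|²`. -/
def divCutoff (ζ : Space) : ℂ := ((ζ 0 ^ 2 + ζ 1 ^ 2 : ℝ) : ℂ)⁻¹ * cutoff ζ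

theorem isCutoff_divCutoff : IsCutoff divCutoff := by
  refine isCutoff_mul_cutoff (g := fun ζ ↦ ((ζ 0 ^ 2 + ζ 1 ^ 2 : ℝ) : ℂ)⁻¹) ?_
  rw [contDiff_iff_contDiffAt]
  intro ζ
  by_cases h : ζ ∈ tsupport cutoff
  · have h1 := (isCutoff_cutoff.tsupport_bounds h).1
    have h2 : ContDiffAt ℝ ∞ (fun ζ : Space ↦ ((ζ 0 ^ 2 + ζ 1 ^ 2 : ℝ) : ℂ)) ζ :=
      (Complex.ofRealCLM.contDiff.comp (f := fun ζ : Space ↦ ζ 0 ^ 2 + ζ 1 ^ 2)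
        (by fun_prop)).contDiffAt
    refine (h2.inv ?_).mul contDiff_cutoff.contDiffAt
    rw [Complex.ofReal_ne_zero]
    linarith
  · refine (contDiffAt_const (c := (0 : ℂ))).congr_of_eventuallyEq ?_
    filter_upwards [notMem_tsupport_iff_eventuallyEq.1 h] with x hx
    simp [hx]

theorem cutoff_eq_one {ζ : Space} (h : 9 / 16 ≤ ζ 0 ^ 2 + ζ 1 ^ 2 ∧ ζ 0 ^ 2 + ζ 1 ^ 2 ≤ 64 / 9 ∧
    9 / 16 ≤ ζ 2 ^ 2 ∧ ζ 2 ^ 2 ≤ 64 / 9) : cutoff ζ = 1 := by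
  rw [cutoff, bump_eq_one h.1 h.2.1, bump_eq_one h.2.2.1 h.2.2.2]
  simp

/-- The scale `2^k` or `2^l` of the derivative `∂_m` on a block. -/
def derivScale (k l : ℤ) (m : Fin 3) : ℝ := if m = 2 then 2 ^ l else 2 ^ k

theorem derivScale_mul (k l : ℤ) (m : Fin 3) (η : Space) :
    derivScale k l m * dil (freq k)⁻¹ (freq l)⁻¹ η m = 2 * Real.pi * η m := by
  fin_cases m
  · simp [derivScale, two_pi_mul_eq k]
  · simp [derivScale, two_pi_mul_eq k]
  · simp [derivScale, two_pi_mul_eq l]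

theorem horNorm_sq (ξ : Space) : horNorm ξ ^ 2 = ξ 0 ^ 2 + ξ 1 ^ 2 :=
  Real.sq_sqrt (by positivity)

/-- The symbol `|ξ_h|²` of `-Δ_h`, at `ξ = 2π η`. -/
def horLaplaceSymbol (η : Space) : ℂ := (quad ((2 * Real.pi) ^ 2) 0 η : ℝ)

theorem hasTemperateGrowth_horLaplaceSymbol : horLaplaceSymbol.HasTemperateGrowth :=
  Function.Complex.hasTemperateGrowth_ofReal.comp (hasTemperateGrowth_quad ((2 * Real.pi) ^ 2) 0)

theorem horLaplaceSymbol_eq (k l : ℤ) (η : Space) : horLaplaceSymbol η = ((2 ^ k) ^ 2 *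
    (dil (freq k)⁻¹ (freq l)⁻¹ η 0 ^ 2 + dil (freq k)⁻¹ (freq l)⁻¹ η 1 ^ 2) : ℝ) := by
  unfold horLaplaceSymbol quad
  congr 1
  have h0 := two_pi_mul_eq k (η 0)
  have h1 := two_pi_mul_eq k (η 1)
  simp only [dil_zero_apply, dil_one_apply]
  calc _ = (2 * Real.pi * η 0) ^ 2 + (2 * Real.pi * η 1) ^ 2 := by ring
    _ = _ := by rw [h0, h1]; ring

/-- The heat symbol at `ξ = 2π η`, in the variable of the block `(k, l)`. -/
theorem heatSymbol_eq (νh ν3 t : ℝ) (k l : ℤ) (η : Space) :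
    Real.exp (-(νh * t * horNorm ((2 * Real.pi) • η) ^ 2 +
      ν3 * t * ((2 * Real.pi) • η : Space) 2 ^ 2)) =
    Real.exp (-quad (νh * t * (2 ^ k) ^ 2) (ν3 * t * (2 ^ l) ^ 2)
      (dil (freq k)⁻¹ (freq l)⁻¹ η)) := by
  have h0 := two_pi_mul_eq k (η 0)
  have h1 := two_pi_mul_eq k (η 1)
  have h2 := two_pi_mul_eq l (η 2)
  congr 2
  rw [horNorm_sq, quad]
  simp only [dil_zero_apply, dil_one_apply, dil_two_apply, PiLp.smul_apply, smul_eq_mul]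
  rw [h0, h1, h2]
  ring

theorem hasTemperateGrowth_heatSymbol {νh ν3 t : ℝ} (hνh : 0 ≤ νh) (hν3 : 0 ≤ ν3) (ht : 0 ≤ t) :
    (fun η : Space ↦ ((Real.exp (-(νh * t * horNorm ((2 * Real.pi) • η) ^ 2 +
      ν3 * t * ((2 * Real.pi) • η : Space) 2 ^ 2)) : ℝ) : ℂ)).HasTemperateGrowth := by
  simp_rw [heatSymbol_eq νh ν3 t 0 0]
  refine Function.Complex.hasTemperateGrowth_ofReal.comp
    (hasTemperateGrowth_exp_neg (q := fun η ↦ quad (νh * t * (2 ^ (0 : ℤ)) ^ 2)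
      (ν3 * t * (2 ^ (0 : ℤ)) ^ 2) (dil (freq 0)⁻¹ (freq 0)⁻¹ η)) ?_ fun η ↦ ?_)
  · exact (hasTemperateGrowth_quad _ _).comp (dil (freq 0)⁻¹ (freq 0)⁻¹).hasTemperateGrowth
  · unfold quad
    positivity

section
variable {φ : ℝ → ℝ} (hφ : IsDyadicProfile φ)
include hφ

theorem IsDyadicProfile.heat_block {νh ν3 t : ℝ} (hνh : 0 ≤ νh) (hν3 : 0 ≤ ν3) (ht : 0 ≤ t)
    (k l : ℤ) (a : 𝓢'(Space, Vec)) :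
    heat νh ν3 t (deltaH φ k (deltaV φ l a)) =
      TemperedDistribution.fourierMultiplierCLM Vec (blockSymbol isCutoff_cutoff
        (νh * t * (2 ^ k) ^ 2) (ν3 * t * (2 ^ l) ^ 2) k l) (deltaH φ k (deltaV φ l a)) := by
  refine hφ.fourierMultiplier_block_congr (hasTemperateGrowth_heatSymbol hνh hν3 ht)
    (SchwartzMap.hasTemperateGrowth _) (fun η hη ↦ ?_) a
  rw [blockSymbol_apply, damp, cutoff_eq_one hη, heatSymbol_eq νh ν3 t k l]
  simp

theorem IsDyadicProfile.lineDeriv_heat_block {νh ν3 t : ℝ} (hνh : 0 ≤ νh) (hν3 : 0 ≤ ν3)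
    (ht : 0 ≤ t) (k l : ℤ) (m : Fin 3) (a : 𝓢'(Space, Vec)) :
    ∂_{EuclideanSpace.single m (1 : ℝ)} (heat νh ν3 t (deltaH φ k (deltaV φ l a))) =
      (derivScale k l m : ℂ) •
      TemperedDistribution.fourierMultiplierCLM Vec (blockSymbol (isCutoff_derivCutoff m)
        (νh * t * (2 ^ k) ^ 2) (ν3 * t * (2 ^ l) ^ 2) k l) (deltaH φ k (deltaV φ l a)) := by
  have hi : (fun η : Space ↦ ((inner ℝ η (EuclideanSpace.single m (1 : ℝ)) : ℝ) :
      ℂ)).HasTemperateGrowth := by fun_prop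
  have hh := hasTemperateGrowth_heatSymbol hνh hν3 ht
  have hb := (blockSymbol (isCutoff_derivCutoff m)
        (νh * t * (2 ^ k) ^ 2) (ν3 * t * (2 ^ l) ^ 2) k l).hasTemperateGrowth
  rw [TemperedDistribution.lineDeriv_eq_fourierMultiplierCLM]
  unfold heat multiplier
  rw [TemperedDistribution.fourierMultiplierCLM_fourierMultiplierCLM_apply hh hi,
    ← smul_apply, ← smul_apply,
    ← TemperedDistribution.fourierMultiplierCLM_smul (hh.mul hi),
    ← TemperedDistribution.fourierMultiplierCLM_smul hb]
  refine hφ.fourierMultiplier_block_congr ((Function.HasTemperateGrowth.const _).mul (hh.mul hi))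
    ((Function.HasTemperateGrowth.const _).mul hb) (fun η hη ↦ ?_) a
  have e := congrArg (fun r : ℝ ↦ (r : ℂ)) (derivScale_mul k l m η)
  simp only [Pi.mul_apply, blockSymbol_apply, damp, derivCutoff,
    cutoff_eq_one hη, heatSymbol_eq νh ν3 t k l, EuclideanSpace.inner_single_right, mul_one,
    Complex.real_smul]
  push_cast at e ⊢
  simp only [conj_trivial]
  linear_combination (-Complex.I * Complex.exp (-(quad (νh * t * (2 ^ k) ^ 2)
    (ν3 * t * (2 ^ l) ^ 2) (dil (freq k)⁻¹ (freq l)⁻¹ η) : ℝ))) * e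

theorem IsDyadicProfile.block_eq_cutoff (k l : ℤ) (a : 𝓢'(Space, Vec)) :
    deltaH φ k (deltaV φ l a) =
      TemperedDistribution.fourierMultiplierCLM Vec (blockSymbol isCutoff_cutoff 0 0 k l)
        (deltaH φ k (deltaV φ l a)) := by
  have h := hφ.fourierMultiplier_block_congr (Function.HasTemperateGrowth.const (1 : ℂ))
    (blockSymbol isCutoff_cutoff 0 0 k l).hasTemperateGrowth (k := k) (l := l)
    (fun η hη ↦ by rw [blockSymbol_apply, damp, cutoff_eq_one hη]; simp [quad]) a
  rw [← h]
  simp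

/-- A block is `2^{-2k}` times the horizontal Laplacian of a bounded function of the size of the
block. -/
theorem IsDyadicProfile.block_eq_horLaplace (k l : ℤ) (a : 𝓢'(Space, Vec)) :
    deltaH φ k (deltaV φ l a) =
      TemperedDistribution.fourierMultiplierCLM Vec horLaplaceSymbol
        ((((2 ^ k) ^ 2)⁻¹ : ℂ) •
        TemperedDistribution.fourierMultiplierCLM Vec (blockSymbol isCutoff_divCutoff 0 0 k l)
          (deltaH φ k (deltaV φ l a))) := by
  have hb := (blockSymbol isCutoff_divCutoff 0 0 k l).hasTemperateGrowth
  have hc : ((((2 ^ k) ^ 2)⁻¹ : ℂ) •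
      (blockSymbol isCutoff_divCutoff 0 0 k l : Space → ℂ)).HasTemperateGrowth :=
    (Function.HasTemperateGrowth.const _).mul hb
  have h := hφ.fourierMultiplier_block_congr (Function.HasTemperateGrowth.const (1 : ℂ))
    (hc.mul hasTemperateGrowth_horLaplaceSymbol)
    (g' := ((((2 ^ k) ^ 2)⁻¹ : ℂ) • (blockSymbol isCutoff_divCutoff 0 0 k l : Space → ℂ)) *
      horLaplaceSymbol) (k := k) (l := l) (fun η hη ↦ ?_) a
  · rw [← smul_apply, ← TemperedDistribution.fourierMultiplierCLM_smul hb,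
      TemperedDistribution.fourierMultiplierCLM_fourierMultiplierCLM_apply
        hc hasTemperateGrowth_horLaplaceSymbol, ← h]
    simp
  · simp only [Pi.smul_apply, Pi.mul_apply, smul_eq_mul, blockSymbol_apply, damp, divCutoff,
      cutoff_eq_one hη, horLaplaceSymbol_eq k l]
    have h1 : ((dil (freq k)⁻¹ (freq l)⁻¹ η 0 ^ 2 + dil (freq k)⁻¹ (freq l)⁻¹ η 1 ^ 2 : ℝ) : ℂ)
        ≠ 0 := Complex.ofReal_ne_zero.2 (by linarith [hη.1])
    generalize dil (freq k)⁻¹ (freq l)⁻¹ η = ζ at h1 ⊢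
    rw [Complex.ofReal_mul]
    have h2 : ((2 : ℂ) ^ k) ≠ 0 := zpow_ne_zero _ two_ne_zero
    simp only [quad, zero_mul, add_zero, neg_zero, Real.exp_zero, one_smul, mul_one]
    push_cast at h1 ⊢
    field_simp

end

/-! ### The blocks of a Besov field -/

/-- The blocks of a field of finite Besov norm are functions; their sizes `β k l` have a finite
`ℓ¹_l ℓ²_k` norm. -/
theorem exists_blocks {φ : ℝ → ℝ} {p : ℝ} {a : 𝓢'(Space, Vec)} (ha : besovNorm φ p a ≠ ⊤) :
    ∃ (f : {q : ℤ × ℤ // q.2 - 1 ≤ q.1} → Space → Vec) (β : ℤ → ℤ → ℝ≥0∞),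
      (∀ q, StronglyMeasurable (f q) ∧ Represents (highBlock φ a q) (f q) ∧
        (2 : ℝ≥0∞) ^ (q.1.2 : ℝ) * blockMass p q.1.1 (f q) ≤ β q.1.1 q.1.2 ^ 2) ∧
      ∑' l, (∑' k, β k l ^ 2) ^ (1 / 2 : ℝ) ≤ besovNorm φ p a := by
  set B : ℤ → ℤ → ℝ≥0∞ := fun k l ↦ (2 : ℝ≥0∞) ^ ((-2 + 4 / p) * (k : ℝ)) *
      mixedNorm p (deltaH φ k (deltaV φ l a)) ^ (2 : ℝ) with hB
  have h1 : ∑' l : ℤ, (2 : ℝ≥0∞) ^ ((l : ℝ) / 2) *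
      (∑' k : Set.Ici (l - 1), B k l) ^ (1 / 2 : ℝ) ≤ besovNorm φ p a := le_self_add
  -- every weight in the Besov norm is positive, so each block has finite mixed norm
  have hfin : ∀ l k, l - 1 ≤ k → mixedNorm p (deltaH φ k (deltaV φ l a)) ≠ ⊤ := by
    intro l k hkl htop
    have h2 : (2 : ℝ≥0∞) ^ ((l : ℝ) / 2) * (∑' k : Set.Ici (l - 1), B k l) ^ (1 / 2 : ℝ) ≠ ⊤ :=
      ENNReal.ne_top_of_tsum_ne_top (ne_top_of_le_ne_top ha h1) l
    have h3 : ∑' k : Set.Ici (l - 1), B k l = ⊤ := by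
      refine ENNReal.tsum_eq_top_of_eq_top ⟨⟨k, hkl⟩, ?_⟩
      simp [hB, htop, ENNReal.mul_top (two_rpow_ne_zero _)]
    refine h2 ?_
    rw [h3, ENNReal.top_rpow_of_pos (by norm_num), ENNReal.mul_top (two_rpow_ne_zero _)]
  have hex : ∀ q : {q : ℤ × ℤ // q.2 - 1 ≤ q.1}, ∃ f, StronglyMeasurable f ∧
      Represents (highBlock φ a q) f ∧ mixedNormFun p f = mixedNorm p (highBlock φ a q) :=
    fun q ↦ exists_represents_of_mixedNorm_ne_top (hfin _ _ q.2)
  choose f hf1 hf2 hf3 using hex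
  set b : ℤ → ℤ → ℝ≥0∞ := fun k l ↦ (Set.Ici (l - 1)).indicator (fun k ↦ 2 ^ (l : ℝ) * B k l) k
    with hb
  have hbsq : ∀ k l, (b k l ^ (1 / 2 : ℝ)) ^ 2 = b k l := fun k l ↦ by
    rw [← ENNReal.rpow_two, ← ENNReal.rpow_mul]
    norm_num
  refine ⟨f, fun k l ↦ b k l ^ (1 / 2 : ℝ), fun q ↦ ⟨hf1 q, hf2 q, ?_⟩, ?_⟩
  · rw [hbsq, hb]
    simp only
    rw [Set.indicator_of_mem (show q.1.1 ∈ Set.Ici (q.1.2 - 1) from q.2), blockMass, hf3]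
    exact le_rfl
  · refine le_trans (ENNReal.tsum_le_tsum fun l ↦ ?_) h1
    simp_rw [hbsq]
    rw [hb, ← tsum_subtype, ENNReal.tsum_mul_left, ENNReal.mul_rpow_of_nonneg _ _ (by norm_num),
      ← ENNReal.rpow_mul, mul_one_div]

theorem le_of_sq_le {x y : ℝ≥0∞} (h : x ^ 2 ≤ y ^ 2) : x ≤ y :=
  (ENNReal.pow_le_pow_left_iff two_ne_zero).1 h

theorem sqrt_sq (x : ℝ≥0∞) : (x ^ (1 / 2 : ℝ)) ^ 2 = x := by
  rw [← ENNReal.rpow_two, ← ENNReal.rpow_mul]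
  norm_num

/-- The decay `e^{-τ/8}` of the heat kernel of a block. -/
def heatDecay (τ : ℝ) : ℝ≥0∞ := ENNReal.ofReal (Real.exp (-(τ / 8)))

theorem heatDecay_sq (τ : ℝ) : heatDecay τ ^ 2 = ENNReal.ofReal (Real.exp (-(τ / 4))) := by
  have := sq_ofReal_exp 1 τ zero_le_one
  simpa [ENNReal.rpow_two, heatDecay] using this

theorem two_rpow_two_mul (x : ℝ) : (2 : ℝ≥0∞) ^ (2 * x) = (2 ^ x) ^ 2 := by
  rw [two_mul, two_rpow_add, sq]

/-- The sup norm of a heated block is at most `e^{-τ/8} 2^k β`. -/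
theorem IsCutoff.exists_absConv_le {χ : Space → ℂ} (h : IsCutoff χ) :
    ∃ C : ℝ≥0∞, C ≠ ⊤ ∧ ∀ τ σ : ℝ, 0 ≤ τ → 0 ≤ σ → ∀ p : ℝ, 2 ≤ p → p ≤ 4 →
      ∀ (k l : ℤ) (f : Space → Vec) (β : ℝ≥0∞), StronglyMeasurable f →
      (2 : ℝ≥0∞) ^ (l : ℝ) * blockMass p k f ≤ β ^ 2 →
      ∀ x, absConv (kernel (blockSymbol h τ σ k l)) f x ≤
        C * heatDecay τ * (2 ^ (k : ℝ) * β) := by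
  obtain ⟨C, hC, H⟩ := h.exists_block_bounds
  refine ⟨(C * wtMass) ^ (1 / 2 : ℝ), ENNReal.rpow_ne_top_of_nonneg (by norm_num)
    (ENNReal.mul_ne_top hC wtMass_ne_top), fun τ σ hτ hσ p hp hp4 k l f β hf hβ x ↦ ?_⟩
  have h1 := (H τ σ hτ hσ k l f hf).1 x
  rw [ENNReal.rpow_two, ← heatDecay_sq] at h1
  refine le_of_sq_le (h1.trans ?_)
  rw [mul_pow, mul_pow, sqrt_sq, mul_pow]
  calc _ ≤ C * heatDecay τ ^ 2 * 2 ^ (l : ℝ) *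
        (wtMass * 2 ^ (2 * (k : ℝ)) * blockMass p k f) := by
        gcongr
        exact horConv_freq_le k hf hp hp4 _
    _ = C * wtMass * heatDecay τ ^ 2 * ((2 ^ (k : ℝ)) ^ 2 * (2 ^ (l : ℝ) * blockMass p k f)) := by
        rw [two_rpow_two_mul]; ring
    _ ≤ _ := by gcongr

theorem measurable_absConv (M : 𝓢(Space, ℂ)) {f : Space → Vec} (hf : StronglyMeasurable f) :
    Measurable (absConv (kernel M) f) := by
  have h : Measurable fun q : Space × Space ↦ ‖kernel M (q.1 - q.2)‖ₑ * ‖f q.2‖ₑ :=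
    (((kernel M).continuous.comp (continuous_fst.sub continuous_snd)).measurable.enorm).mul
      (hf.enorm.comp measurable_snd)
  exact h.lintegral_prod_right'

/-- The `L²` norm of a product: `L^∞` in the vertical variable on the first factor, `L²` on the
second, and the Cauchy–Schwarz inequality in the horizontal variables. -/
theorem lintegral_mul_sq_le {F F' : Space → ℝ≥0∞} (hF : Measurable F) (hF' : Measurable F')
    {H H' : Plane → ℝ≥0∞} (hH : Measurable H) (hH' : Measurable H') {A A' : ℝ≥0∞}
    (h : ∀ x, F x ^ 2 ≤ A * H (hor x)) (h' : ∀ y, ∫⁻ z : ℝ, F' (glue y z) ^ 2 ≤ A' * H' y) :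
    ∫⁻ x, (F x * F' x) ^ 2 ≤ A * A' *
      ((∫⁻ y, H y ^ (2 : ℝ)) ^ (1 / 2 : ℝ) * (∫⁻ y, H' y ^ (2 : ℝ)) ^ (1 / 2 : ℝ)) := by
  rw [lintegral_space (g := fun x ↦ (F x * F' x) ^ 2) ((hF.mul hF').pow_const 2)]
  calc _ ≤ ∫⁻ y : Plane, A * A' * (H y * H' y) := by
        refine lintegral_mono fun y ↦ ?_
        calc _ ≤ ∫⁻ z : ℝ, (A * H y) * F' (glue y z) ^ 2 := by
              refine lintegral_mono fun z ↦ ?_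
              simp only
              rw [mul_pow]
              gcongr
              simpa using h (glue y z)
          _ = (A * H y) * ∫⁻ z : ℝ, F' (glue y z) ^ 2 :=
              lintegral_const_mul _ ((hF'.comp (continuous_glue_right y).measurable).pow_const 2)
          _ ≤ (A * H y) * (A' * H' y) := by gcongr; exact h' y
          _ = _ := by ring
    _ = A * A' * ∫⁻ y : Plane, H y * H' y := lintegral_const_mul _ (hH.mul hH')
    _ ≤ _ := by
        gcongr
        exact ENNReal.lintegral_mul_le_Lp_mul_Lq volume .two_two hH.aemeasurable hH'.aemeasurable

/-- The `L²` norm of the product of two heated blocks. The gain `2^{-max(l, l')/2}` comes from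
applying Bernstein's inequality in the vertical variable to the block of lower frequency. -/
theorem IsCutoff.exists_lintegral_mul_le {χ χ' : Space → ℂ} (h : IsCutoff χ) (h' : IsCutoff χ') :
    ∃ C : ℝ≥0∞, C ≠ ⊤ ∧ ∀ τ σ τ' σ' : ℝ, 0 ≤ τ → 0 ≤ σ → 0 ≤ τ' → 0 ≤ σ' →
      ∀ p : ℝ, 2 ≤ p → p ≤ 4 → ∀ (k l k' l' : ℤ) (f f' : Space → Vec) (β β' : ℝ≥0∞),
      StronglyMeasurable f → StronglyMeasurable f' →
      (2 : ℝ≥0∞) ^ (l : ℝ) * blockMass p k f ≤ β ^ 2 →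
      (2 : ℝ≥0∞) ^ (l' : ℝ) * blockMass p k' f' ≤ β' ^ 2 →
      ∫⁻ x, (absConv (kernel (blockSymbol h τ σ k l)) f x *
          absConv (kernel (blockSymbol h' τ' σ' k' l')) f' x) ^ 2 ≤
        (C * heatDecay τ * heatDecay τ' *
          2 ^ (((k : ℝ) + (k' : ℝ) - ((max l l' : ℤ) : ℝ)) / 2) * (β * β')) ^ 2 := by
  obtain ⟨C, hC, H⟩ := h.exists_block_bounds
  obtain ⟨C', hC', H'⟩ := h'.exists_block_bounds
  refine ⟨(C * C' * wtMass ^ 3) ^ (1 / 2 : ℝ), ENNReal.rpow_ne_top_of_nonneg (by norm_num)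
    (ENNReal.mul_ne_top (ENNReal.mul_ne_top hC hC') (ENNReal.pow_ne_top wtMass_ne_top)),
    fun τ σ τ' σ' hτ hσ hτ' hσ' p hp hp4 k l k' l' f f' β β' hf hf' hβ hβ' ↦ ?_⟩
  obtain ⟨a1, a2⟩ := H τ σ hτ hσ k l f hf
  obtain ⟨b1, b2⟩ := H' τ' σ' hτ' hσ' k' l' f' hf'
  simp only [ENNReal.rpow_two, ← heatDecay_sq] at a1 a2 b1 b2
  have mF := measurable_absConv (blockSymbol h τ σ k l) hf
  have mF' := measurable_absConv (blockSymbol h' τ' σ' k' l') hf'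
  set F := absConv (kernel (blockSymbol h τ σ k l)) f
  set F' := absConv (kernel (blockSymbol h' τ' σ' k' l')) f'
  have mH := measurable_horConv hf (freq k)
  have mH' := measurable_horConv hf' (freq k')
  have c1 : ∀ {g : Space → Vec} (_ : StronglyMeasurable g) (k : ℤ),
      (∫⁻ y, horConv (freq k) g y ^ (2 : ℝ)) ^ (1 / 2 : ℝ) ≤
        (wtMass ^ 3) ^ (1 / 2 : ℝ) * (2 ^ (k : ℝ) * blockMass p k g) := fun hg k ↦ by
    refine (ENNReal.rpow_le_rpow (lintegral_horConv_freq_sq_le k hg hp hp4)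
      (by norm_num)).trans (le_of_eq ?_)
    rw [ENNReal.mul_rpow_of_nonneg _ _ (by norm_num), ← ENNReal.rpow_mul]
    norm_num
  set g := blockMass p k f
  set g' := blockMass p k' f'
  set W := (wtMass ^ 3) ^ (1 / 2 : ℝ) with hW
  have hW2 : W * W = wtMass ^ 3 := by rw [← sq, hW, sqrt_sq]
  have key : ∫⁻ x, (F x * F' x) ^ 2 ≤ (C * heatDecay τ ^ 2) * (C' * heatDecay τ' ^ 2) *
      2 ^ ((min l l' : ℤ) : ℝ) * ((W * (2 ^ (k : ℝ) * g)) * (W * (2 ^ (k' : ℝ) * g'))) := by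
    rcases le_total l l' with hl | hl
    · refine (lintegral_mul_sq_le mF mF' mH mH' a1 b2).trans ?_
      rw [min_eq_left hl]
      calc _ ≤ C * heatDecay τ ^ 2 * 2 ^ (l : ℝ) * (C' * heatDecay τ' ^ 2) *
            ((W * (2 ^ (k : ℝ) * g)) * (W * (2 ^ (k' : ℝ) * g'))) := by
            gcongr
            · exact c1 hf k
            · exact c1 hf' k'
        _ = _ := by ring
    · simp_rw [mul_comm (F _)]
      refine (lintegral_mul_sq_le mF' mF mH' mH b1 a2).trans ?_
      rw [min_eq_right hl]
      calc _ ≤ C' * heatDecay τ' ^ 2 * 2 ^ (l' : ℝ) * (C * heatDecay τ ^ 2) *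
            ((W * (2 ^ (k' : ℝ) * g')) * (W * (2 ^ (k : ℝ) * g))) := by
            gcongr
            · exact c1 hf' k'
            · exact c1 hf k
        _ = _ := by ring
  refine key.trans ?_
  have e : (2 : ℝ≥0∞) ^ ((min l l' : ℤ) : ℝ) =
      2 ^ (-((max l l' : ℤ) : ℝ)) * 2 ^ (l : ℝ) * 2 ^ (l' : ℝ) := by
    rw [← two_rpow_add, ← two_rpow_add]
    congr 1
    have := min_add_max l l'
    have : ((min l l' : ℤ) : ℝ) + ((max l l' : ℤ) : ℝ) = l + l' := by exact_mod_cast this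
    linarith
  have e2 : ((2 : ℝ≥0∞) ^ (((k : ℝ) + (k' : ℝ) - ((max l l' : ℤ) : ℝ)) / 2)) ^ 2 =
      2 ^ (k : ℝ) * 2 ^ (k' : ℝ) * 2 ^ (-((max l l' : ℤ) : ℝ)) := by
    rw [← two_rpow_two_mul, ← two_rpow_add, ← two_rpow_add]
    congr 1; ring
  simp only [mul_pow]
  rw [sqrt_sq, e, e2]
  calc _ = C * C' * (W * W) * heatDecay τ ^ 2 * heatDecay τ' ^ 2 *
        (2 ^ (k : ℝ) * 2 ^ (k' : ℝ) * 2 ^ (-((max l l' : ℤ) : ℝ))) *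
        ((2 ^ (l : ℝ) * g) * (2 ^ (l' : ℝ) * g')) := by ring
    _ ≤ _ := by rw [hW2]; gcongr

/-! ### Dyadic sums -/

theorem tsum_two_rpow_neg_abs_ne_top {r : ℝ} (hr : 0 < r) :
    ∑' k : ℤ, (2 : ℝ≥0∞) ^ (-(r * |(k : ℝ)|)) ≠ ⊤ := by
  have hlt : (2 : ℝ≥0∞) ^ (-r) < 1 :=
    ENNReal.rpow_lt_one_of_one_lt_of_neg (by norm_num) (by linarith)
  have hg : ∑' n : ℕ, ((2 : ℝ≥0∞) ^ (-r)) ^ n ≠ ⊤ := by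
    rw [ENNReal.tsum_geometric]
    exact ENNReal.inv_ne_top.2 (tsub_pos_of_lt hlt).ne'
  have hle : ∀ (n : ℕ) (k : ℤ), (n : ℝ) ≤ |(k : ℝ)| →
      (2 : ℝ≥0∞) ^ (-(r * |(k : ℝ)|)) ≤ ((2 : ℝ≥0∞) ^ (-r)) ^ n := fun n k h ↦ by
    rw [← ENNReal.rpow_natCast, ← ENNReal.rpow_mul]
    exact two_rpow_mono (by nlinarith)
  rw [tsum_of_nat_of_neg_add_one ENNReal.summable ENNReal.summable]
  refine ENNReal.add_ne_top.2 ⟨?_, ?_⟩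
  · refine ne_top_of_le_ne_top hg (ENNReal.tsum_le_tsum fun n ↦ hle n _ ?_)
    simp
  · refine ne_top_of_le_ne_top hg (ENNReal.tsum_le_tsum fun n ↦ hle n _ ?_)
    push_cast
    rw [abs_neg, abs_of_nonneg (by positivity)]
    linarith

theorem le_sqrt_tsum (b : ℤ → ℝ≥0∞) (k : ℤ) : b k ≤ (∑' k, b k ^ 2) ^ (1 / 2 : ℝ) := by
  refine le_of_sq_le ?_
  rw [sqrt_sq]
  exact ENNReal.le_tsum (f := fun k ↦ b k ^ 2) k

theorem tsum_blocks_le (w : ℤ → ℝ≥0∞) (β : ℤ → ℤ → ℝ≥0∞) :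
    ∑' q : {q : ℤ × ℤ // q.2 - 1 ≤ q.1}, w q.1.1 * β q.1.1 q.1.2 ≤
      (∑' k, w k) * ∑' l, (∑' k, β k l ^ 2) ^ (1 / 2 : ℝ) := by
  calc _ ≤ ∑' q : ℤ × ℤ, w q.1 * β q.1 q.2 :=
        ENNReal.tsum_comp_le_tsum_of_injective Subtype.val_injective
          fun q : ℤ × ℤ ↦ w q.1 * β q.1 q.2
    _ = ∑' k, ∑' l, w k * β k l := ENNReal.tsum_prod (f := fun k l ↦ w k * β k l)
    _ ≤ ∑' k, ∑' l, w k * (∑' k, β k l ^ 2) ^ (1 / 2 : ℝ) := by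
        gcongr with k l
        exact le_sqrt_tsum (fun k ↦ β k l) k
    _ = _ := by simp_rw [ENNReal.tsum_mul_left, ENNReal.tsum_mul_right]

theorem exp_mul_le {c y : ℝ} (hc : 0 < c) (hy : 0 < y) :
    Real.exp (-(c * y ^ 2 / 8)) * (y + y * y) ≤ (2 + 256 / c ^ 2) * min y y⁻¹ := by
  have hD : 0 < 256 / c ^ 2 := by positivity
  have h1 : Real.exp (-(c * y ^ 2 / 8)) ≤ 1 := Real.exp_le_one_iff.2 (by
    rw [neg_nonpos]; positivity)
  rcases le_total y 1 with h | h
  · rw [min_eq_left (h.trans ((one_le_inv₀ hy).2 h))]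
    calc _ ≤ 1 * (y + y * 1) := by gcongr
      _ ≤ (2 + 256 / c ^ 2) * y := by nlinarith
  · rw [min_eq_right ((inv_le_one_of_one_le₀ h).trans h)]
    have h2 : Real.exp (-(c * y ^ 2 / 8)) ≤ 128 / c ^ 2 * (y⁻¹) ^ 4 := by
      have h3 := Real.quadratic_le_exp_of_nonneg (show 0 ≤ c * y ^ 2 / 8 by positivity)
      have h4 : (c * y ^ 2 / 8) ^ 2 / 2 ≤ Real.exp (c * y ^ 2 / 8) := by
        have : 0 ≤ c * y ^ 2 / 8 := by positivity
        linarith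
      rw [Real.exp_neg]
      refine (inv_anti₀ (by positivity) h4).trans (le_of_eq ?_)
      field_simp
      norm_num
    calc _ ≤ 128 / c ^ 2 * (y⁻¹) ^ 4 * (y * y + y * y) := by
          gcongr
          exact le_mul_of_one_le_left hy.le h
      _ = 256 / c ^ 2 * (y⁻¹ * y⁻¹) := by field_simp; norm_num
      _ ≤ 256 / c ^ 2 * (y⁻¹ * 1) := by
          gcongr
          exact inv_le_one_of_one_le₀ h
      _ ≤ _ := by
          rw [mul_one]
          gcongr
          linarith

theorem min_two_zpow (k : ℤ) : min ((2 : ℝ) ^ k) ((2 : ℝ) ^ k)⁻¹ = 2 ^ (-(1 * |(k : ℝ)|)) := by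
  rw [← Real.rpow_intCast, ← Real.rpow_neg (by norm_num), one_mul]
  rcases le_total 0 (k : ℝ) with h | h
  · rw [abs_of_nonneg h, min_eq_right]
    exact Real.rpow_le_rpow_of_exponent_le (by norm_num) (by linarith)
  · rw [abs_of_nonpos h, neg_neg, min_eq_left]
    exact Real.rpow_le_rpow_of_exponent_le (by norm_num) (by linarith)

theorem ofReal_min_two_zpow (k : ℤ) : ENNReal.ofReal (min ((2 : ℝ) ^ k) ((2 : ℝ) ^ k)⁻¹) =
    2 ^ (-(1 * |(k : ℝ)|)) := by
  rw [min_two_zpow, ← ENNReal.ofReal_rpow_of_pos (by norm_num)]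
  norm_num

/-- For a positive time, `c = ν_h t > 0`, the heat decay makes the sup norms `2^k` of the blocks and
`4^k` of their derivatives summable over the horizontal frequencies. -/
theorem exists_heatDecay_mul_le {c : ℝ} (hc : 0 < c) : ∃ D : ℝ≥0∞, D ≠ ⊤ ∧ ∀ k : ℤ,
    heatDecay (c * (2 ^ k) ^ 2) * (2 ^ (k : ℝ) + 2 ^ (k : ℝ) * 2 ^ (k : ℝ)) ≤
      D * 2 ^ (-(1 * |(k : ℝ)|)) := by
  refine ⟨ENNReal.ofReal (2 + 256 / c ^ 2), ENNReal.ofReal_ne_top, fun k ↦ ?_⟩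
  have hy : (0 : ℝ) < 2 ^ k := by positivity
  rw [heatDecay, ← ofReal_two_zpow, ← ofReal_min_two_zpow, ← ENNReal.ofReal_mul (by positivity),
    ← ENNReal.ofReal_add (by positivity) (by positivity), ← ENNReal.ofReal_mul (by positivity),
    ← ENNReal.ofReal_mul (by positivity)]
  exact ENNReal.ofReal_le_ofReal (exp_mul_le hc hy)

/-! ### Convergence of the series of blocks -/

theorem Represents.const_smul {T : 𝓢'(Space, Vec)} {f : Space → Vec} (h : Represents T f) (c : ℂ) :
    Represents (c • T) fun x ↦ c • f x := by
  refine ⟨h.1.smul c, fun ψ ↦ ?_⟩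
  have e : ∀ x, ψ x • c • f x = c • ψ x • f x := fun x ↦ smul_comm _ _ _
  simp_rw [e]
  refine ⟨(h.2 ψ).1.smul c, ?_⟩
  rw [integral_smul, ← (h.2 ψ).2]
  rfl

/-- The series that defines `a_hh` converges. The blocks with `k < 0` are summable as bounded
functions; those with `k ≥ 0` are horizontal Laplacians of such a family. -/
theorem IsDyadicProfile.summable_highBlock {φ : ℝ → ℝ} (hφ : IsDyadicProfile φ) {p : ℝ}
    (hp : 2 ≤ p) (hp4 : p ≤ 4) {a : 𝓢'(Space, Vec)} (ha : besovNorm φ p a ≠ ⊤) :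
    Summable (highBlock φ a) := by
  obtain ⟨f, β, hf, hβ⟩ := exists_blocks ha
  obtain ⟨C₁, hC₁, H₁⟩ := isCutoff_cutoff.exists_absConv_le
  obtain ⟨C₂, hC₂, H₂⟩ := isCutoff_divCutoff.exists_absConv_le
  -- a family of multipliers of the blocks, weighted so as to be summable in the sup norm
  have aux : ∀ {χ : Space → ℂ} (h : IsCutoff χ) {C : ℝ≥0∞}, C ≠ ⊤ →
      (∀ τ σ : ℝ, 0 ≤ τ → 0 ≤ σ → ∀ p : ℝ, 2 ≤ p → p ≤ 4 →
      ∀ (k l : ℤ) (f : Space → Vec) (β : ℝ≥0∞), StronglyMeasurable f →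
      (2 : ℝ≥0∞) ^ (l : ℝ) * blockMass p k f ≤ β ^ 2 →
      ∀ x, absConv (kernel (blockSymbol h τ σ k l)) f x ≤
        C * heatDecay τ * (2 ^ (k : ℝ) * β)) → ∀ c : ℤ → ℂ,
      (∀ k : ℤ, ‖c k‖ * 2 ^ k ≤ min ((2 : ℝ) ^ k) ((2 : ℝ) ^ k)⁻¹) →
      Summable fun q : {q : ℤ × ℤ // q.2 - 1 ≤ q.1} ↦ c q.1.1 •
        TemperedDistribution.fourierMultiplierCLM Vec (blockSymbol h 0 0 q.1.1 q.1.2)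
          (highBlock φ a q) := by
    intro χ h C hC H c hc
    have hβ1 : ∀ q : {q : ℤ × ℤ // q.2 - 1 ≤ q.1}, β q.1.1 q.1.2 ≠ ⊤ := fun q ↦ by
      refine ne_top_of_le_ne_top ha (le_trans ?_ hβ)
      exact (le_sqrt_tsum (fun k ↦ β k q.1.2) q.1.1).trans
        (ENNReal.le_tsum (f := fun l ↦ (∑' k, β k l ^ 2) ^ (1 / 2 : ℝ)) q.1.2)
    have hb : ∀ (q : {q : ℤ × ℤ // q.2 - 1 ≤ q.1}) x,
        absConv (kernel (blockSymbol h 0 0 q.1.1 q.1.2)) (f q) x ≤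
          C * (2 ^ (q.1.1 : ℝ) * β q.1.1 q.1.2) := fun q x ↦ by
      simpa [heatDecay] using H 0 0 le_rfl le_rfl p hp hp4 q.1.1 q.1.2 (f q) _ (hf q).1 (hf q).2.2 x
    have hbt : ∀ q : {q : ℤ × ℤ // q.2 - 1 ≤ q.1}, C * (2 ^ (q.1.1 : ℝ) * β q.1.1 q.1.2) ≠ ⊤ :=
      fun q ↦ ENNReal.mul_ne_top hC (ENNReal.mul_ne_top (two_rpow_ne_top _) (hβ1 q))
    have hm : ∀ q : {q : ℤ × ℤ // q.2 - 1 ≤ q.1}, AEStronglyMeasurable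
        (fun x ↦ c q.1.1 • kconv (kernel (blockSymbol h 0 0 q.1.1 q.1.2)) (f q) x) volume :=
      fun q ↦ (stronglyMeasurable_kconv (kernel _).continuous
        (hf q).1).aestronglyMeasurable.fun_const_smul _
    have hA : ∀ (q : {q : ℤ × ℤ // q.2 - 1 ≤ q.1}) x,
        ‖c q.1.1 • kconv (kernel (blockSymbol h 0 0 q.1.1 q.1.2)) (f q) x‖ₑ ≤
          C * (2 ^ (-(1 * |(q.1.1 : ℝ)|)) * β q.1.1 q.1.2) := fun q x ↦ by
      rw [enorm_smul]
      calc _ ≤ ‖c q.1.1‖ₑ * (C * (2 ^ (q.1.1 : ℝ) * β q.1.1 q.1.2)) := by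
            gcongr
            exact (enorm_kconv_le _ _ _).trans (hb q x)
        _ = C * ((‖c q.1.1‖ₑ * 2 ^ (q.1.1 : ℝ)) * β q.1.1 q.1.2) := by ring
        _ ≤ _ := by
            gcongr
            rw [← ofReal_norm, ← ofReal_two_zpow, ← ENNReal.ofReal_mul (norm_nonneg _),
              ← ofReal_min_two_zpow]
            exact ENNReal.ofReal_le_ofReal (hc _)
    have hAs : ∑' q : {q : ℤ × ℤ // q.2 - 1 ≤ q.1},
        C * (2 ^ (-(1 * |(q.1.1 : ℝ)|)) * β q.1.1 q.1.2) ≠ ⊤ := by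
      rw [ENNReal.tsum_mul_left]
      refine ENNReal.mul_ne_top hC (ne_top_of_le_ne_top ?_
        (tsum_blocks_le (fun k ↦ 2 ^ (-(1 * |(k : ℝ)|))) β))
      exact ENNReal.mul_ne_top (tsum_two_rpow_neg_abs_ne_top one_pos) (ne_top_of_le_ne_top ha hβ)
    obtain ⟨S, hS, -⟩ := exists_hasSum_of_bounded hm hA hAs fun q ↦
      (represents_fourierMultiplier _ (hf q).1 (hf q).2.1 (hbt q) (hb q)).const_smul _
    exact hS.summable
  have s1 := aux isCutoff_cutoff hC₁ H₁ (fun k ↦ if k < 0 then 1 else 0) fun k ↦ by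
    split_ifs with hk
    · have : (2 : ℝ) ^ k ≤ 1 := zpow_le_one_of_nonpos₀ (by norm_num) hk.le
      rw [min_eq_left (this.trans ((one_le_inv₀ (by positivity)).2 this))]
      simp
    · simp only [norm_zero, zero_mul]
      positivity
  have s2 := aux isCutoff_divCutoff hC₂ H₂ (fun k ↦ if k < 0 then 0 else ((2 ^ k) ^ 2)⁻¹) fun k ↦ by
    split_ifs with hk
    · simp only [norm_zero, zero_mul]
      positivity
    · have : 1 ≤ (2 : ℝ) ^ k := one_le_zpow₀ (by norm_num) (not_lt.1 hk)
      rw [min_eq_right ((inv_le_one_of_one_le₀ this).trans this)]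
      simp only [norm_inv, norm_pow, norm_zpow, Complex.norm_ofNat]
      refine le_of_eq ?_
      field_simp
  have s3 := s2.map (TemperedDistribution.fourierMultiplierCLM Vec horLaplaceSymbol)
    (TemperedDistribution.fourierMultiplierCLM Vec horLaplaceSymbol).continuous
  refine (s1.add s3).congr fun q ↦ ?_
  simp only [Function.comp_apply]
  split_ifs with hk
  · rw [zero_smul, map_zero, add_zero, one_smul]
    exact (hφ.block_eq_cutoff q.1.1 q.1.2 a).symm
  · rw [zero_smul, zero_add]
    exact (hφ.block_eq_horLaplace q.1.1 q.1.2 a).symm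

/-! ### Products of blocks -/

theorem derivScale_le {k l : ℤ} (h : l - 1 ≤ k) (m : Fin 3) :
    ‖(derivScale k l m : ℂ)‖ₑ ≤ 2 * 2 ^ (k : ℝ) := by
  have h0 : 0 ≤ derivScale k l m := by unfold derivScale; positivity
  rw [← ofReal_norm, Complex.norm_real, Real.norm_of_nonneg h0]
  have h1 : derivScale k l m ≤ 2 * 2 ^ k := by
    have : (0 : ℝ) < 2 ^ k := by positivity
    unfold derivScale
    split_ifs
    · calc (2 : ℝ) ^ l ≤ 2 ^ (k + 1) := zpow_le_zpow_right₀ (by norm_num) (by lia)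
        _ = _ := by rw [zpow_add₀ (by norm_num)]; ring
    · linarith
  refine (ENNReal.ofReal_le_ofReal h1).trans (le_of_eq ?_)
  rw [ENNReal.ofReal_mul (by norm_num), ofReal_two_zpow]
  norm_num

theorem eLpNorm_two_le {n : Space → Vec} {F : Space → ℝ≥0∞} {A : ℝ≥0∞} (h : ∀ x, ‖n x‖ₑ ≤ F x)
    (hF : ∫⁻ x, F x ^ 2 ≤ A ^ 2) : eLpNorm n 2 volume ≤ A := by
  rw [eLpNorm_eq_lintegral_rpow_enorm_toReal (by norm_num) (by norm_num)]
  refine le_of_sq_le ?_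
  simp only [ENNReal.toReal_ofNat, ENNReal.rpow_two]
  rw [sqrt_sq]
  refine le_trans (lintegral_mono fun x ↦ ?_) hF
  gcongr
  exact h x

/-- The `L²` norm of the transport term of two heated blocks. -/
theorem exists_eLpNorm_blocks_le : ∃ C : ℝ≥0∞, C ≠ ⊤ ∧
    ∀ τ σ τ' σ' : ℝ, 0 ≤ τ → 0 ≤ σ → 0 ≤ τ' → 0 ≤ σ' →
      ∀ p : ℝ, 2 ≤ p → p ≤ 4 → ∀ (k l k' l' : ℤ) (f f' : Space → Vec) (β β' : ℝ≥0∞),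
      l' - 1 ≤ k' → StronglyMeasurable f → StronglyMeasurable f' →
      (2 : ℝ≥0∞) ^ (l : ℝ) * blockMass p k f ≤ β ^ 2 →
      (2 : ℝ≥0∞) ^ (l' : ℝ) * blockMass p k' f' ≤ β' ^ 2 →
      eLpNorm (fun x ↦ ∑ m, kconv (kernel (blockSymbol isCutoff_cutoff τ σ k l)) f x m •
        (derivScale k' l' m : ℂ) •
          kconv (kernel (blockSymbol (isCutoff_derivCutoff m) τ' σ' k' l')) f' x) 2 volume ≤
        C * (heatDecay τ * heatDecay τ' * 2 ^ (k' : ℝ) *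
          2 ^ (((k : ℝ) + (k' : ℝ) - ((max l l' : ℤ) : ℝ)) / 2) * (β * β')) := by
  choose C hC H using fun m ↦ isCutoff_cutoff.exists_lintegral_mul_le (isCutoff_derivCutoff m)
  refine ⟨∑ m, 2 * C m, ENNReal.sum_ne_top.2 fun m _ ↦ ENNReal.mul_ne_top (by norm_num) (hC m), ?_⟩
  intro τ σ τ' σ' hτ hσ hτ' hσ' p hp hp4 k l k' l' f f' β β' hkl hf hf' hβ hβ'
  set F := kconv (kernel (blockSymbol isCutoff_cutoff τ σ k l)) f with hF
  set G := fun m ↦ kconv (kernel (blockSymbol (isCutoff_derivCutoff m) τ' σ' k' l')) f' with hG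
  have mF : AEStronglyMeasurable F volume :=
    (stronglyMeasurable_kconv (kernel _).continuous hf).aestronglyMeasurable
  have mG : ∀ m, AEStronglyMeasurable (G m) volume := fun m ↦
    (stronglyMeasurable_kconv (kernel _).continuous hf').aestronglyMeasurable
  have e : (fun x ↦ ∑ m, F x m • (derivScale k' l' m : ℂ) • G m x) =
      ∑ m, fun x ↦ F x m • (derivScale k' l' m : ℂ) • G m x := by
    ext1 x; simp
  change eLpNorm (fun x ↦ ∑ m, F x m • (derivScale k' l' m : ℂ) • G m x) 2 volume ≤ _
  rw [e, Finset.sum_mul]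
  refine (eLpNorm_sum_le (fun m _ ↦ ?_) (by norm_num)).trans (Finset.sum_le_sum fun m _ ↦ ?_)
  · have : AEStronglyMeasurable (fun x ↦ F x m) volume :=
      (EuclideanSpace.proj (𝕜 := ℂ) m : Vec →L[ℂ] ℂ).continuous.comp_aestronglyMeasurable mF
    exact this.smul ((mG m).fun_const_smul _)
  · set A := absConv (kernel (blockSymbol isCutoff_cutoff τ σ k l)) f
    set B := absConv (kernel (blockSymbol (isCutoff_derivCutoff m) τ' σ' k' l')) f'
    have hAB := H m τ σ τ' σ' hτ hσ hτ' hσ' p hp hp4 k l k' l' f f' β β' hf hf' hβ hβ'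
    refine eLpNorm_two_le (F := fun x ↦ (2 * 2 ^ (k' : ℝ)) * (A x * B x)) (fun x ↦ ?_) ?_
    · rw [enorm_smul, enorm_smul]
      calc _ ≤ A x * ((2 * 2 ^ (k' : ℝ)) * B x) := by
            gcongr
            · exact (PiLp.enorm_apply_le _ _).trans (enorm_kconv_le _ _ _)
            · exact derivScale_le hkl m
            · exact enorm_kconv_le _ _ _
        _ = _ := by ring
    · simp_rw [mul_pow _ (A _ * B _)]
      have mAB : Measurable fun x ↦ (A x * B x) ^ 2 :=
        ((measurable_absConv _ hf).mul (measurable_absConv _ hf')).pow_const 2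
      rw [lintegral_const_mul _ mAB]
      calc _ ≤ _ := mul_le_mul_right hAB _
        _ = _ := by ring

/-! ### The transport term as a series -/

theorem abs_two_pi_mul_le_of_blockSymbol_ne_zero {χ : Space → ℂ} (h : IsCutoff χ) {τ σ : ℝ}
    {k l : ℤ} {η : Space} (hη : blockSymbol h τ σ k l η ≠ 0) :
    |2 * Real.pi * η 2| ≤ 3 * 2 ^ l := by
  have h1 := ((h.damp τ σ).bounds _ hη).2.2.2
  rw [two_pi_mul_eq l, abs_mul, abs_of_pos (show (0 : ℝ) < 2 ^ l by positivity), mul_comm]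
  rw [dil_two_apply] at h1
  gcongr
  exact abs_le_of_sq_le_sq (by linarith) (by norm_num)

/-- The sum of two frequencies of vertical size `2^l` and `2^{l'}` is not seen by `Δ^v_j` when `j`
is large compared to `l` and `l'`. -/
theorem IsDyadicProfile.verSymbol_add_eq_zero {φ : ℝ → ℝ} (hφ : IsDyadicProfile φ) {j l l' : ℤ}
    (hj : max l l' + 3 ≤ j) {η η' : Space} (h : |2 * Real.pi * η 2| ≤ 3 * 2 ^ l)
    (h' : |2 * Real.pi * η' 2| ≤ 3 * 2 ^ l') :
    verSymbol φ j ((2 * Real.pi) • (η + η')) = 0 := by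
  by_contra hne
  have h1 := (hφ.bounds hne).1
  have e : ((2 * Real.pi) • (η + η') : Space) 2 = 2 * Real.pi * η 2 + 2 * Real.pi * η' 2 := by
    simp
  rw [e, zpow_neg] at h1
  have hM : ∀ i ≤ max l l', (2 : ℝ) ^ i ≤ 2 ^ j / 8 := fun i hi ↦ by
    rw [le_div_iff₀ (by norm_num)]
    calc (2 : ℝ) ^ i * 8 = 2 ^ (i + 3) := by rw [zpow_add₀ (by norm_num)]; norm_num
      _ ≤ 2 ^ j := zpow_le_zpow_right₀ (by norm_num) (by lia)
  have h2 := hM l (le_max_left _ _)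
  have h3 := hM l' (le_max_right _ _)
  have h4 := abs_add_le (2 * Real.pi * η 2) (2 * Real.pi * η' 2)
  have hp : (0 : ℝ) < 2 ^ j := by positivity
  rw [lt_inv_mul_iff₀ hp] at h1
  linarith

/-- The bound, up to a constant, for the `L²` norm of the transport of the block `r.2 = (k', l')` by
the block `r.1 = (k, l)` in the heat flow at time `t`. -/
def pairBound (νh t : ℝ) (β : ℤ → ℤ → ℝ≥0∞) (r : (ℤ × ℤ) × ℤ × ℤ) : ℝ≥0∞ :=
  heatDecay (νh * t * (2 ^ r.1.1) ^ 2) * heatDecay (νh * t * (2 ^ r.2.1) ^ 2) * 2 ^ (r.2.1 : ℝ) *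
    2 ^ (((r.1.1 : ℝ) + (r.2.1 : ℝ) - ((max r.1.2 r.2.2 : ℤ) : ℝ)) / 2) *
    (β r.1.1 r.1.2 * β r.2.1 r.2.2)

theorem summable_of_tsum_enorm_ne_top {ι E : Type*} [NormedAddCommGroup E] [CompleteSpace E]
    {f : ι → E} (h : ∑' i, ‖f i‖ₑ ≠ ⊤) : Summable f :=
  Summable.of_norm (by simpa using ENNReal.summable_toReal h)

/-- The advection term of a field given by a series of bounded functions, with bounded derivatives,
is the series of the products of its terms. -/
theorem exists_isAdvection_hasSum {ι : Type*} [Countable ι] {U : ι → 𝓢'(Space, Vec)}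
    {u : 𝓢'(Space, Vec)} (hu : HasSum U u) {F : ι → Space → Vec} {G : Fin 3 → ι → Space → Vec}
    {A B : ι → ℝ≥0∞} (mF : ∀ i, AEStronglyMeasurable (F i) volume)
    (mG : ∀ m i, AEStronglyMeasurable (G m i) volume) (bF : ∀ i x, ‖F i x‖ₑ ≤ A i)
    (bG : ∀ m i x, ‖G m i x‖ₑ ≤ B i) (sA : ∑' i, A i ≠ ⊤) (sB : ∑' i, B i ≠ ⊤)
    (rF : ∀ i, Represents (U i) (F i))
    (rG : ∀ m i, Represents (∂_{EuclideanSpace.single m (1 : ℝ)} (U i)) (G m i)) :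
    ∃ (N : ι × ι → 𝓢'(Space, Vec)) (S : 𝓢'(Space, Vec)), IsAdvection u S ∧ HasSum N S ∧
      ∀ r, Represents (N r) fun x ↦ ∑ m, F r.1 x m • G m r.2 x := by
  have hdu : ∀ m : Fin 3, HasSum (fun i ↦ ∂_{EuclideanSpace.single m (1 : ℝ)} (U i))
      (∂_{EuclideanSpace.single m (1 : ℝ)} u) := fun m ↦
    (LineDeriv.lineDerivOpCLM ℂ 𝓢'(Space, Vec) (EuclideanSpace.single m (1 : ℝ))).hasSum hu
  have rU : Represents u fun x ↦ ∑' i, F i x := by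
    obtain ⟨S, hS, -, -, h⟩ := exists_hasSum_of_bounded mF bF sA rF
    rwa [hu.unique hS]
  have rdU : ∀ m : Fin 3, Represents (∂_{EuclideanSpace.single m (1 : ℝ)} u)
      fun x ↦ ∑' i, G m i x := fun m ↦ by
    obtain ⟨S, hS, -, -, h⟩ := exists_hasSum_of_bounded (mG m) (bG m) sB (rG m)
    rwa [(hdu m).unique hS]
  have sAB : ∑' r : ι × ι, A r.1 * B r.2 ≠ ⊤ := by
    rw [ENNReal.tsum_prod (f := fun q q' ↦ A q * B q')]
    simp_rw [ENNReal.tsum_mul_left, ENNReal.tsum_mul_right]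
    exact ENNReal.mul_ne_top sA sB
  have bFG : ∀ m (r : ι × ι) x, ‖F r.1 x m • G m r.2 x‖ₑ ≤ A r.1 * B r.2 := fun m r x ↦ by
    rw [enorm_smul]
    gcongr
    · exact (PiLp.enorm_apply_le _ _).trans (bF _ _)
    · exact bG _ _ _
  have bn : ∀ (r : ι × ι) x, ‖∑ m, F r.1 x m • G m r.2 x‖ₑ ≤ 3 * (A r.1 * B r.2) := fun r x ↦ by
    refine (enorm_sum_le _ _).trans ((Finset.sum_le_sum fun m _ ↦ bFG m r x).trans (le_of_eq ?_))
    simp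
  have sn : ∑' r : ι × ι, 3 * (A r.1 * B r.2) ≠ ⊤ := by
    rw [ENNReal.tsum_mul_left]
    exact ENNReal.mul_ne_top (by norm_num) sAB
  have mn : ∀ r : ι × ι, AEStronglyMeasurable (fun x ↦ ∑ m, F r.1 x m • G m r.2 x) volume :=
    fun r ↦ Finset.aestronglyMeasurable_fun_sum _ fun m _ ↦
      ((EuclideanSpace.proj (𝕜 := ℂ) m : Vec →L[ℂ] ℂ).continuous.comp_aestronglyMeasurable
        (mF r.1)).smul (mG m r.2)
  choose N hN using fun r ↦ exists_represents_of_bounded (mn r)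
    (ENNReal.ne_top_of_tsum_ne_top sn r) (bn r)
  obtain ⟨S, hS, -, -, rS⟩ := exists_hasSum_of_bounded mn bn sn hN
  have hn : ∀ x, ∑' r : ι × ι, ∑ m, F r.1 x m • G m r.2 x =
      ∑ m, (∑' q, F q x) m • ∑' q, G m q x := fun x ↦ by
    refine HasSum.tsum_eq (hasSum_sum fun m _ ↦ ?_)
    have s1 : Summable fun q ↦ F q x := summable_of_tsum_enorm_ne_top
      (ne_top_of_le_ne_top sA (ENNReal.tsum_le_tsum fun q ↦ bF q x))
    have s2 : Summable fun q ↦ G m q x := summable_of_tsum_enorm_ne_top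
      (ne_top_of_le_ne_top sB (ENNReal.tsum_le_tsum fun q ↦ bG m q x))
    have s3 : HasSum (fun q ↦ F q x m) ((∑' q, F q x) m) :=
      (EuclideanSpace.proj (𝕜 := ℂ) m : Vec →L[ℂ] ℂ).hasSum s1.hasSum
    have s4 : Summable fun r : ι × ι ↦ F r.1 x m • G m r.2 x := summable_of_tsum_enorm_ne_top
      (ne_top_of_le_ne_top sAB (ENNReal.tsum_le_tsum fun r ↦ bFG m r x))
    obtain ⟨v, hv⟩ := s4
    rwa [HasSum.smul_eq (R := ℂ) (M := Vec) s3 s2.hasSum hv]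
  refine ⟨N, S, ⟨_, _, rU, rdU, ?_⟩, hS, hN⟩
  simp_rw [← hn]
  exact rS

/-- The transport term of the heat flow is the series of the transport terms of its blocks, and
`Δ^v_j` only sees the pairs of blocks with `j < max(l, l') + 3`. -/
theorem IsDyadicProfile.exists_advectionNorm_le {φ : ℝ → ℝ} (hφ : IsDyadicProfile φ) :
    ∃ C : ℝ≥0∞, C ≠ ⊤ ∧ ∀ p : ℝ, 2 ≤ p → p ≤ 4 → ∀ a : 𝓢'(Space, Vec), besovNorm φ p a ≠ ⊤ →
      ∃ β : ℤ → ℤ → ℝ≥0∞, ∑' l, (∑' k, β k l ^ 2) ^ (1 / 2 : ℝ) ≤ besovNorm φ p a ∧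
      ∀ νh ν3 t : ℝ, 0 < νh → 0 ≤ ν3 → 0 < t → ∀ j : ℤ,
        advectionNorm φ j (heatFlow φ νh ν3 a t) ≤
          ∑' r : (ℤ × ℤ) × ℤ × ℤ, if j < max r.1.2 r.2.2 + 3 then C * pairBound νh t β r else 0 := by
  obtain ⟨C₀, hC₀, H₀⟩ := isCutoff_cutoff.exists_absConv_le
  choose C₁ hC₁ H₁ using fun m ↦ (isCutoff_derivCutoff m).exists_absConv_le
  obtain ⟨C₂, hC₂, H₂⟩ := exists_eLpNorm_blocks_le
  obtain ⟨Cφ, hCφ⟩ := hφ.exists_bound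
  have hD₁ : ∑ m, C₁ m ≠ ⊤ := ENNReal.sum_ne_top.2 fun m _ ↦ hC₁ m
  set D₁ := ∑ m, C₁ m with hD₁def
  refine ⟨ENNReal.ofReal Cφ * C₂, ENNReal.mul_ne_top ENNReal.ofReal_ne_top hC₂,
    fun p hp hp4 a ha ↦ ?_⟩
  obtain ⟨f, β, hf, hβ⟩ := exists_blocks ha
  refine ⟨β, hβ, fun νh ν3 t hνh hν3 ht j ↦ ?_⟩
  have hβa : ∑' l, (∑' k, β k l ^ 2) ^ (1 / 2 : ℝ) ≠ ⊤ := ne_top_of_le_ne_top ha hβ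
  have hβ1 : ∀ k l, β k l ≠ ⊤ := fun k l ↦ by
    refine ne_top_of_le_ne_top hβa ?_
    exact (le_sqrt_tsum (fun k ↦ β k l) k).trans
      (ENNReal.le_tsum (f := fun l ↦ (∑' k, β k l ^ 2) ^ (1 / 2 : ℝ)) l)
  let Q := {q : ℤ × ℤ // q.2 - 1 ≤ q.1}
  let τ : Q → ℝ := fun q ↦ νh * t * (2 ^ q.1.1) ^ 2
  let σ : Q → ℝ := fun q ↦ ν3 * t * (2 ^ q.1.2) ^ 2
  have hτ : ∀ q, 0 ≤ τ q := fun q ↦ by positivity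
  have hσ : ∀ q, 0 ≤ σ q := fun q ↦ by positivity
  let M : Q → 𝓢(Space, ℂ) := fun q ↦ blockSymbol isCutoff_cutoff (τ q) (σ q) q.1.1 q.1.2
  let M' : Q → Fin 3 → 𝓢(Space, ℂ) := fun q m ↦
    blockSymbol (isCutoff_derivCutoff m) (τ q) (σ q) q.1.1 q.1.2
  let F : Q → Space → Vec := fun q ↦ kconv (kernel (M q)) (f q)
  let G : Fin 3 → Q → Space → Vec := fun m q x ↦
    (derivScale q.1.1 q.1.2 m : ℂ) • kconv (kernel (M' q m)) (f q) x
  let A : Q → ℝ≥0∞ := fun q ↦ C₀ * heatDecay (τ q) * (2 ^ (q.1.1 : ℝ) * β q.1.1 q.1.2)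
  let A' : Q → ℝ≥0∞ := fun q ↦ D₁ * heatDecay (τ q) * (2 ^ (q.1.1 : ℝ) * β q.1.1 q.1.2)
  let B : Q → ℝ≥0∞ := fun q ↦ 2 * 2 ^ (q.1.1 : ℝ) * A' q
  have hAt : ∀ q, A q ≠ ⊤ := fun q ↦ ENNReal.mul_ne_top (ENNReal.mul_ne_top hC₀
    ENNReal.ofReal_ne_top) (ENNReal.mul_ne_top (two_rpow_ne_top _) (hβ1 _ _))
  have hAt' : ∀ q, A' q ≠ ⊤ := fun q ↦ ENNReal.mul_ne_top (ENNReal.mul_ne_top hD₁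
    ENNReal.ofReal_ne_top) (ENNReal.mul_ne_top (two_rpow_ne_top _) (hβ1 _ _))
  have bM : ∀ q x, absConv (kernel (M q)) (f q) x ≤ A q := fun q x ↦
    H₀ (τ q) (σ q) (hτ q) (hσ q) p hp hp4 _ _ _ _ (hf q).1 (hf q).2.2 x
  have bM' : ∀ q m x, absConv (kernel (M' q m)) (f q) x ≤ A' q := fun q m x ↦ by
    refine (H₁ m (τ q) (σ q) (hτ q) (hσ q) p hp hp4 _ _ _ _ (hf q).1 (hf q).2.2 x).trans ?_
    have : C₁ m ≤ D₁ := Finset.single_le_sum (fun _ _ ↦ zero_le) (Finset.mem_univ m)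
    simp only [A']
    gcongr
  have bF : ∀ q x, ‖F q x‖ₑ ≤ A q := fun q x ↦ (enorm_kconv_le _ _ _).trans (bM q x)
  have bG : ∀ m q x, ‖G m q x‖ₑ ≤ B q := fun m q x ↦ by
    simp only [G, B, enorm_smul]
    gcongr
    · exact derivScale_le q.2 m
    · exact (enorm_kconv_le _ _ _).trans (bM' q m x)
  have mF : ∀ q, AEStronglyMeasurable (F q) volume := fun q ↦
    (stronglyMeasurable_kconv (kernel _).continuous (hf q).1).aestronglyMeasurable
  have mG : ∀ m q, AEStronglyMeasurable (G m q) volume := fun m q ↦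
    (stronglyMeasurable_kconv (kernel _).continuous (hf q).1).aestronglyMeasurable.fun_const_smul _
  -- summability of the sup norms, which uses that `t > 0`
  obtain ⟨D, hD, HD⟩ := exists_heatDecay_mul_le (c := νh * t) (by positivity)
  have hw : ∀ w : ℤ → ℝ≥0∞,
      (∀ k : ℤ, w k ≤ heatDecay (νh * t * (2 ^ k) ^ 2) *
        (2 ^ (k : ℝ) + 2 ^ (k : ℝ) * 2 ^ (k : ℝ))) →
      ∑' q : Q, w q.1.1 * β q.1.1 q.1.2 ≠ ⊤ := fun w hw ↦ by
    refine ne_top_of_le_ne_top (ENNReal.mul_ne_top ?_ hβa) (tsum_blocks_le w β)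
    refine ne_top_of_le_ne_top ?_ (ENNReal.tsum_le_tsum fun k ↦ (hw k).trans (HD k))
    rw [ENNReal.tsum_mul_left]
    exact ENNReal.mul_ne_top hD (tsum_two_rpow_neg_abs_ne_top one_pos)
  have sA : ∑' q, A q ≠ ⊤ := by
    have e : ∀ q : Q, A q =
        C₀ * (heatDecay (νh * t * (2 ^ q.1.1) ^ 2) * 2 ^ (q.1.1 : ℝ) * β q.1.1 q.1.2) :=
      fun q ↦ by simp only [A, τ]; ring
    simp_rw [e]
    rw [ENNReal.tsum_mul_left]
    refine ENNReal.mul_ne_top hC₀ (hw (fun k ↦ heatDecay (νh * t * (2 ^ k) ^ 2) * 2 ^ (k : ℝ))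
      fun k ↦ ?_)
    gcongr
    exact le_self_add
  have sB : ∑' q, B q ≠ ⊤ := by
    have e : ∀ q : Q, B q = 2 * D₁ * (heatDecay (νh * t * (2 ^ q.1.1) ^ 2) *
        (2 ^ (q.1.1 : ℝ) * 2 ^ (q.1.1 : ℝ)) * β q.1.1 q.1.2) :=
      fun q ↦ by simp only [B, A', τ]; ring
    simp_rw [e]
    rw [ENNReal.tsum_mul_left]
    refine ENNReal.mul_ne_top (ENNReal.mul_ne_top (by norm_num) hD₁)
      (hw (fun k ↦ heatDecay (νh * t * (2 ^ k) ^ 2) * (2 ^ (k : ℝ) * 2 ^ (k : ℝ))) fun k ↦ ?_)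
    gcongr
    exact le_add_self
  -- the heat flow and its derivatives are given by series of bounded functions
  have rF : ∀ q, Represents (heat νh ν3 t (highBlock φ a q)) (F q) := fun q ↦ by
    have := represents_fourierMultiplier (M q) (hf q).1 (hf q).2.1 (hAt q) (bM q)
    rw [highBlock, hφ.heat_block hνh.le hν3 ht.le]
    exact this
  have rG : ∀ (m : Fin 3) q, Represents (∂_{EuclideanSpace.single m (1 : ℝ)}
      (heat νh ν3 t (highBlock φ a q))) (G m q) := fun m q ↦ by
    have := (represents_fourierMultiplier (M' q m) (hf q).1 (hf q).2.1 (hAt' q)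
      (bM' q m)).const_smul (derivScale q.1.1 q.1.2 m : ℂ)
    rw [highBlock, hφ.lineDeriv_heat_block hνh.le hν3 ht.le]
    exact this
  have hu : HasSum (fun q ↦ heat νh ν3 t (highBlock φ a q)) (heatFlow φ νh ν3 a t) :=
    (heat νh ν3 t).hasSum (hφ.summable_highBlock hp hp4 ha).hasSum
  obtain ⟨N, S, hadv, hS, hN⟩ := exists_isAdvection_hasSum hu mF mG bF bG sA sB rF rG
  refine (iInf₂_le (f := fun N (_ : IsAdvection _ N) ↦ normL2 (deltaV φ j N)) S hadv).trans ?_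
  -- each product is estimated in `L²`
  have hv : ∀ r : Q × Q, ∃ v : Lp Vec 2 (volume : Measure Space),
      deltaV φ j (N r) = Lp.toTemperedDistribution v ∧
      ‖v‖ₑ ≤ if j < max r.1.1.2 r.2.1.2 + 3 then
        ENNReal.ofReal Cφ * C₂ * pairBound νh t β (r.1.1, r.2.1) else 0 := fun r ↦ by
    split_ifs with hj
    · have h1 := H₂ (τ r.1) (σ r.1) (τ r.2) (σ r.2) (hτ _) (hσ _) (hτ _) (hσ _) p hp hp4
        r.1.1.1 r.1.1.2 r.2.1.1 r.2.1.2 (f r.1) (f r.2) _ _ r.2.2 (hf _).1 (hf _).1 (hf _).2.2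
        (hf _).2.2
      have h2 : eLpNorm (fun x ↦ ∑ m, F r.1 x m • G m r.2 x) 2 volume ≤
          C₂ * pairBound νh t β (r.1.1, r.2.1) := h1
      have h3 : C₂ * pairBound νh t β (r.1.1, r.2.1) ≠ ⊤ := by
        simp only [pairBound, heatDecay]
        exact ENNReal.mul_ne_top hC₂ (ENNReal.mul_ne_top (ENNReal.mul_ne_top (ENNReal.mul_ne_top
          (ENNReal.mul_ne_top ENNReal.ofReal_ne_top ENNReal.ofReal_ne_top) (two_rpow_ne_top _))
          (two_rpow_ne_top _)) (ENNReal.mul_ne_top (hβ1 _ _) (hβ1 _ _)))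
      obtain ⟨v, hv1, hv2⟩ := exists_Lp_fourierMultiplier (hN r) (ne_top_of_le_ne_top h3 h2)
        (hφ.hasTemperateGrowth_verSymbol j) (C := Cφ) fun η ↦ by
          rw [Complex.norm_real]; exact hCφ _
      refine ⟨v, hv1, hv2.trans ?_⟩
      rw [mul_assoc]
      gcongr
    · refine ⟨0, ?_, by simp⟩
      have h0 : Lp.toTemperedDistribution (0 : Lp Vec 2 (volume : Measure Space)) = 0 :=
        map_zero (Lp.toTemperedDistributionCLM Vec volume 2)
      rw [h0]
      refine fourierMultiplier_mul_kconv_eq_zero (M r.1) (M' r.2) (hf r.1).1 (hf r.2).1 (hAt _)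
        (hAt' _) (bM _) (bM' _) (fun m ↦ (derivScale r.2.1.1 r.2.1.2 m : ℂ))
        (hφ.hasTemperateGrowth_verSymbol j) (fun m η η' h h' ↦ ?_) (hN r)
      rw [hφ.verSymbol_add_eq_zero (not_lt.1 hj)
        (abs_two_pi_mul_le_of_blockSymbol_ne_zero _ h)
        (abs_two_pi_mul_le_of_blockSymbol_ne_zero _ h'), Complex.ofReal_zero]
  choose v hv1 hv2 using hv
  refine (normL2_le_tsum ((deltaV φ j).hasSum hS) v hv1).trans
    ((ENNReal.tsum_le_tsum hv2).trans ?_)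
  exact ENNReal.tsum_comp_le_tsum_of_injective (f := fun r : Q × Q ↦ (r.1.1, r.2.1))
    (fun r r' h ↦ Prod.ext (Subtype.ext (Prod.ext_iff.1 h).1) (Subtype.ext (Prod.ext_iff.1 h).2))
    fun r : (ℤ × ℤ) × ℤ × ℤ ↦ if j < max r.1.2 r.2.2 + 3 then
      ENNReal.ofReal Cφ * C₂ * pairBound νh t β r else 0

/-! ### Summation over the frequencies -/

theorem tsum_mul_le_sqrt_mul_sqrt (b c : ℤ → ℝ≥0∞) :
    ∑' k, b k * c k ≤ (∑' k, b k ^ 2) ^ (1 / 2 : ℝ) * (∑' k, c k ^ 2) ^ (1 / 2 : ℝ) := by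
  have h := ENNReal.lintegral_mul_le_Lp_mul_Lq (Measure.count : Measure ℤ) .two_two
    (f := b) (g := c) (measurable_of_countable _).aemeasurable
    (measurable_of_countable _).aemeasurable
  simpa [lintegral_count] using h

/-- Schur's test for the convolution kernel `w(k' - k)`. -/
theorem tsum_kernel_mul_le (w b c : ℤ → ℝ≥0∞) :
    ∑' k, ∑' k', w (k' - k) * (b k * c k') ≤
      (∑' n, w n) * ((∑' k, b k ^ 2) ^ (1 / 2 : ℝ) * (∑' k, c k ^ 2) ^ (1 / 2 : ℝ)) := by
  have e : ∀ k, ∑' k', w (k' - k) * (b k * c k') = ∑' n, w n * (b k * c (k + n)) := fun k ↦ by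
    rw [← (Equiv.addLeft k).tsum_eq]
    simp
  simp_rw [e]
  rw [ENNReal.tsum_comm, ← ENNReal.tsum_mul_right]
  refine ENNReal.tsum_le_tsum fun n ↦ ?_
  rw [ENNReal.tsum_mul_left]
  gcongr
  refine (tsum_mul_le_sqrt_mul_sqrt b fun k ↦ c (k + n)).trans (le_of_eq ?_)
  rw [(Equiv.addRight n).tsum_eq (fun k ↦ c k ^ 2) |>.symm]
  rfl

theorem tsum_pairs_le (w : ℤ → ℝ≥0∞) (β : ℤ → ℤ → ℝ≥0∞) :
    ∑' r : (ℤ × ℤ) × ℤ × ℤ, w (r.2.1 - r.1.1) * (β r.1.1 r.1.2 * β r.2.1 r.2.2) ≤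
      (∑' n, w n) * (∑' l, (∑' k, β k l ^ 2) ^ (1 / 2 : ℝ)) ^ 2 := by
  have e : ∑' r : (ℤ × ℤ) × ℤ × ℤ, w (r.2.1 - r.1.1) * (β r.1.1 r.1.2 * β r.2.1 r.2.2) =
      ∑' l, ∑' l', ∑' k, ∑' k', w (k' - k) * (β k l * β k' l') := by
    rw [ENNReal.tsum_prod (f := fun q q' : ℤ × ℤ ↦ w (q'.1 - q.1) * (β q.1 q.2 * β q'.1 q'.2)),
      ENNReal.tsum_prod (f := fun k l : ℤ ↦ ∑' q' : ℤ × ℤ, w (q'.1 - k) * (β k l * β q'.1 q'.2)),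
      ENNReal.tsum_comm]
    refine tsum_congr fun l ↦ ?_
    refine Eq.trans (tsum_congr fun k ↦ ?_) ENNReal.tsum_comm
    rw [ENNReal.tsum_prod (f := fun k' l' : ℤ ↦ w (k' - k) * (β k l * β k' l')), ENNReal.tsum_comm]
  rw [e]
  calc _ ≤ ∑' l, ∑' l', (∑' n, w n) *
        ((∑' k, β k l ^ 2) ^ (1 / 2 : ℝ) * (∑' k, β k l' ^ 2) ^ (1 / 2 : ℝ)) :=
        ENNReal.tsum_le_tsum fun l ↦ ENNReal.tsum_le_tsum fun l' ↦
          tsum_kernel_mul_le w (fun k ↦ β k l) fun k ↦ β k l'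
    _ = _ := by
        simp_rw [ENNReal.tsum_mul_left, ENNReal.tsum_mul_right]
        rw [sq]

/-- The sum of `2^{j/2}` over `j < m + 3`; the terms are compared with `4 · 2^{m/2} 2^{-|j - m|/2}`. -/
theorem tsum_geometric_lt_le (m : ℤ) :
    ∑' j : ℤ, (if j < m + 3 then (2 : ℝ≥0∞) ^ ((j : ℝ) / 2) else 0) ≤
      2 ^ ((m : ℝ) / 2) * (4 * ∑' i : ℤ, 2 ^ (-(1 / 2 * |(i : ℝ)|))) := by
  rw [← (Equiv.addLeft m).tsum_eq, ← ENNReal.tsum_mul_left, ← ENNReal.tsum_mul_left]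
  refine ENNReal.tsum_le_tsum fun i ↦ ?_
  simp only [Equiv.coe_addLeft, add_lt_add_iff_left]
  split_ifs with hi
  · have h4 : (4 : ℝ≥0∞) = 2 ^ (2 : ℝ) := by rw [ENNReal.rpow_two]; norm_num
    rw [h4, ← two_rpow_add, ← two_rpow_add]
    refine two_rpow_mono ?_
    have : (i : ℝ) ≤ 2 := by exact_mod_cast (by lia : i ≤ 2)
    push_cast
    rcases abs_cases (i : ℝ) with h | h <;> linarith
  · exact zero_le

theorem continuous_heatDecay : Continuous heatDecay :=
  ENNReal.continuous_ofReal.comp (by fun_prop)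

theorem heatDecay_mul (τ τ' : ℝ) : heatDecay τ * heatDecay τ' = heatDecay (τ + τ') := by
  rw [heatDecay, heatDecay, heatDecay, ← ENNReal.ofReal_mul (by positivity), ← Real.exp_add]
  congr 2
  ring

theorem heatDecay_anti {τ τ' : ℝ} (h : τ ≤ τ') : heatDecay τ' ≤ heatDecay τ :=
  ENNReal.ofReal_le_ofReal (Real.exp_le_exp.2 (by linarith))

theorem lintegral_heatDecay {c : ℝ} (hc : 0 < c) :
    ∫⁻ t in Set.Ioi (0 : ℝ), heatDecay (c * t) = ENNReal.ofReal (8 / c) := by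
  have hc8 : -(c / 8) < 0 := by linarith
  have e : ∀ t, heatDecay (c * t) = ENNReal.ofReal (Real.exp (-(c / 8) * t)) := fun t ↦ by
    rw [heatDecay]; congr 2; ring
  simp_rw [e]
  rw [← ofReal_integral_eq_lintegral_ofReal (integrableOn_exp_mul_Ioi hc8 0)
    (.of_forall fun t ↦ (Real.exp_pos _).le), integral_exp_mul_Ioi hc8]
  congr 1
  simp

/-- The time integral gains two horizontal derivatives on the block of higher frequency. -/
theorem lintegral_heatDecay_mul_le {νh : ℝ} (hνh : 0 < νh) (k k' : ℤ) :
    ∫⁻ t in Set.Ioi (0 : ℝ),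
        heatDecay (νh * t * (2 ^ k) ^ 2) * heatDecay (νh * t * (2 ^ k') ^ 2) ≤
      8 * ENNReal.ofReal νh⁻¹ * 2 ^ (-(2 * max (k : ℝ) k')) := by
  set m := max k k' with hm
  have hm2 : ((2 : ℝ) ^ m) ^ 2 ≤ (2 ^ k) ^ 2 + (2 ^ k') ^ 2 := by
    have h1 := sq_nonneg ((2 : ℝ) ^ k)
    have h2 := sq_nonneg ((2 : ℝ) ^ k')
    rcases max_choice k k' with h | h <;> rw [hm, h] <;> linarith
  calc _ ≤ ∫⁻ t in Set.Ioi (0 : ℝ), heatDecay (νh * (2 ^ m) ^ 2 * t) := by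
        refine setLIntegral_mono' measurableSet_Ioi fun t ht ↦ ?_
        rw [heatDecay_mul]
        refine heatDecay_anti ?_
        have : 0 < νh * t := mul_pos hνh ht
        nlinarith
    _ = ENNReal.ofReal (8 / (νh * (2 ^ m) ^ 2)) := lintegral_heatDecay (by positivity)
    _ = _ := by
        have e : (8 : ℝ) / (νh * (2 ^ m) ^ 2) = 8 * νh⁻¹ * (2 : ℝ) ^ (-(2 * (m : ℝ))) := by
          rw [Real.rpow_neg (by norm_num), mul_comm 2 (m : ℝ), Real.rpow_mul (by norm_num),
            Real.rpow_intCast, Real.rpow_two]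
          field_simp
        rw [e, ENNReal.ofReal_mul (by positivity), ENNReal.ofReal_mul (by norm_num),
          ← ENNReal.ofReal_rpow_of_pos (by norm_num), hm]
        push_cast
        norm_num

theorem measurable_pairBound (νh : ℝ) (β : ℤ → ℤ → ℝ≥0∞) (r : (ℤ × ℤ) × ℤ × ℤ) :
    Measurable fun t ↦ pairBound νh t β r := by
  unfold pairBound
  have h : ∀ c : ℝ, Measurable fun t : ℝ ↦ heatDecay (νh * t * c) := fun c ↦
    (continuous_heatDecay.comp (by fun_prop)).measurable
  exact ((((h _).mul (h _)).mul_const _).mul_const _).mul_const _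

theorem tsum_lintegral_pairBound_le {νh : ℝ} (hνh : 0 < νh) (C : ℝ≥0∞) (β : ℤ → ℤ → ℝ≥0∞) :
    ∑' j : ℤ, (2 : ℝ≥0∞) ^ ((j : ℝ) / 2) * ∫⁻ t in Set.Ioi (0 : ℝ),
        ∑' r : (ℤ × ℤ) × ℤ × ℤ, (if j < max r.1.2 r.2.2 + 3 then C * pairBound νh t β r else 0) ≤
      32 * C * (∑' i : ℤ, (2 : ℝ≥0∞) ^ (-(1 / 2 * |(i : ℝ)|))) ^ 2 * ENNReal.ofReal νh⁻¹ *
        (∑' l, (∑' k, β k l ^ 2) ^ (1 / 2 : ℝ)) ^ 2 := by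
  set Z := ∑' i : ℤ, (2 : ℝ≥0∞) ^ (-(1 / 2 * |(i : ℝ)|)) with hZ
  have mP : ∀ (j : ℤ) (r : (ℤ × ℤ) × ℤ × ℤ), Measurable fun t : ℝ ↦
      if j < max r.1.2 r.2.2 + 3 then C * pairBound νh t β r else 0 := fun j r ↦ by
    split_ifs
    · exact (measurable_pairBound νh β r).const_mul C
    · exact measurable_const
  have e : ∀ j : ℤ, (2 : ℝ≥0∞) ^ ((j : ℝ) / 2) * ∫⁻ t in Set.Ioi (0 : ℝ),
      ∑' r : (ℤ × ℤ) × ℤ × ℤ, (if j < max r.1.2 r.2.2 + 3 then C * pairBound νh t β r else 0) =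
      ∑' r : (ℤ × ℤ) × ℤ × ℤ, (if j < max r.1.2 r.2.2 + 3 then (2 : ℝ≥0∞) ^ ((j : ℝ) / 2) else 0) *
        (C * ∫⁻ t in Set.Ioi (0 : ℝ), pairBound νh t β r) := fun j ↦ by
    rw [lintegral_tsum fun r ↦ (mP j r).aemeasurable, ← ENNReal.tsum_mul_left]
    refine tsum_congr fun r ↦ ?_
    split_ifs
    · rw [lintegral_const_mul _ (measurable_pairBound νh β r)]
    · simp
  simp_rw [e]
  rw [ENNReal.tsum_comm]
  simp_rw [ENNReal.tsum_mul_right]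
  have hr : ∀ r : (ℤ × ℤ) × ℤ × ℤ,
      (∑' j : ℤ, if j < max r.1.2 r.2.2 + 3 then (2 : ℝ≥0∞) ^ ((j : ℝ) / 2) else 0) *
        (C * ∫⁻ t in Set.Ioi (0 : ℝ), pairBound νh t β r) ≤
      32 * C * Z * ENNReal.ofReal νh⁻¹ * (2 ^ (-(1 / 2 * |((r.2.1 - r.1.1 : ℤ) : ℝ)|)) *
        (β r.1.1 r.1.2 * β r.2.1 r.2.2)) := by
    rintro ⟨⟨k, l⟩, k', l'⟩
    set m := max l l' with hm
    have h1 : ∫⁻ t in Set.Ioi (0 : ℝ), pairBound νh t β ((k, l), k', l') ≤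
        8 * ENNReal.ofReal νh⁻¹ * 2 ^ (-(2 * max (k : ℝ) k')) * (2 ^ (k' : ℝ) *
          2 ^ (((k : ℝ) + (k' : ℝ) - (m : ℝ)) / 2) * (β k l * β k' l')) := by
      simp only [pairBound, mul_assoc (heatDecay _ * heatDecay _)]
      rw [lintegral_mul_const _ (by unfold heatDecay; fun_prop)]
      gcongr
      exact lintegral_heatDecay_mul_le hνh k k'
    have h2 : (2 : ℝ≥0∞) ^ ((m : ℝ) / 2) * (2 ^ (-(2 * max (k : ℝ) k')) * (2 ^ (k' : ℝ) *
        2 ^ (((k : ℝ) + (k' : ℝ) - (m : ℝ)) / 2))) ≤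
        2 ^ (-(1 / 2 * |((k' - k : ℤ) : ℝ)|)) := by
      rw [← two_rpow_add, ← two_rpow_add, ← two_rpow_add]
      refine two_rpow_mono ?_
      push_cast
      rcases le_total (k : ℝ) k' with h | h
      · rw [max_eq_right h, abs_of_nonneg (by linarith)]; linarith
      · rw [max_eq_left h, abs_of_nonpos (by linarith)]; linarith
    calc _ ≤ 2 ^ ((m : ℝ) / 2) * (4 * Z) * (C * (8 * ENNReal.ofReal νh⁻¹ *
          2 ^ (-(2 * max (k : ℝ) k')) * (2 ^ (k' : ℝ) *
          2 ^ (((k : ℝ) + (k' : ℝ) - (m : ℝ)) / 2) * (β k l * β k' l')))) := by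
          gcongr
          exact tsum_geometric_lt_le m
      _ = 32 * C * Z * ENNReal.ofReal νh⁻¹ * ((2 ^ ((m : ℝ) / 2) * (2 ^ (-(2 * max (k : ℝ) k')) *
          (2 ^ (k' : ℝ) * 2 ^ (((k : ℝ) + (k' : ℝ) - (m : ℝ)) / 2)))) * (β k l * β k' l')) := by
          ring
      _ ≤ _ := by gcongr
  refine (ENNReal.tsum_le_tsum hr).trans ?_
  rw [ENNReal.tsum_mul_left]
  calc _ ≤ 32 * C * Z * ENNReal.ofReal νh⁻¹ *
        (Z * (∑' l, (∑' k, β k l ^ 2) ^ (1 / 2 : ℝ)) ^ 2) := by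
        gcongr
        exact tsum_pairs_le (fun n ↦ 2 ^ (-(1 / 2 * |(n : ℝ)|))) β
    _ = _ := by ring

/-- The estimate of the transport term, before and after exchanging the sum over `j` and the
integral in time. -/
theorem IsDyadicProfile.exists_transport_le {φ : ℝ → ℝ} (hφ : IsDyadicProfile φ) :
    ∃ K : ℝ≥0∞, K ≠ ⊤ ∧ ∀ p : ℝ, 2 ≤ p → p ≤ 4 → ∀ νh ν3 : ℝ, 0 < νh → 0 ≤ ν3 →
      ∀ a : 𝓢'(Space, Vec), besovNorm φ p a ≠ ⊤ →
        ∑' j : ℤ, (2 : ℝ≥0∞) ^ ((j : ℝ) / 2) *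
            ∫⁻ t in Set.Ioi (0 : ℝ), advectionNorm φ j (heatFlow φ νh ν3 a t) ≤
          K * ENNReal.ofReal νh⁻¹ * besovNorm φ p a ^ 2 ∧
        ∫⁻ t in Set.Ioi (0 : ℝ), ∑' j : ℤ, (2 : ℝ≥0∞) ^ ((j : ℝ) / 2) *
            advectionNorm φ j (heatFlow φ νh ν3 a t) ≤
          K * ENNReal.ofReal νh⁻¹ * besovNorm φ p a ^ 2 := by
  obtain ⟨C, hC, H⟩ := hφ.exists_advectionNorm_le
  refine ⟨32 * C * (∑' i : ℤ, (2 : ℝ≥0∞) ^ (-(1 / 2 * |(i : ℝ)|))) ^ 2,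
    ENNReal.mul_ne_top (ENNReal.mul_ne_top (by norm_num) hC)
      (ENNReal.pow_ne_top (tsum_two_rpow_neg_abs_ne_top (by norm_num))),
    fun p hp hp4 νh ν3 hνh hν3 a ha ↦ ?_⟩
  obtain ⟨β, hβ, hadv⟩ := H p hp hp4 a ha
  have hsum := (tsum_lintegral_pairBound_le hνh C β).trans
    (mul_le_mul_right (pow_le_pow_left' hβ 2) _)
  have mB : ∀ j : ℤ, Measurable fun t : ℝ ↦ ∑' r : (ℤ × ℤ) × ℤ × ℤ,
      if j < max r.1.2 r.2.2 + 3 then C * pairBound νh t β r else 0 := fun j ↦ by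
    refine Measurable.tsum fun r ↦ ?_
    split_ifs
    · exact (measurable_pairBound νh β r).const_mul C
    · exact measurable_const
  constructor
  · refine le_trans (ENNReal.tsum_le_tsum fun j ↦ ?_) hsum
    gcongr 2 ^ _ * ?_
    exact setLIntegral_mono' measurableSet_Ioi fun t ht ↦ hadv νh ν3 t hνh hν3 ht j
  · refine le_trans (setLIntegral_mono' measurableSet_Ioi fun t ht ↦
      ENNReal.tsum_le_tsum fun j ↦ mul_le_mul_right (hadv νh ν3 t hνh hν3 ht j) _) ?_
    rw [lintegral_tsum fun j ↦ ((mB j).const_mul _).aemeasurable]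
    simp_rw [lintegral_const_mul _ (mB _)]
    exact hsum

end ANS

end

theorem mainTheorem3 (φ : ℝ → ℝ) (hφ : ANS.IsDyadicProfile φ) :
    (∃ C : ℝ, 0 < C ∧
      ∀ p : ℝ, 2 ≤ p → p ≤ 4 →
      ∀ νh ν3 : ℝ, 0 < νh → 0 ≤ ν3 →
      ∀ a : 𝓢'(ANS.Space, ANS.Vec), ANS.MemBesov φ p a →
        Summable (ANS.highBlock φ a) ∧
        ∑' j : ℤ, (2 : ℝ≥0∞) ^ ((j : ℝ) / 2) *
            ∫⁻ t in Set.Ioi (0 : ℝ), ANS.advectionNorm φ j (ANS.heatFlow φ νh ν3 a t)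
          ≤ ENNReal.ofReal (C * νh⁻¹) * ANS.besovNorm φ p a ^ 2 ∧
        ANS.bracketE φ p νh ν3 ⊤ a
          ≤ ENNReal.ofReal C *
            (ANS.besovNorm φ p a + ENNReal.ofReal (νh⁻¹) * ANS.besovNorm φ p a ^ 2)) ∧
    (∀ c : ℝ, 0 < c → ∃ c' : ℝ, 0 < c' ∧
      ∀ p : ℝ, 2 ≤ p → p ≤ 4 →
      ∀ νh ν3 : ℝ, 0 < νh → 0 ≤ ν3 →
      ∀ a : 𝓢'(ANS.Space, ANS.Vec), ANS.MemBesov φ p a →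
        ANS.besovNorm φ p a ≤ ENNReal.ofReal (c' * νh) →
        ANS.bracketE φ p νh ν3 ⊤ a ≤ ENNReal.ofReal (c * νh)) := by
  obtain ⟨K, hK, H⟩ := hφ.exists_transport_le
  set C : ℝ := K.toReal + 1 with hC
  have hC1 : 1 ≤ C := le_add_of_nonneg_left ENNReal.toReal_nonneg
  have hKC : K ≤ ENNReal.ofReal C := by
    rw [← ENNReal.ofReal_toReal hK]
    exact ENNReal.ofReal_le_ofReal (by linarith)
  have hbr : ∀ p : ℝ, 2 ≤ p → p ≤ 4 → ∀ νh ν3 : ℝ, 0 < νh → 0 ≤ ν3 →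
      ∀ a : 𝓢'(ANS.Space, ANS.Vec), ANS.MemBesov φ p a → ANS.bracketE φ p νh ν3 ⊤ a
          ≤ ENNReal.ofReal C *
            (ANS.besovNorm φ p a + ENNReal.ofReal (νh⁻¹) * ANS.besovNorm φ p a ^ 2) := by
    intro p hp hp4 νh ν3 hνh hν3 a ha
    have h := (H p hp hp4 νh ν3 hνh hν3 a ha.1.ne).2
    have e : {t : ℝ | 0 < t ∧ ENNReal.ofReal t < ⊤} = Set.Ioi 0 := by
      ext t; simp
    rw [ANS.bracketE, e, mul_add, ← mul_assoc]
    refine add_le_add ?_ (h.trans (by gcongr))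
    exact le_mul_of_one_le_left' (by simpa using ENNReal.ofReal_le_ofReal hC1)
  refine ⟨⟨C, by linarith, fun p hp hp4 νh ν3 hνh hν3 a ha ↦
    ⟨hφ.summable_highBlock hp hp4 ha.1.ne, ?_, hbr p hp hp4 νh ν3 hνh hν3 a ha⟩⟩, fun c hc ↦ ?_⟩
  · refine (H p hp hp4 νh ν3 hνh hν3 a ha.1.ne).1.trans ?_
    rw [ENNReal.ofReal_mul (by linarith)]
    gcongr
  · -- with `‖a‖ ≤ c' νh` the bound is `C (c' + c'²) νh`, and `c' ≤ 1` makes this `≤ 2 C c' νh`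
    have hC0 : 0 < C := by linarith
    refine ⟨min 1 (c / (2 * C)), by positivity, fun p hp hp4 νh ν3 hνh hν3 a ha hsmall ↦ ?_⟩
    set c' := min 1 (c / (2 * C)) with hc'
    have h0 : 0 < c' := by positivity
    have h1 : c' ≤ 1 := min_le_left _ _
    have h2 : c' * (2 * C) ≤ c := by
      rw [← le_div_iff₀ (by positivity)]; exact min_le_right _ _
    refine (hbr p hp hp4 νh ν3 hνh hν3 a ha).trans ?_
    calc _ ≤ ENNReal.ofReal C * (ENNReal.ofReal (c' * νh) +
          ENNReal.ofReal νh⁻¹ * ENNReal.ofReal (c' * νh) ^ 2) := by gcongr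
      _ = ENNReal.ofReal (C * (c' * νh + νh⁻¹ * (c' * νh) ^ 2)) := by
          rw [← ENNReal.ofReal_pow (by positivity), ← ENNReal.ofReal_mul (by positivity),
            ← ENNReal.ofReal_add (by positivity) (by positivity), ← ENNReal.ofReal_mul hC0.le]
      _ ≤ _ := by
          refine ENNReal.ofReal_le_ofReal ?_
          have e : C * (c' * νh + νh⁻¹ * (c' * νh) ^ 2) = C * c' * νh * (1 + c') := by
            field_simp
          rw [e]
          calc C * c' * νh * (1 + c') ≤ C * c' * νh * 2 := by gcongr; linarith
            _ = c' * (2 * C) * νh := by ring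
            _ ≤ c * νh := by gcongr
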